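/- Let $n,m\ge 0$, let $\mathfrak g=\mathfrak{osp}(2m+1|2n)$ over $\mathbb C$, with Cartan subalgebra $\mathfrak h$ of diagonal matrices, and let $\pm\delta_i$ ($1\le i\le n$; odd), $0$, $\pm\bar\epsilon_j$ ($1\le j\le m$; even) be the weights of its natural module. Borel subalgebras are those containing $\mathfrak h$: $\mathcal B=\mathfrak h\oplus\bigoplus_{\alpha\in\Phi^+}\mathfrak g_\alpha$ for a positive system $\Phi^+$; its simple roots are the positive roots that are not sums of two positive roots. The standard Borel subalgebra has simple roots $\delta_i-\delta_{i+1}$ ($1\le i<n$), $\delta_n-\bar\epsilon_1$, $\bar\epsilon_j-\bar\epsilon_{j+1}$ ($1\le j<m$), $\bar\epsilon_m$ (with $\delta_n-\bar\epsilon_1$ omitted if $nm=0$, and the last root $\bar\epsilon_m$ replaced by $\delta_n$ if $m=0$). For every Borel subalgebra $\mathcal B$ there are an integer $r\ge1$, integers $d_1,\dots,d_r$ with sum $n$ and $e_1,\dots,e_r$ with sum $m$ (all positive, except that $d_1$ and $e_r$ may be $0$), permutations $s$ of $\{1,\dots,n\}$ and $t$ of $\{1,\dots,m\}$, and signs $\xi_1,\dots,\xi_n,\eta_1,\dots,\eta_m\in\{\pm1\}$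 such that, with $\mathtt d_u=\sum_{a\le u}d_a$ and $\mathtt e_u=\sum_{a\le u}e_a$, the simple roots of $\mathcal B$ are exactly (terms with an index outside its range being omitted) $\xi_i\delta_{s(i)}-\xi_{i+1}\delta_{s(i+1)}$ for $1\le i<n$, $i\notin\{\mathtt d_1,\dots,\mathtt d_r\}$; $\eta_j\bar\epsilon_{t(j)}-\eta_{j+1}\bar\epsilon_{t(j+1)}$ for $1\le j<m$, $j\notin\{\mathtt e_1,\dots,\mathtt e_r\}$; $\xi_{\mathtt d_u}\delta_{s(\mathtt d_u)}-\eta_{1+\mathtt e_{u-1}}\bar\epsilon_{t(1+\mathtt e_{u-1})}$ for $1\le u\le r$ (only $u<r$ if $e_r=0$); $\eta_{\mathtt e_u}\bar\epsilon_{t(\mathtt e_u)}-\xi_{1+\mathtt d_u}\delta_{s(1+\mathtt d_u)}$ for $1\le u<r$; and $\eta_{\mathtt e_r}\bar\epsilon_{t(\mathtt e_r)}$ if $e_r>0$, or $\xi_{\mathtt d_r}\delta_{s(\mathtt d_r)}$ if $e_r=0$. Let $\lambda$ be an $(n|m)$-hook partition, i.e. a partition with $\lambda_{n+1}\le m$,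 and let $\lambda'$ be its conjugate. Put $\lambda^\#=\sum_{i=1}^n\lambda_i\delta_i+\sum_{j=1}^m\nu_j\bar\epsilon_j$, where $(\nu_1,\dots,\nu_m)$ is the conjugate of $(\lambda_{n+1},\lambda_{n+2},\dots)$, and let $L'(\lambda^\#)$ be the irreducible $\mathfrak g$-module of highest weight $\lambda^\#$ with respect to the standard Borel subalgebra. The block Frobenius coordinates $(p_i|q_j)$ of $\lambda$ attached to the data above are $$p_i=\max\{\lambda_i-\mathtt e_u,0\}\ \text{ if } \mathtt d_u<i\le\mathtt d_{u+1},\qquad q_j=\max\{\lambda'_j-\mathtt d_{u+1},0\}\ \text{ if } \mathtt e_u<j\le\mathtt e_{u+1}\qquad(0\le u\le r-1).$$ Theorem. For every Borel subalgebra $\mathcal B$ and all data as above describing its simple roots, the highest weight of $L'(\lambda^\#)$ with respect to $\mathcal B$ exists, is unique, and equals $$\sum_{i=1}^n\xi_i\,p_i\,\delta_{s(i)}+\sum_{j=1}^m\eta_j\,q_j\,\bar\epsilon_{t(j)}.$$ -/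

import Mathlib

open scoped Matrix

noncomputable section

namespace OspB

/-! ### The Lie superalgebra `osp(2m+1|2n)` -/

/-- Indices of the standard basis of the natural module `ℂ^{2m+1|2n}`: the `2n` odd basis vectors
(weights `δ₁, …, δₙ, -δ₁, …, -δₙ`), then the `2m+1` even ones
(weights `0, ε₁, …, εₘ, -ε₁, …, -εₘ`). -/
abbrev Idx (n m : ℕ) : Type := (Fin n ⊕ Fin n) ⊕ (Unit ⊕ (Fin m ⊕ Fin m))

/-- The general linear Lie superalgebra of the natural module, as a vector space. -/
abbrev Gl (n m : ℕ) : Type := Matrix (Idx n m) (Idx n m) ℂ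

/-- Parity of a basis vector. -/
def par {n m : ℕ} : Idx n m → ZMod 2
  | Sum.inl _ => 1
  | Sum.inr _ => 0

/-- The sign `(-1)^a`. -/
def sgn (a : ZMod 2) : ℂ := if a = 0 then 1 else -1

/-- Gram matrix of the even supersymmetric bilinear form: skew-symmetric on the odd part,
symmetric on the even part, and the two parts are orthogonal. -/
def gram (n m : ℕ) : Gl n m :=
  Matrix.fromBlocks (Matrix.J (Fin n) ℂ) 0 0 (LieAlgebra.Orthogonal.JB (Fin m) ℂ)

/-- The homogeneous component of degree `k` of a matrix. -/
def homPart {n m : ℕ} (k : ZMod 2) (A : Gl n m) : Gl n m :=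
  Matrix.of fun i j => if par i + par j = k then A i j else 0

/-- The supercommutator: bilinear, and `A * B - (-1)^{|A||B|} B * A` for homogeneous `A`, `B`
(see `superComm_of_hom`). -/
def superComm {n m : ℕ} (A B : Gl n m) : Gl n m :=
  A * B - ∑ k : ZMod 2, ∑ l : ZMod 2, sgn (k * l) • (homPart l B * homPart k A)

/-- The degree `k` part of `osp(2m+1|2n)`: matrices `A` of degree `k` with
`(A v, w) + (-1)^{k |v|} (v, A w) = 0` for all basis vectors `v`, `w`. -/
def ospHom (n m : ℕ) (k : ZMod 2) : Submodule ℂ (Gl n m) where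
  carrier := {A | (∀ i j, par i + par j ≠ k → A i j = 0) ∧
    ∀ i j, (Aᵀ * gram n m) i j + sgn (k * par i) * (gram n m * A) i j = 0}
  add_mem' := by
    rintro A B ⟨hA, hA'⟩ ⟨hB, hB'⟩
    refine ⟨fun i j h => by simp [hA i j h, hB i j h], fun i j => ?_⟩
    have h1 := hA' i j
    have h2 := hB' i j
    simp only [Matrix.transpose_add, Matrix.add_mul, Matrix.mul_add, Matrix.add_apply]
    linear_combination h1 + h2
  zero_mem' := ⟨fun i j _ => rfl, fun i j => by simp⟩
  smul_mem' := by
    rintro c A ⟨hA, hA'⟩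
    refine ⟨fun i j h => by simp [hA i j h], fun i j => ?_⟩
    have h1 := hA' i j
    simp only [Matrix.transpose_smul, Matrix.smul_mul, Matrix.mul_smul, Matrix.smul_apply,
      smul_eq_mul]
    linear_combination c * h1

/-- The Lie superalgebra `osp(2m+1|2n)`. -/
def osp (n m : ℕ) : Submodule ℂ (Gl n m) := ospHom n m 0 ⊔ ospHom n m 1

theorem sgn_mul_self (a : ZMod 2) : sgn a * sgn a = 1 := by
  unfold sgn; split <;> norm_num

theorem sgn_add (a b : ZMod 2) : sgn (a + b) = sgn a * sgn b := by
  have h : ∀ c : ZMod 2, c = 0 ∨ c = 1 := by decide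
  have h2 : (1 : ZMod 2) + 1 = 0 := by decide
  rcases h a with rfl | rfl <;> rcases h b with rfl | rfl <;> simp [sgn, h2]

theorem ospHom_le_osp (n m : ℕ) (k : ZMod 2) : ospHom n m k ≤ osp n m := by
  fin_cases k
  · exact le_sup_left
  · exact le_sup_right

theorem homPart_add {n m : ℕ} (k : ZMod 2) (A B : Gl n m) :
    homPart k (A + B) = homPart k A + homPart k B := by
  ext i j
  simp only [homPart, Matrix.of_apply, Matrix.add_apply]
  split <;> simp

theorem superComm_add_left {n m : ℕ} (A B C : Gl n m) :
    superComm (A + B) C = superComm A C + superComm B C := by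
  simp only [superComm, homPart_add, Matrix.mul_add, Matrix.add_mul, smul_add,
    Finset.sum_add_distrib]
  abel

theorem superComm_add_right {n m : ℕ} (A B C : Gl n m) :
    superComm A (B + C) = superComm A B + superComm A C := by
  simp only [superComm, homPart_add, Matrix.mul_add, Matrix.add_mul, smul_add,
    Finset.sum_add_distrib]
  abel

theorem homPart_of_hom {n m : ℕ} {k : ZMod 2} {A : Gl n m}
    (hA : ∀ i j, par i + par j ≠ k → A i j = 0) (l : ZMod 2) :
    homPart l A = if l = k then A else 0 := by
  ext i j
  by_cases h : par i + par j = k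
  · subst h
    by_cases h' : l = par i + par j
    · simp [homPart, h']
    · simp [homPart, h', Ne.symm h']
  · have h0 := hA i j h
    simp only [homPart, Matrix.of_apply, h0, ite_self]
    split <;> simp [h0]

theorem superComm_of_hom {n m : ℕ} {k l : ZMod 2} {A B : Gl n m}
    (hA : ∀ i j, par i + par j ≠ k → A i j = 0) (hB : ∀ i j, par i + par j ≠ l → B i j = 0) :
    superComm A B = A * B - sgn (k * l) • (B * A) := by
  unfold superComm
  congr 1
  rw [Finset.sum_eq_single k, Finset.sum_eq_single l]
  · simp [homPart_of_hom hA, homPart_of_hom hB]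
  · intro b _ hb
    simp [homPart_of_hom hB, hb]
  · simp
  · intro b _ hb
    simp [homPart_of_hom hA, hb]
  · simp

theorem superComm_mem_ospHom {n m : ℕ} {k l : ZMod 2} {A B : Gl n m}
    (hA : A ∈ ospHom n m k) (hB : B ∈ ospHom n m l) :
    superComm A B ∈ ospHom n m (k + l) := by
  have key : ∀ {k l : ZMod 2} {A B : Gl n m}, A ∈ ospHom n m k → B ∈ ospHom n m l →
      (∀ i j, par i + par j ≠ k + l → (A * B) i j = 0) ∧
      ∀ i j, ((A * B)ᵀ * gram n m) i j =
        sgn (k * l) * sgn ((k + l) * par i) * (gram n m * (B * A)) i j := by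
    intro k l A B hA hB
    constructor
    · intro i j h
      rw [Matrix.mul_apply]
      refine Finset.sum_eq_zero fun x _ => ?_
      by_cases h1 : par i + par x = k
      · have h2 : par x + par j ≠ l := by
          rintro rfl
          apply h
          rw [← h1]
          generalize par i = a
          generalize par x = b
          generalize par j = c
          revert a b c
          decide
        rw [hB.1 x j h2, mul_zero]
      · rw [hA.1 i x h1, zero_mul]
    · intro i j
      have e1 : ∀ x, (Aᵀ * gram n m) x j = -(sgn (k * par x) * (gram n m * A) x j) :=
        fun x => eq_neg_of_add_eq_zero_left (hA.2 x j)
      have e2 : ∀ x, (Bᵀ * gram n m) i x = -(sgn (l * par i) * (gram n m * B) i x) :=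
        fun x => eq_neg_of_add_eq_zero_left (hB.2 i x)
      have e3 : ∀ x, Bᵀ i x * sgn (k * par x) = sgn (k * l) * sgn (k * par i) * Bᵀ i x := by
        intro x
        by_cases h : par x + par i = l
        · have : k * par x = k * l + k * par i := by
            rw [← h]
            have hd : ∀ c a b : ZMod 2, c * b = c * (b + a) + c * a := by decide
            exact hd _ _ _
          rw [this, sgn_add]
          ring
        · simp [Matrix.transpose_apply, hB.1 x i h]
      have s1 : ((A * B)ᵀ * gram n m) i j = ∑ x, Bᵀ i x * (Aᵀ * gram n m) x j := by
        rw [Matrix.transpose_mul, Matrix.mul_assoc, Matrix.mul_apply]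
      have s2 : ∑ x, Bᵀ i x * (gram n m * A) x j = ∑ x, (Bᵀ * gram n m) i x * A x j := by
        rw [← Matrix.mul_apply, ← Matrix.mul_apply, Matrix.mul_assoc]
      have s3 : (gram n m * (B * A)) i j = ∑ x, (gram n m * B) i x * A x j := by
        rw [← Matrix.mul_assoc, Matrix.mul_apply]
      calc ((A * B)ᵀ * gram n m) i j
          = ∑ x, -(sgn (k * l) * sgn (k * par i)) * (Bᵀ i x * (gram n m * A) x j) := by
            rw [s1]
            refine Finset.sum_congr rfl fun x _ => ?_
            rw [e1 x]
            linear_combination (-(gram n m * A) x j) * e3 x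
        _ = -(sgn (k * l) * sgn (k * par i)) * ∑ x, (Bᵀ * gram n m) i x * A x j := by
            rw [← Finset.mul_sum, s2]
        _ = -(sgn (k * l) * sgn (k * par i)) *
              ∑ x, -sgn (l * par i) * ((gram n m * B) i x * A x j) := by
            congr 1
            refine Finset.sum_congr rfl fun x _ => ?_
            rw [e2 x]
            ring
        _ = _ := by
            rw [← Finset.mul_sum, ← s3, add_mul, sgn_add]
            ring
  rw [superComm_of_hom hA.1 hB.1]
  obtain ⟨h1, h2⟩ := key hA hB
  obtain ⟨h3, h4⟩ := key hB hA
  refine ⟨fun i j h => ?_, fun i j => ?_⟩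
  · simp [h1 i j h, h3 i j (by rwa [add_comm l k])]
  · simp only [Matrix.transpose_sub, Matrix.transpose_smul, Matrix.sub_mul, Matrix.mul_sub,
      Matrix.smul_mul, Matrix.mul_smul, Matrix.sub_apply, Matrix.smul_apply, smul_eq_mul]
    rw [h2 i j, h4 i j, mul_comm l k, add_comm l k]
    have hs := sgn_mul_self (k * l)
    linear_combination (-sgn ((k + l) * par i) * (gram n m * (A * B)) i j) * hs

theorem superComm_mem_osp {n m : ℕ} {A B : Gl n m} (hA : A ∈ osp n m) (hB : B ∈ osp n m) :
    superComm A B ∈ osp n m := by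
  obtain ⟨a, ha, a', ha', rfl⟩ := Submodule.mem_sup.1 hA
  obtain ⟨b, hb, b', hb', rfl⟩ := Submodule.mem_sup.1 hB
  have h : ∀ {k l : ZMod 2} {A B : Gl n m}, A ∈ ospHom n m k → B ∈ ospHom n m l →
      superComm A B ∈ osp n m :=
    fun h h' => ospHom_le_osp n m _ (superComm_mem_ospHom h h')
  rw [superComm_add_left, superComm_add_right, superComm_add_right]
  exact add_mem (add_mem (h ha hb) (h ha hb')) (add_mem (h ha' hb) (h ha' hb'))

/-- The Lie superbracket of `osp(2m+1|2n)`. -/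
def bracket {n m : ℕ} (x y : osp n m) : osp n m :=
  ⟨superComm (x : Gl n m) (y : Gl n m), superComm_mem_osp x.2 y.2⟩

/-! ### Weights, roots and Borel subalgebras -/

/-- The Cartan subalgebra of diagonal matrices. -/
def cartan (n m : ℕ) : Submodule ℂ (osp n m) where
  carrier := {H | ∀ i j, i ≠ j → (H : Gl n m) i j = 0}
  add_mem' := by
    intro A B hA hB i j h
    simp [hA i j h, hB i j h]
  zero_mem' := fun i j _ => rfl
  smul_mem' := by
    intro c A hA i j h
    simp [hA i j h]

/-- Weights: linear functionals on the Cartan subalgebra. -/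
abbrev Weight (n m : ℕ) : Type := Module.Dual ℂ (cartan n m)

/-- The weight `δ_{i+1}`. -/
def δ {n m : ℕ} (i : Fin n) : Weight n m where
  toFun H := ((H : osp n m) : Gl n m) (Sum.inl (Sum.inl i)) (Sum.inl (Sum.inl i))
  map_add' _ _ := rfl
  map_smul' _ _ := rfl

/-- The weight `ε_{j+1}`. -/
def ε {n m : ℕ} (j : Fin m) : Weight n m where
  toFun H := ((H : osp n m) : Gl n m) (Sum.inr (Sum.inr (Sum.inl j))) (Sum.inr (Sum.inr (Sum.inl j)))
  map_add' _ _ := rfl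
  map_smul' _ _ := rfl

theorem homPart_smul {n m : ℕ} (k : ZMod 2) (c : ℂ) (A : Gl n m) :
    homPart k (c • A) = c • homPart k A := by
  ext i j
  simp only [homPart, Matrix.of_apply, Matrix.smul_apply]
  split <;> simp

theorem superComm_smul_right {n m : ℕ} (A : Gl n m) (c : ℂ) (B : Gl n m) :
    superComm A (c • B) = c • superComm A B := by
  simp only [superComm, homPart_smul, Matrix.mul_smul, Matrix.smul_mul, smul_sub,
    Finset.smul_sum, smul_comm c]

/-- The weight space of weight `α` of the adjoint module. -/
def rootSpace {n m : ℕ} (α : Weight n m) : Submodule ℂ (osp n m) where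
  carrier := {x | ∀ H : cartan n m, bracket (H : osp n m) x = α H • x}
  add_mem' := by
    intro x y hx hy H
    rw [smul_add, ← hx H, ← hy H]
    exact Subtype.ext (superComm_add_right _ _ _)
  zero_mem' := by
    intro H
    apply Subtype.ext
    have h := superComm_smul_right ((H : osp n m) : Gl n m) 0 0
    rw [zero_smul, zero_smul] at h
    rw [smul_zero]
    exact h
  smul_mem' := by
    intro c x hx H
    rw [smul_comm, ← hx H]
    exact Subtype.ext (superComm_smul_right _ _ _)

/-- Roots of `osp(2m+1|2n)`. -/
def IsRoot {n m : ℕ} (α : Weight n m) : Prop := α ≠ 0 ∧ rootSpace α ≠ ⊥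

/-- Borel subalgebras (containing the Cartan subalgebra): the sum of the Cartan subalgebra and of
the root spaces of the roots that are positive for a real linear functional vanishing on no
root. -/
def IsBorel {n m : ℕ} (B : Submodule ℂ (osp n m)) : Prop :=
  ∃ f : Weight n m →ₗ[ℝ] ℝ, (∀ α, IsRoot α → f α ≠ 0) ∧
    B = cartan n m ⊔ ⨆ α, ⨆ (_ : IsRoot α ∧ 0 < f α), rootSpace α

/-- The positive roots of a Borel subalgebra. -/
def posRoots {n m : ℕ} (B : Submodule ℂ (osp n m)) : Set (Weight n m) :=
  {α | IsRoot α ∧ rootSpace α ≤ B}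

/-- The simple roots of a Borel subalgebra: the positive roots that are not a sum of two positive
roots. -/
def simpleRoots {n m : ℕ} (B : Submodule ℂ (osp n m)) : Set (Weight n m) :=
  {α | α ∈ posRoots B ∧ ∀ β ∈ posRoots B, ∀ γ ∈ posRoots B, α ≠ β + γ}

/-- The simple roots `δ₁ - δ₂, …, δₙ₋₁ - δₙ, δₙ - ε₁, ε₁ - ε₂, …, εₘ₋₁ - εₘ, εₘ` of the standard
Borel subalgebra (the last one is `δₙ` if `m = 0`). -/
def stdSimpleRoots (n m : ℕ) : Set (Weight n m) :=
  {α | (∃ i i' : Fin n, (i' : ℕ) = i + 1 ∧ α = δ i - δ i') ∨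
    (∃ (i : Fin n) (j : Fin m), (i : ℕ) + 1 = n ∧ (j : ℕ) = 0 ∧ α = δ i - ε j) ∨
    (∃ j j' : Fin m, (j' : ℕ) = j + 1 ∧ α = ε j - ε j') ∨
    (∃ j : Fin m, (j : ℕ) + 1 = m ∧ α = ε j) ∨
    (∃ i : Fin n, m = 0 ∧ (i : ℕ) + 1 = n ∧ α = δ i)}

/-! ### Modules -/

/-- A structure of `osp(2m+1|2n)`-module on a complex vector space `V`: a `ℤ/2`-grading and a
compatible action. -/
structure OspModule (n m : ℕ) (V : Type*) [AddCommGroup V] [Module ℂ V] where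
  deg : ZMod 2 → Submodule ℂ V
  isInternal : DirectSum.IsInternal deg
  act : osp n m →ₗ[ℂ] Module.End ℂ V
  act_deg : ∀ (k l : ZMod 2) (x : osp n m) (v : V),
    (x : Gl n m) ∈ ospHom n m k → v ∈ deg l → act x v ∈ deg (k + l)
  act_bracket : ∀ (k l : ZMod 2) (x y : osp n m),
    (x : Gl n m) ∈ ospHom n m k → (y : Gl n m) ∈ ospHom n m l →
      act (bracket x y) = act x * act y - sgn (k * l) • (act y * act x)

section Modules

variable {n m : ℕ} {V : Type*} [AddCommGroup V] [Module ℂ V]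

/-- Submodules: graded subspaces stable under the action. -/
def OspModule.IsSubmodule (M : OspModule n m V) (W : Submodule ℂ V) : Prop :=
  W ≤ ⨆ k, W ⊓ M.deg k ∧ ∀ (x : osp n m), ∀ v ∈ W, M.act x v ∈ W

def OspModule.IsIrreducible (M : OspModule n m V) : Prop :=
  Nontrivial V ∧ ∀ W : Submodule ℂ V, M.IsSubmodule W → W = ⊥ ∨ W = ⊤

/-- `M` is a highest weight module of highest weight `μ` with respect to `B`: it is generated by a
nonzero vector of weight `μ` that is killed by all positive root spaces. -/
def OspModule.HasHighestWeight (M : OspModule n m V) (B : Submodule ℂ (osp n m))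
    (μ : Weight n m) : Prop :=
  ∃ v : V, v ≠ 0 ∧ (∀ H : cartan n m, M.act (H : osp n m) v = μ H • v) ∧
    (∀ α ∈ posRoots B, ∀ x ∈ rootSpace α, M.act x v = 0) ∧
    ∀ W : Submodule ℂ V, M.IsSubmodule W → v ∈ W → W = ⊤

end Modules

/-! ### Hook partitions

Partitions are Young diagrams; `lam.rowLen i` is the part `λ_{i+1}`, and `lam.colLen j` is the
part `λ'_{j+1}` of the conjugate partition. -/

/-- `(n|m)`-hook partitions: `λ_{n+1} ≤ m`. -/
def IsHook (n m : ℕ) (lam : YoungDiagram) : Prop := lam.rowLen n ≤ m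

/-- The partition `(λ_{n+1}, λ_{n+2}, …)`. -/
def dropRows (n : ℕ) (lam : YoungDiagram) : YoungDiagram where
  cells := (lam.cells.filter fun c => n ≤ c.1).image fun c => (c.1 - n, c.2)
  isLowerSet := by
    rintro ⟨a, b⟩ ⟨a', b'⟩ ⟨h1, h2⟩ h
    simp only [Finset.coe_image, Finset.coe_filter, Set.mem_image, Set.mem_ofPred_eq,
      Prod.mk.injEq, Prod.exists, YoungDiagram.mem_cells] at h ⊢
    obtain ⟨c, d, ⟨hc, hn⟩, rfl, rfl⟩ := h
    simp only at h1 h2 hn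
    exact ⟨a' + n, b', ⟨lam.up_left_mem (by omega) h2 hc, by simp⟩, by simp, rfl⟩

/-- The weight `λ^# = ∑ λ_i δ_i + ∑ ν_j ε_j`, where `ν` is the conjugate of
`(λ_{n+1}, λ_{n+2}, …)`. -/
def hashWeight (n m : ℕ) (lam : YoungDiagram) : Weight n m :=
  ∑ i : Fin n, (lam.rowLen i : ℂ) • δ i + ∑ j : Fin m, ((dropRows n lam).colLen j : ℂ) • ε j

/-! ### Signed `εδ`-sequences and block Frobenius coordinates -/

/-- The combinatorial data of a signed `εδ`-sequence: `d₁` `δ`'s, `e₁` `ε`'s, …, `d_r` `δ`'s,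
`e_r` `ε`'s, with signs `ξ`, `η` and permutations `s`, `t`. Only the values of `d` and `e` at
`1, …, r` matter. -/
structure EpsDelta (n m : ℕ) where
  r : ℕ
  one_le_r : 1 ≤ r
  d : ℕ → ℕ
  e : ℕ → ℕ
  d_pos : ∀ a, 1 < a → a ≤ r → 0 < d a
  e_pos : ∀ a, 1 ≤ a → a < r → 0 < e a
  sum_d : ∑ a ∈ Finset.Icc 1 r, d a = n
  sum_e : ∑ a ∈ Finset.Icc 1 r, e a = m
  s : Equiv.Perm (Fin n)
  t : Equiv.Perm (Fin m)
  ξ : Fin n → ℤˣ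
  η : Fin m → ℤˣ

namespace EpsDelta

variable {n m : ℕ} (D : EpsDelta n m)

/-- `d₁ + ⋯ + d_u`. -/
def dSum (u : ℕ) : ℕ := ∑ a ∈ Finset.Icc 1 u, D.d a

/-- `e₁ + ⋯ + e_u`. -/
def eSum (u : ℕ) : ℕ := ∑ a ∈ Finset.Icc 1 u, D.e a

/-- The signed weight `ξ_i δ_{s(i)}`. -/
def sδ (i : Fin n) : Weight n m := ((D.ξ i : ℤ) : ℂ) • δ (D.s i)

/-- The signed weight `η_j ε_{t(j)}`. -/
def sε (j : Fin m) : Weight n m := ((D.η j : ℤ) : ℂ) • ε (D.t j)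

/-- The simple roots attached to the data. The positions `1, …, n` and `1, …, m` are shifted to
start from `0`. -/
def simpleRoots : Set (Weight n m) :=
  {α | (∃ i i' : Fin n, (i' : ℕ) = i + 1 ∧ (∀ u, 1 ≤ u → u ≤ D.r → (i : ℕ) + 1 ≠ D.dSum u) ∧
      α = D.sδ i - D.sδ i') ∨
    (∃ j j' : Fin m, (j' : ℕ) = j + 1 ∧ (∀ u, 1 ≤ u → u ≤ D.r → (j : ℕ) + 1 ≠ D.eSum u) ∧
      α = D.sε j - D.sε j') ∨
    (∃ u, 1 ≤ u ∧ u ≤ D.r ∧ (u < D.r ∨ 0 < D.e D.r) ∧ ∃ (i : Fin n) (j : Fin m),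
      (i : ℕ) + 1 = D.dSum u ∧ (j : ℕ) = D.eSum (u - 1) ∧ α = D.sδ i - D.sε j) ∨
    (∃ u, 1 ≤ u ∧ u < D.r ∧ ∃ (i : Fin n) (j : Fin m),
      (j : ℕ) + 1 = D.eSum u ∧ (i : ℕ) = D.dSum u ∧ α = D.sε j - D.sδ i) ∨
    (0 < D.e D.r ∧ ∃ j : Fin m, (j : ℕ) + 1 = D.eSum D.r ∧ α = D.sε j) ∨
    (D.e D.r = 0 ∧ ∃ i : Fin n, (i : ℕ) + 1 = D.dSum D.r ∧ α = D.sδ i)}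

/-- The block Frobenius coordinate `p_{i+1} = max (λ_{i+1} - (e₁ + ⋯ + e_u)) 0`, where `u < r` is
the unique index with `d₁ + ⋯ + d_u < i + 1 ≤ d₁ + ⋯ + d_{u+1}`; the sum has one nonzero term at
most, and the subtraction of natural numbers is truncated at `0`. -/
def p (lam : YoungDiagram) (i : Fin n) : ℕ :=
  ∑ u ∈ Finset.range D.r,
    if D.dSum u < (i : ℕ) + 1 ∧ (i : ℕ) + 1 ≤ D.dSum (u + 1) then lam.rowLen i - D.eSum u else 0

/-- The block Frobenius coordinate `q_{j+1} = max (λ'_{j+1} - (d₁ + ⋯ + d_{u+1})) 0`, where `u < r`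
is the unique index with `e₁ + ⋯ + e_u < j + 1 ≤ e₁ + ⋯ + e_{u+1}`. -/
def q (lam : YoungDiagram) (j : Fin m) : ℕ :=
  ∑ u ∈ Finset.range D.r,
    if D.eSum u < (j : ℕ) + 1 ∧ (j : ℕ) + 1 ≤ D.eSum (u + 1) then
      lam.colLen j - D.dSum (u + 1) else 0

/-- The weight `∑ ξ_i p_i δ_{s(i)} + ∑ η_j q_j ε_{t(j)}`. -/
def weight (lam : YoungDiagram) : Weight n m :=
  ∑ i : Fin n, (((D.ξ i : ℤ) : ℂ) * (D.p lam i : ℂ)) • δ (D.s i) +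
    ∑ j : Fin m, (((D.η j : ℤ) : ℂ) * (D.q lam j : ℂ)) • ε (D.t j)

end EpsDelta

end OspB

end

/-! The highest weight is carried from one Borel subalgebra to the next by reflections. A Borel
subalgebra matters only through the order that its functional puts on the weights of the natural
module. As the functional vanishes on no root, this order amounts to a total order of the letters
`δ_i`, `ε_j` and a sign for each of them: a `Chamber` (`Chamber.exists_agrees`). Any two chambers
are joined by exchanges of neighbouring letters and sign changes of the last letter
(`Chamber.induction`), that is, by crossing walls of simple roots. So it suffices to check the
weight at the standard chamber, where it is `λ^#` (`weight_stdEpsDelta`), and to follow it across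
one wall.

Let `v` be a highest weight vector of weight `μ`, let `e`, `f` be root vectors for `α` and `-α`,
where `α` is the simple root of the wall, and put `h = [e, f]`. The last nonzero `f ^ K v` is a
highest weight vector beyond the wall (`IsHighest.reflect`). Indeed `e f ^ (j + 1) v = c (j + 1) f ^
j v` for a recursive sequence `c`. If `c (K + 1)` is its first zero after `c 0`, then `f ^ K v ≠ 0`,
while `f ^ (K + 1) v` is singular for the old chamber, of weight different from `μ`; it vanishes
because an irreducible module has only one highest weight (`IsHighest.weight_unique`). No finiteness
of dimension enters. The recursion is solved in rank one (`exists_coef`): `K = 2 μ(h) / α(h)` for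
`sl₂`; `K` is `0` or `1`, according to whether `μ(h) = 0`, for an isotropic odd root; `K = 2 μ(h)`,
an even number, for `osp(1|2)`.

The combinatorial side is local as well. A letter preceded by `d` letters `δ` and `e` letters `ε`
has coordinate `λ_{d+1} - e` or `λ'_{e+1} - d`, truncated at `0`. Like neighbours exchange their
coordinates, as under an ordinary reflection. For unlike neighbours everything depends on the box in
row `d + 1` and column `e + 1`: if it lies in `λ`, one unit passes from the first letter to the
second; if not, both coordinates are `0` and stay so (`exists_coordAt_swap`). This is the isotropic
rule, since `μ(h)` is then the sum of the two coordinates. A sign change of the last letter negates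
its term of the weight, which is `K = 2c` for the coordinate `c`.

Finally, signed `εδ`-sequences describe all chambers (`Chamber.exists_epsDelta`), with the right
simple roots (`EpsDelta.simpleRoots_chamber`) and coordinates (`EpsDelta.weight_chamber`). -/

noncomputable section

namespace OspB

variable {n m : ℕ}

/-! ### The standard basis and root vectors -/

/-- The index of the basis vector of opposite weight. -/
def bar : Idx n m → Idx n m
  | Sum.inl (Sum.inl i) => Sum.inl (Sum.inr i)
  | Sum.inl (Sum.inr i) => Sum.inl (Sum.inl i)
  | Sum.inr (Sum.inl u) => Sum.inr (Sum.inl u)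
  | Sum.inr (Sum.inr (Sum.inl j)) => Sum.inr (Sum.inr (Sum.inr j))
  | Sum.inr (Sum.inr (Sum.inr j)) => Sum.inr (Sum.inr (Sum.inl j))

/-- The index of the basis vector of weight `0`. -/
def idxZero : Idx n m := Sum.inr (Sum.inl ())

@[simp] theorem bar_bar (a : Idx n m) : bar (bar a) = a := by
  rcases a with (i | i) | (u | (j | j)) <;> rfl

theorem bar_injective : Function.Injective (bar : Idx n m → Idx n m) :=
  Function.LeftInverse.injective bar_bar

@[simp] theorem bar_inj {a b : Idx n m} : bar a = bar b ↔ a = b := bar_injective.eq_iff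

theorem bar_eq_comm {a b : Idx n m} : bar a = b ↔ a = bar b := by
  rw [← bar_inj, bar_bar]

@[simp] theorem bar_idxZero : bar (idxZero : Idx n m) = idxZero := rfl

theorem bar_eq_self {a : Idx n m} : bar a = a ↔ a = idxZero := by
  rcases a with (i | i) | (u | (j | j)) <;> simp [bar, idxZero]

@[simp] theorem par_bar (a : Idx n m) : par (bar a) = par a := by
  rcases a with (i | i) | (u | (j | j)) <;> rfl

/-- The nonzero entry of the Gram matrix in row `a`. -/
def gramEntry (a : Idx n m) : ℂ := gram n m a (bar a)

theorem gram_apply (a b : Idx n m) : gram n m a b = if b = bar a then gramEntry a else 0 := by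
  rcases a with (i | i) | (u | (j | j)) <;> rcases b with (i' | i') | (u' | (j' | j')) <;>
    simp [gramEntry, gram, bar, Matrix.J, LieAlgebra.Orthogonal.JB, LieAlgebra.Orthogonal.JD,
      Matrix.one_apply, eq_comm]
  split_ifs <;> simp

theorem gramEntry_ne_zero (a : Idx n m) : gramEntry a ≠ 0 := by
  rcases a with (i | i) | (u | (j | j)) <;>
    simp [gramEntry, gram, bar, Matrix.J, LieAlgebra.Orthogonal.JB, LieAlgebra.Orthogonal.JD]

theorem gramEntry_bar (a : Idx n m) : gramEntry (bar a) = sgn (par a) * gramEntry a := by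
  rcases a with (i | i) | (u | (j | j)) <;>
    simp [gramEntry, gram, bar, par, sgn, Matrix.J, LieAlgebra.Orthogonal.JB,
      LieAlgebra.Orthogonal.JD]

theorem sgn_ne_zero (a : ZMod 2) : sgn a ≠ 0 := by
  unfold sgn; split <;> norm_num

/-- The ratio of the entries `(bar b, bar a)` and `(a, b)` of an element of `osp`. -/
def ratio (a b : Idx n m) : ℂ := -sgn ((par a + par b) * par b) * (gramEntry a / gramEntry b)

/-- Passing from the entry `(a, b)` to `(bar b, bar a)` is an involution, so the two factors have to
be inverse to each other; the signs in `gramEntry_bar` make them so. -/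
theorem ratio_bar (a b : Idx n m) : ratio (bar b) (bar a) * ratio a b = 1 := by
  unfold ratio
  rw [gramEntry_bar, gramEntry_bar, par_bar, par_bar]
  have ha := gramEntry_ne_zero a
  have hb := gramEntry_ne_zero b
  have sa := sgn_ne_zero (par a)
  have : sgn ((par b + par a) * par a) * sgn ((par a + par b) * par b) * sgn (par b)
      = sgn (par a) := by
    rw [← sgn_add, ← sgn_add]
    congr 1
    generalize par a = x
    generalize par b = y
    revert x y
    decide
  generalize sgn ((par b + par a) * par a) = s₁ at *
  generalize sgn ((par a + par b) * par b) = s₂ at *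
  field_simp
  linear_combination this

theorem ratio_self (a : Idx n m) : ratio a a = -1 := by
  have h : par a + par a = 0 := CharTwo.add_self_eq_zero _
  simp [ratio, h, sgn, gramEntry_ne_zero a]

/-- The Gram matrix is monomial, so each invariance equation links just two entries of `A`. All
later computations use this entrywise form. -/
theorem mem_ospHom_iff {k : ZMod 2} {A : Gl n m} :
    A ∈ ospHom n m k ↔ (∀ a b, par a + par b ≠ k → A a b = 0) ∧
      ∀ a b, A (bar b) (bar a) = ratio a b * A a b := by
  have h1 : ∀ i j, (Aᵀ * gram n m) i j = A (bar j) i * gramEntry (bar j) := by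
    intro i j
    rw [Matrix.mul_apply, Finset.sum_eq_single (bar j)]
    · simp [gram_apply]
    · intro b _ hb
      rw [gram_apply, if_neg, mul_zero]
      intro h
      exact hb (by rw [h, bar_bar])
    · simp
  have h2 : ∀ i j, (gram n m * A) i j = gramEntry i * A (bar i) j := by
    intro i j
    rw [Matrix.mul_apply, Finset.sum_eq_single (bar i)]
    · simp [gram_apply]
    · intro b _ hb
      rw [gram_apply, if_neg hb, zero_mul]
    · simp
  refine and_congr_right fun hpar => ?_
  simp only [h1, h2]
  constructor
  · intro h a b
    by_cases hk : par a + par b = k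
    · have := h b (bar a)
      rw [bar_bar] at this
      subst hk
      unfold ratio
      have hb := gramEntry_ne_zero b
      have hs := sgn_mul_self ((par a + par b) * par b)
      generalize sgn ((par a + par b) * par b) = s at *
      field_simp
      linear_combination s * this - gramEntry b * A (bar b) (bar a) * hs
    · rw [hpar a b hk, hpar, mul_zero]
      rwa [par_bar, par_bar, add_comm]
  · intro h i j
    by_cases hk : par (bar j) + par i = k
    · have := h (bar j) i
      rw [bar_bar] at this
      subst hk
      rw [this, ratio]
      have hb := gramEntry_ne_zero i
      have hs := sgn_mul_self ((par (bar j) + par i) * par i)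
      generalize sgn ((par (bar j) + par i) * par i) = s at *
      field_simp
      linear_combination (-A (bar j) i * gramEntry (bar j)) * hs
    · rw [hpar _ _ hk, hpar (bar i) j]
      · simp
      · rw [par_bar] at hk ⊢
        rwa [add_comm]

theorem homPart_mem_ospHom {A : Gl n m}
    (h : ∀ a b, A (bar b) (bar a) = ratio a b * A a b) (k : ZMod 2) :
    homPart k A ∈ ospHom n m k := by
  rw [mem_ospHom_iff]
  refine ⟨fun a b hab => by simp [homPart, hab], fun a b => ?_⟩
  simp only [homPart, Matrix.of_apply, par_bar, add_comm (par b) (par a)]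
  split
  · exact h a b
  · simp

theorem homPart_zero_add_homPart_one (A : Gl n m) : homPart 0 A + homPart 1 A = A := by
  ext a b
  have h : ∀ c : ZMod 2, c = 0 ∨ c = 1 := by decide
  rcases h (par a + par b) with h | h <;> simp [homPart, h]

/-- The factor `ratio a b` sees the parity of an entry through its indices, so the homogeneous parts
need not be separated. -/
theorem mem_osp_iff {A : Gl n m} :
    A ∈ osp n m ↔ ∀ a b, A (bar b) (bar a) = ratio a b * A a b := by
  constructor
  · intro h a b
    obtain ⟨x, hx, y, hy, rfl⟩ := Submodule.mem_sup.1 h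
    rw [Matrix.add_apply, Matrix.add_apply, (mem_ospHom_iff.1 hx).2, (mem_ospHom_iff.1 hy).2]
    ring
  · intro h
    rw [← homPart_zero_add_homPart_one A]
    exact add_mem (ospHom_le_osp n m 0 (homPart_mem_ospHom h 0))
      (ospHom_le_osp n m 1 (homPart_mem_ospHom h 1))

/-- The matrix `E_{ab}` plus the multiple of `E_{bar b, bar a}` that makes it an element
of `osp`. -/
def rootMatrix (a b : Idx n m) : Gl n m :=
  Matrix.single a b 1 + Matrix.single (bar b) (bar a) (ratio a b)

theorem rootMatrix_apply (a b c d : Idx n m) :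
    rootMatrix a b c d = (if a = c ∧ b = d then 1 else 0) +
      (if bar b = c ∧ bar a = d then ratio a b else 0) := by
  simp [rootMatrix, Matrix.single_apply]

theorem rootMatrix_mem_ospHom (a b : Idx n m) :
    rootMatrix a b ∈ ospHom n m (par a + par b) := by
  rw [mem_ospHom_iff]
  constructor
  · intro c d h
    rw [rootMatrix_apply, if_neg, if_neg, add_zero]
    · rintro ⟨rfl, rfl⟩
      simp [add_comm] at h
    · rintro ⟨rfl, rfl⟩
      exact h rfl
  · intro c d
    rw [rootMatrix_apply, rootMatrix_apply]
    simp only [bar_inj, ← bar_eq_comm (a := a), ← bar_eq_comm (a := b)]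
    rw [add_comm, mul_add]
    simp only [and_comm (a := bar a = d), and_comm (a := b = d)]
    congr 1
    · split_ifs with h
      · rw [h.1, h.2, mul_one]
      · simp
    · split_ifs with h
      · rw [← h.1, ← h.2, ratio_bar]
      · simp

/-- The element `rootMatrix a b` of `osp`; it is a root vector of weight `wt a - wt b`
if `a ≠ b`, and an element of the Cartan subalgebra if `a = b`. -/
def rootVec (a b : Idx n m) : osp n m :=
  ⟨rootMatrix a b, ospHom_le_osp n m _ (rootMatrix_mem_ospHom a b)⟩

theorem rootVec_apply (a b c d : Idx n m) :
    (rootVec a b : Gl n m) c d = (if a = c ∧ b = d then 1 else 0) +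
      (if bar b = c ∧ bar a = d then ratio a b else 0) := rootMatrix_apply a b c d

theorem rootVec_mem_ospHom (a b : Idx n m) :
    (rootVec a b : Gl n m) ∈ ospHom n m (par a + par b) := rootMatrix_mem_ospHom a b

/-- The factor `1 / 2` appears because `(a, b)` and `(bar b, bar a)` contribute the same term. When
these positions coincide, the two summands of `rootMatrix` add up instead. -/
theorem eq_sum_rootVec (x : osp n m) :
    x = ∑ a, ∑ b, ((1 / 2 : ℂ) * (x : Gl n m) a b) • rootVec a b := by
  apply Subtype.ext
  ext c d
  simp only [AddSubmonoidClass.coe_finsetSum, Submodule.coe_smul, Matrix.sum_apply,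
    Matrix.smul_apply, smul_eq_mul, rootVec_apply, mul_add, Finset.sum_add_distrib]
  rw [Finset.sum_eq_single c, Finset.sum_eq_single d, Finset.sum_eq_single (bar d),
    Finset.sum_eq_single (bar c)]
  · have := mem_osp_iff.1 x.2 (bar d) (bar c)
    simp only [bar_bar] at this
    simp only [bar_bar, and_self, if_true]
    linear_combination (1 / 2 : ℂ) * this
  · intro b _ hb
    rw [if_neg, mul_zero]
    rintro ⟨h, -⟩
    exact hb (bar_eq_comm.1 h)
  · simp
  · intro b _ hb
    refine Finset.sum_eq_zero fun e _ => ?_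
    rw [if_neg, mul_zero]
    rintro ⟨-, h⟩
    exact hb (bar_eq_comm.1 h)
  · simp
  · intro b _ hb
    rw [if_neg, mul_zero]
    rintro ⟨-, h⟩
    exact hb h
  · simp
  · intro b _ hb
    refine Finset.sum_eq_zero fun e _ => ?_
    rw [if_neg, mul_zero]
    rintro ⟨h, -⟩
    exact hb h
  · simp

theorem rootVec_bar (a b : Idx n m) :
    rootVec (bar b) (bar a) = ratio (bar b) (bar a) • rootVec a b := by
  apply Subtype.ext
  ext c d
  rw [Submodule.coe_smul, Matrix.smul_apply, rootVec_apply, rootVec_apply, smul_eq_mul]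
  simp only [bar_bar]
  have h := ratio_bar a b
  rw [mul_add, mul_ite, mul_ite, h, mul_one, mul_zero, add_comm]
  

/-! ### Weights -/

/-- The weight of a basis vector of the natural module. -/
def wt (c : Idx n m) : Weight n m where
  toFun H := ((H : osp n m) : Gl n m) c c
  map_add' _ _ := rfl
  map_smul' _ _ := rfl

theorem wt_apply (c : Idx n m) (H : cartan n m) : wt c H = ((H : osp n m) : Gl n m) c c := rfl

theorem δ_eq_wt (i : Fin n) : (δ i : Weight n m) = wt (Sum.inl (Sum.inl i)) := rfl

theorem ε_eq_wt (j : Fin m) : (ε j : Weight n m) = wt (Sum.inr (Sum.inr (Sum.inl j))) := rfl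

theorem wt_bar (c : Idx n m) : wt (bar c) = -wt c := by
  ext H
  have := mem_osp_iff.1 (H : osp n m).2 c c
  rw [ratio_self] at this
  rw [wt_apply, this, LinearMap.neg_apply, wt_apply]
  ring

@[simp] theorem wt_idxZero : wt (idxZero : Idx n m) = 0 := by
  have := wt_bar (idxZero : Idx n m)
  rw [bar_idxZero] at this
  ext H
  exact self_eq_neg.1 (congrArg (fun w : Weight n m => w H) this)

/-- The diagonal matrix `E_{aa} - E_{bar a, bar a}`. -/
def diagVec (a : Idx n m) : cartan n m :=
  ⟨rootVec a a, fun c d hcd => by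
    rw [rootVec_apply, if_neg, if_neg, add_zero]
    · rintro ⟨rfl, rfl⟩; exact hcd rfl
    · rintro ⟨rfl, rfl⟩; exact hcd rfl⟩

theorem wt_diagVec (c a : Idx n m) :
    wt c (diagVec a) = (if a = c then 1 else 0) - (if bar a = c then 1 else 0) := by
  rw [wt_apply, diagVec, rootVec_apply, ratio_self]
  simp only [and_self]
  split_ifs <;> ring

theorem wt_injective : Function.Injective (wt : Idx n m → Weight n m) := by
  have key : ∀ a b : Idx n m, a ≠ idxZero → wt a = wt b → a = b := by
    intro a b ha h
    -- At `diagVec a` the weight `wt a` takes the value `1`, every other one `0` or `-1`.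
    have h1 := congrArg (fun w : Weight n m => w (diagVec a)) h
    simp only [wt_diagVec, if_true, bar_eq_self, ha, if_false] at h1
    by_contra hab
    rw [if_neg hab] at h1
    split_ifs at h1 <;> norm_num at h1
  intro a b h
  by_cases ha : a = idxZero
  · by_cases hb : b = idxZero
    · rw [ha, hb]
    · exact (key b a hb h.symm).symm
  · exact key a b ha h

/-- A nonzero sum of two weights of the natural module determines them up to order. -/
theorem eq_or_eq_of_wt_add_wt_eq {a b c d : Idx n m} (h : wt a + wt b = wt c + wt d)
    (h0 : wt a + wt b ≠ 0) : (c = a ∧ d = b) ∨ (c = b ∧ d = a) := by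
  have key : ∀ a b : Idx n m, a ≠ idxZero → wt a + wt b = wt c + wt d → wt a + wt b ≠ 0 →
      (c = a ∧ d = b) ∨ (c = b ∧ d = a) := by
    intro a b ha h h0
    by_cases hca : c = a
    · subst hca
      exact Or.inl ⟨rfl, (wt_injective (add_left_cancel h)).symm⟩
    by_cases hda : d = a
    · subst hda
      rw [add_comm (wt c)] at h
      exact Or.inr ⟨(wt_injective (add_left_cancel h)).symm, rfl⟩
    exfalso
    have hb : bar a ≠ b := by
      rintro rfl
      rw [wt_bar] at h0
      simp at h0
    -- At `diagVec a` the left side is at least `1`, as `b ≠ bar a`, and the right side at most `0`,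
    -- as neither `c` nor `d` is `a`.
    have h1 := congrArg (fun w : Weight n m => w (diagVec a)) h
    simp only [LinearMap.add_apply, wt_diagVec, if_true, bar_eq_self, ha, if_false, hb,
      Ne.symm hca, Ne.symm hda] at h1
    split_ifs at h1 <;> norm_num at h1
  by_cases ha : a = idxZero
  · by_cases hb : b = idxZero
    · simp [ha, hb] at h0
    · rw [add_comm (wt a)] at h h0
      exact (key b a hb h h0).symm
  · exact key a b ha h h0

/-- A nonzero difference of two weights of the natural module determines them up to `bar`. -/
theorem eq_or_eq_of_wt_sub_wt_eq {a b c d : Idx n m} (h : wt c - wt d = wt a - wt b)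
    (hab : a ≠ b) : (c = a ∧ d = b) ∨ (c = bar b ∧ d = bar a) := by
  have h0 : wt a + wt (bar b) ≠ 0 := by
    rw [wt_bar, ← sub_eq_add_neg, sub_ne_zero]
    exact fun h => hab (wt_injective h)
  have := eq_or_eq_of_wt_add_wt_eq (a := a) (b := bar b) (c := c) (d := bar d)
    (by rw [wt_bar, wt_bar, ← sub_eq_add_neg, ← sub_eq_add_neg, h]) h0
  rw [bar_inj, bar_eq_comm] at this
  exact this

/-! ### Root spaces -/

/-- Diagonal matrices are even, so the supercommutator is the ordinary commutator here. -/
theorem superComm_diag_apply {H : Gl n m} (hH : ∀ i j, i ≠ j → H i j = 0) (x : Gl n m)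
    (a b : Idx n m) : superComm H x a b = (H a a - H b b) * x a b := by
  have hd : H = Matrix.diagonal fun i => H i i := by
    ext i j
    by_cases h : i = j
    · subst h; simp
    · rw [hH i j h, Matrix.diagonal_apply_ne _ h]
  have h0 : ∀ k, homPart k H = if k = 0 then H else 0 := by
    intro k
    apply homPart_of_hom
    intro i j hij
    apply hH
    rintro rfl
    exact hij (CharTwo.add_self_eq_zero _)
  have hs : superComm H x = H * x - x * H := by
    have h2 : ∀ f : ZMod 2 → Gl n m, ∑ k : ZMod 2, f k = f 0 + f 1 := Fin.sum_univ_two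
    unfold superComm
    simp only [h2, h0, zero_mul, if_true, one_ne_zero, if_false, Matrix.mul_zero, smul_zero,
      add_zero]
    conv_rhs => rw [← homPart_zero_add_homPart_one x]
    conv_rhs => rw [Matrix.add_mul]
    simp [sgn, homPart_zero_add_homPart_one]
  rw [hs, hd, Matrix.sub_apply, Matrix.diagonal_mul, Matrix.mul_diagonal]
  simp
  ring

/-- Root spaces become conditions on the support of a matrix, because a diagonal matrix acts on the
entry `(a, b)` through `wt a - wt b`. -/
theorem mem_rootSpace_iff {α : Weight n m} {x : osp n m} :
    x ∈ rootSpace α ↔ ∀ a b, (x : Gl n m) a b ≠ 0 → wt a - wt b = α := by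
  have h1 : x ∈ rootSpace α ↔ ∀ H : cartan n m, bracket (H : osp n m) x = α H • x := Iff.rfl
  have h2 : ∀ H : cartan n m, bracket (H : osp n m) x = α H • x ↔
      ∀ a b, ((wt a - wt b) H) * (x : Gl n m) a b = α H * (x : Gl n m) a b := by
    intro H
    rw [Subtype.ext_iff, ← Matrix.ext_iff]
    refine forall_congr' fun a => forall_congr' fun b => ?_
    change superComm ((H : osp n m) : Gl n m) (x : Gl n m) a b = _ ↔ _
    rw [superComm_diag_apply H.2]
    rfl
  rw [h1]
  simp only [h2]
  constructor
  · intro h a b hab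
    ext H
    exact mul_right_cancel₀ hab (h H a b)
  · intro h H a b
    by_cases hab : (x : Gl n m) a b = 0
    · rw [hab, mul_zero, mul_zero]
    · rw [h a b hab]

theorem rootVec_mem_rootSpace (a b : Idx n m) : rootVec a b ∈ rootSpace (wt a - wt b) := by
  rw [mem_rootSpace_iff]
  intro c d h
  rw [rootVec_apply] at h
  by_cases h1 : a = c ∧ b = d
  · rw [h1.1, h1.2]
  · rw [if_neg h1] at h
    by_cases h2 : bar b = c ∧ bar a = d
    · rw [← h2.1, ← h2.2, wt_bar, wt_bar]
      abel
    · rw [if_neg h2, add_zero] at h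
      exact absurd rfl h

theorem bracket_mem_rootSpace {α β : Weight n m} {x y : osp n m} (hx : x ∈ rootSpace α)
    (hy : y ∈ rootSpace β) : bracket x y ∈ rootSpace (α + β) := by
  rw [mem_rootSpace_iff] at hx hy ⊢
  intro a b
  contrapose!
  intro hab
  have h1 : ∀ A B : Gl n m, ∀ α' β' : Weight n m, α' + β' = α + β →
      (∀ a b, A a b ≠ 0 → wt a - wt b = α') → (∀ a b, B a b ≠ 0 → wt a - wt b = β') →
      (A * B) a b = 0 := by
    intro A B α' β' hs hA hB
    rw [Matrix.mul_apply]
    refine Finset.sum_eq_zero fun c _ => ?_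
    by_contra hc
    apply hab
    rw [← hs, ← hA a c (left_ne_zero_of_mul hc), ← hB c b (right_ne_zero_of_mul hc)]
    abel
  have h2 : ∀ k (A : Gl n m) (γ : Weight n m), (∀ a b, A a b ≠ 0 → wt a - wt b = γ) →
      ∀ a b, homPart k A a b ≠ 0 → wt a - wt b = γ := by
    intro k A γ hA a b h
    apply hA
    simp only [homPart, Matrix.of_apply, ne_eq, ite_eq_right_iff, Classical.not_imp] at h
    exact h.2
  change superComm (x : Gl n m) (y : Gl n m) a b = 0
  simp only [superComm, Matrix.sub_apply, Matrix.sum_apply, Matrix.smul_apply]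
  rw [h1 _ _ α β rfl hx hy, zero_sub, neg_eq_zero]
  refine Finset.sum_eq_zero fun k _ => Finset.sum_eq_zero fun l _ => ?_
  rw [h1 _ _ β α (add_comm _ _) (h2 l _ _ hy) (h2 k _ _ hx), smul_zero]

/-- The two elementary matrices overlap only if `a = bar b`. Then the coefficients add up to `2` for
odd `a` and cancel for even `a`, which is why the `2δ_i` are roots and the `2ε_j` are not. -/
theorem rootVec_ne_zero {a b : Idx n m} (h : a ≠ bar b ∨ par a = 1) : rootVec a b ≠ 0 := by
  intro h0
  have h1 : (rootVec a b : Gl n m) a b = 0 := by rw [h0]; rfl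
  rw [rootVec_apply, if_pos ⟨rfl, rfl⟩] at h1
  by_cases hab : a = bar b
  · have hp : par a = 1 := h.resolve_left (not_not.2 hab)
    subst hab
    rw [par_bar] at hp
    rw [bar_bar, if_pos ⟨rfl, rfl⟩, ratio, gramEntry_bar, par_bar, hp] at h1
    have := gramEntry_ne_zero b
    have h11 : (1 : ZMod 2) + 1 = 0 := by decide
    simp [sgn, h11, this] at h1
  · rw [if_neg, add_zero] at h1
    · exact one_ne_zero h1
    · rintro ⟨h2, -⟩
      exact hab h2.symm

theorem isRoot_wt_sub_wt {a b : Idx n m} (hab : a ≠ b) (h : a ≠ bar b ∨ par a = 1) :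
    IsRoot (wt a - wt b) :=
  ⟨sub_ne_zero.2 fun h => hab (wt_injective h), fun h0 => rootVec_ne_zero h <| by
    have := rootVec_mem_rootSpace a b
    rwa [h0, Submodule.mem_bot] at this⟩

theorem exists_apply_ne_zero {x : osp n m} (hx : x ≠ 0) : ∃ a b, (x : Gl n m) a b ≠ 0 := by
  by_contra! h
  exact hx (Subtype.ext (by ext a b; exact h a b))

theorem IsRoot.exists_eq {α : Weight n m} (h : IsRoot α) :
    ∃ a b : Idx n m, α = wt a - wt b ∧ a ≠ b ∧ (a ≠ bar b ∨ par a = 1) := by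
  obtain ⟨x, hx, hx0⟩ := Submodule.exists_mem_ne_zero_of_ne_bot h.2
  obtain ⟨a, b, hab⟩ := exists_apply_ne_zero hx0
  have hα := mem_rootSpace_iff.1 hx a b hab
  refine ⟨a, b, hα.symm, ?_, ?_⟩
  · rintro rfl
    exact h.1 (by rw [← hα, sub_self])
  · by_contra! hc
    obtain ⟨rfl, hp⟩ := hc
    apply hab
    -- For even `b` the entry `(bar b, b)` is paired with itself with factor `-1`, hence vanishes.
    have h1 := mem_osp_iff.1 x.2 (bar b) b
    have hr : ratio (bar b) b = -1 := by
      have h11 : par b = 0 := by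
        rw [par_bar] at hp
        generalize par b = c at hp
        revert c
        decide
      rw [ratio, gramEntry_bar, par_bar, h11]
      have := gramEntry_ne_zero b
      simp [sgn, this]
    rw [hr, bar_bar] at h1
    linear_combination (1 / 2 : ℂ) * h1

end OspB

namespace OspB

variable {n m : ℕ} {V : Type*} [AddCommGroup V] [Module ℂ V]

/-! ### Weight spaces of modules -/

theorem cartan_mem_ospHom (H : cartan n m) : ((H : osp n m) : Gl n m) ∈ ospHom n m 0 := by
  rw [mem_ospHom_iff]
  refine ⟨fun a b hab => H.2 a b ?_, mem_osp_iff.1 (H : osp n m).2⟩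
  rintro rfl
  exact hab (CharTwo.add_self_eq_zero _)

theorem cartan_mem_rootSpace (H : cartan n m) : (H : osp n m) ∈ rootSpace (0 : Weight n m) := by
  rw [mem_rootSpace_iff]
  intro a b hab
  by_cases h : a = b
  · rw [h, sub_self]
  · exact absurd (H.2 a b h) hab

namespace OspModule

variable (M : OspModule n m V)

/-- The space of vectors of weight `μ`. -/
def weightSpace (μ : Weight n m) : Submodule ℂ V :=
  ⨅ H : cartan n m, (M.act (H : osp n m)).eigenspace (μ H)

variable {M}

theorem mem_weightSpace {μ : Weight n m} {v : V} :
    v ∈ M.weightSpace μ ↔ ∀ H : cartan n m, M.act (H : osp n m) v = μ H • v := by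
  simp [weightSpace]

theorem act_mem_weightSpace {k : ZMod 2} {α μ : Weight n m} {x : osp n m} {v : V}
    (hxk : (x : Gl n m) ∈ ospHom n m k) (hx : x ∈ rootSpace α) (hv : v ∈ M.weightSpace μ) :
    M.act x v ∈ M.weightSpace (α + μ) := by
  rw [mem_weightSpace] at hv ⊢
  intro H
  have h := M.act_bracket 0 k (H : osp n m) x (cartan_mem_ospHom H) hxk
  have hb : bracket (H : osp n m) x = α H • x := hx H
  rw [hb, zero_mul, sgn, if_pos rfl, one_smul] at h
  have h' := congrArg (fun T : Module.End ℂ V => T v) h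
  simp only [map_smul, LinearMap.smul_apply, LinearMap.sub_apply, Module.End.mul_apply,
    hv H] at h'
  rw [LinearMap.add_apply, add_smul, h']
  abel

/-- The Cartan subalgebra acts by commuting operators, and weight spaces lie in their joint
generalized eigenspaces, which are independent in any dimension. -/
theorem iSupIndep_weightSpace : iSupIndep M.weightSpace := by
  have hc : ∀ H H' : cartan n m, Commute (M.act (H : osp n m)) (M.act (H' : osp n m)) := by
    intro H H'
    have h := M.act_bracket 0 0 (H : osp n m) H' (cartan_mem_ospHom H) (cartan_mem_ospHom H')
    have hb : bracket (H : osp n m) H' = (0 : Weight n m) H • (H' : osp n m) :=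
      cartan_mem_rootSpace H' H
    rw [hb, zero_mul, sgn, if_pos rfl, one_smul, LinearMap.zero_apply, zero_smul, map_zero] at h
    exact (sub_eq_zero.1 h.symm)
  have h1 := Module.End.independent_iInf_maxGenEigenspace_of_forall_mapsTo
    (fun H : cartan n m => M.act (H : osp n m))
    (fun H H' φ => Module.End.mapsTo_maxGenEigenspace_of_comm (hc H' H) φ)
  have h2 := h1.comp (f := fun (μ : Weight n m) (H : cartan n m) => μ H)
    (fun μ ν h => LinearMap.ext fun H => congrFun h H)
  refine h2.mono fun μ => ?_
  refine iInf_mono fun H => ?_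
  exact Module.End.genEigenspace_le_maximal _ _ 1

/-! ### Singular vectors -/

variable (M) in
/-- The vector `v` is killed by all elements of `osp` that are strictly upper triangular with
respect to the ordering of the basis by the values of `f` at the weights. -/
def IsSingular (f : Weight n m →ₗ[ℝ] ℝ) (v : V) : Prop :=
  ∀ x : osp n m, (∀ a b, (x : Gl n m) a b ≠ 0 → f (wt b) < f (wt a)) → M.act x v = 0

theorem act_eq_sum (x : osp n m) (v : V) :
    M.act x v = ∑ a, ∑ b, ((1 / 2 : ℂ) * (x : Gl n m) a b) • M.act (rootVec a b) v := by
  conv_lhs => rw [eq_sum_rootVec x]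
  simp [LinearMap.sum_apply]

theorem isSingular_of_rootVec {f : Weight n m →ₗ[ℝ] ℝ} {v : V}
    (h : ∀ a b, f (wt b) < f (wt a) → M.act (rootVec a b) v = 0) : M.IsSingular f v := by
  intro x hx
  rw [act_eq_sum]
  refine Finset.sum_eq_zero fun a _ => Finset.sum_eq_zero fun b _ => ?_
  by_cases hab : (x : Gl n m) a b = 0
  · rw [hab, mul_zero, zero_smul]
  · rw [h a b (hx a b hab), smul_zero]

theorem IsSingular.act_rootVec {f : Weight n m →ₗ[ℝ] ℝ} {v : V} (h : M.IsSingular f v)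
    {a b : Idx n m} (hab : f (wt b) < f (wt a)) : M.act (rootVec a b) v = 0 := by
  refine h _ fun c d hcd => ?_
  have := mem_rootSpace_iff.1 (rootVec_mem_rootSpace a b) c d hcd
  have h2 := congrArg f this
  rw [map_sub, map_sub] at h2
  linarith

variable (M) in
/-- A homogeneous nonzero singular vector of weight `μ`. -/
structure IsHighest (f : Weight n m →ₗ[ℝ] ℝ) (μ : Weight n m) (l : ZMod 2) (v : V) : Prop where
  ne_zero : v ≠ 0
  mem_deg : v ∈ M.deg l
  mem_weightSpace : v ∈ M.weightSpace μ
  isSingular : M.IsSingular f v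

theorem act_act {k l : ZMod 2} {x y : osp n m} (hx : (x : Gl n m) ∈ ospHom n m k)
    (hy : (y : Gl n m) ∈ ospHom n m l) (v : V) :
    M.act x (M.act y v) = M.act (bracket x y) v + sgn (k * l) • M.act y (M.act x v) := by
  rw [M.act_bracket k l x y hx hy]
  simp

theorem exists_ospHom_add (x : osp n m) : ∃ y z : osp n m, (y : Gl n m) ∈ ospHom n m 0 ∧
    (z : Gl n m) ∈ ospHom n m 1 ∧ x = y + z := by
  obtain ⟨y, hy, z, hz, h⟩ := Submodule.mem_sup.1 x.2
  exact ⟨⟨y, ospHom_le_osp _ _ _ hy⟩, ⟨z, ospHom_le_osp _ _ _ hz⟩, hy, hz, Subtype.ext h.symm⟩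

variable (M) in
/-- The smallest subspace containing `w` and stable under the root vectors that are negative
for `f`. -/
def lowerSpan (f : Weight n m →ₗ[ℝ] ℝ) (w : V) : Submodule ℂ V :=
  sInf {W | w ∈ W ∧ ∀ a b, f (wt a) < f (wt b) → ∀ u ∈ W, M.act (rootVec a b) u ∈ W}

section lowerSpan

variable {f : Weight n m →ₗ[ℝ] ℝ} {w : V}

theorem mem_lowerSpan : w ∈ M.lowerSpan f w := by
  rw [lowerSpan, Submodule.mem_sInf]
  exact fun W hW => hW.1

theorem act_mem_lowerSpan {a b : Idx n m} (hab : f (wt a) < f (wt b)) {u : V}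
    (hu : u ∈ M.lowerSpan f w) : M.act (rootVec a b) u ∈ M.lowerSpan f w := by
  rw [lowerSpan, Submodule.mem_sInf] at hu ⊢
  exact fun W hW => hW.2 a b hab u (hu W hW)

theorem lowerSpan_le {W : Submodule ℂ V} (hw : w ∈ W)
    (hW : ∀ a b, f (wt a) < f (wt b) → ∀ u ∈ W, M.act (rootVec a b) u ∈ W) :
    M.lowerSpan f w ≤ W := sInf_le ⟨hw, hW⟩

/-- This replaces the Poincaré–Birkhoff–Witt theorem. The vectors of the span that all of `osp` maps
into the span form a subspace `Z` containing `w`. It is stable under negative root vectors `f`,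
because `x f u = [x, f] u ± f x u` for homogeneous `x`. -/
theorem IsHighest.lowerSpan_stable {μ : Weight n m} {l : ZMod 2}
    (hf : Function.Injective fun c : Idx n m => f (wt c)) (hw : M.IsHighest f μ l w)
    (x : osp n m) {u : V} (hu : u ∈ M.lowerSpan f w) : M.act x u ∈ M.lowerSpan f w := by
  let Z : Submodule ℂ V :=
    { carrier := {u | u ∈ M.lowerSpan f w ∧ ∀ x, M.act x u ∈ M.lowerSpan f w}
      add_mem' := fun {u v} hu hv =>
        ⟨add_mem hu.1 hv.1, fun x => by rw [map_add]; exact add_mem (hu.2 x) (hv.2 x)⟩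
      zero_mem' := ⟨zero_mem _, fun x => by rw [map_zero]; exact zero_mem _⟩
      smul_mem' := fun c u hu =>
        ⟨Submodule.smul_mem _ c hu.1, fun x => by
          rw [map_smul]; exact Submodule.smul_mem _ c (hu.2 x)⟩ }
  have hZ : M.lowerSpan f w ≤ Z := by
    refine lowerSpan_le ⟨mem_lowerSpan, fun x => ?_⟩ fun a b hab u hu =>
      ⟨act_mem_lowerSpan hab hu.1, fun x => ?_⟩
    · rw [act_eq_sum]
      refine sum_mem fun a _ => sum_mem fun b _ => Submodule.smul_mem _ _ ?_
      rcases lt_trichotomy (f (wt a)) (f (wt b)) with h | h | h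
      · exact act_mem_lowerSpan h mem_lowerSpan
      · obtain rfl := hf h
        have := OspModule.mem_weightSpace.1 hw.mem_weightSpace (diagVec a)
        change M.act (rootVec a a) w = _ at this
        rw [this]
        exact Submodule.smul_mem _ _ mem_lowerSpan
      · rw [hw.isSingular.act_rootVec h]
        exact zero_mem _
    · obtain ⟨y, z, hy, hz, rfl⟩ := exists_ospHom_add x
      have key : ∀ k (y : osp n m), (y : Gl n m) ∈ ospHom n m k →
          M.act y (M.act (rootVec a b) u) ∈ M.lowerSpan f w := by
        intro k y hy
        rw [act_act hy (rootVec_mem_ospHom a b)]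
        exact add_mem (hu.2 _) (Submodule.smul_mem _ _ (act_mem_lowerSpan hab (hu.2 y)))
      rw [map_add, LinearMap.add_apply]
      exact add_mem (key 0 y hy) (key 1 z hz)
  exact (hZ hu).2 x

/-- Irreducibility only concerns graded subspaces; this span is graded because `w` and all root
vectors are homogeneous. -/
theorem lowerSpan_le_iSup_deg {l : ZMod 2} (hw : w ∈ M.deg l) :
    M.lowerSpan f w ≤ ⨆ k, M.lowerSpan f w ⊓ M.deg k := by
  have h : M.lowerSpan f w ≤ M.lowerSpan f w ⊓ ⨆ k, M.lowerSpan f w ⊓ M.deg k := by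
    refine lowerSpan_le ⟨mem_lowerSpan, Submodule.mem_iSup_of_mem l ⟨mem_lowerSpan, hw⟩⟩ ?_
    rintro a b hab u ⟨hu, hu'⟩
    refine ⟨act_mem_lowerSpan hab hu, ?_⟩
    clear hu
    induction hu' using Submodule.iSup_induction' with
    | mem k u hu =>
      exact Submodule.mem_iSup_of_mem (par a + par b + k) ⟨act_mem_lowerSpan hab hu.1,
        M.act_deg _ _ _ _ (rootVec_mem_ospHom a b) hu.2⟩
    | zero => rw [map_zero]; exact zero_mem _
    | add u v hu hv h1 h2 =>
      rw [map_add]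
      exact add_mem h1 h2
  exact h.trans inf_le_right

theorem lowerSpan_le_weights {μ : Weight n m} (hw : w ∈ M.weightSpace μ) :
    M.lowerSpan f w ≤ M.weightSpace μ ⊔ ⨆ ν, ⨆ (_ : f ν < f μ), M.weightSpace ν := by
  have key : ∀ a b, f (wt a) < f (wt b) → ∀ ν, f ν ≤ f μ → ∀ u ∈ M.weightSpace ν,
      M.act (rootVec a b) u ∈ ⨆ ν, ⨆ (_ : f ν < f μ), M.weightSpace ν := by
    intro a b hab ν hν u hu
    have h := act_mem_weightSpace (rootVec_mem_ospHom a b) (rootVec_mem_rootSpace a b) hu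
    refine Submodule.mem_iSup_of_mem _ (Submodule.mem_iSup_of_mem ?_ h)
    rw [map_add, map_sub]
    linarith
  refine lowerSpan_le (Submodule.mem_sup_left hw) fun a b hab u hu => ?_
  obtain ⟨u₁, h₁, u₂, h₂, rfl⟩ := Submodule.mem_sup.1 hu
  rw [map_add]
  refine Submodule.mem_sup_right (add_mem (key a b hab μ le_rfl u₁ h₁) ?_)
  clear hu
  induction h₂ using Submodule.iSup_induction' with
  | mem ν u hu =>
    by_cases hν : f ν < f μ
    · rw [iSup_pos hν] at hu
      exact key a b hab ν hν.le u hu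
    · rw [iSup_neg hν, Submodule.mem_bot] at hu
      rw [hu, map_zero]
      exact zero_mem _
  | zero => rw [map_zero]; exact zero_mem _
  | add u v hu hv h1 h2 => rw [map_add]; exact add_mem h1 h2

end lowerSpan

/-- By irreducibility the module is the lower span of `w`, whose weights are `μ` and weights with
smaller value of `f`. Independence of the weight spaces excludes any other. -/
theorem IsHighest.weight_eq_or_lt {f : Weight n m →ₗ[ℝ] ℝ} {μ ν : Weight n m} {l : ZMod 2}
    {w v : V} (hM : M.IsIrreducible) (hf : Function.Injective fun c : Idx n m => f (wt c))
    (hw : M.IsHighest f μ l w) (hv : v ≠ 0) (hv' : v ∈ M.weightSpace ν) :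
    ν = μ ∨ f ν < f μ := by
  by_contra! hcon
  have htop : M.lowerSpan f w = ⊤ := by
    refine (hM.2 _ ⟨lowerSpan_le_iSup_deg hw.mem_deg, fun x v hv =>
      hw.lowerSpan_stable hf x hv⟩).resolve_left fun h => hw.ne_zero ?_
    rw [← Submodule.mem_bot ℂ, ← h]
    exact mem_lowerSpan
  have hle := lowerSpan_le_weights (f := f) hw.mem_weightSpace
  rw [htop, top_le_iff] at hle
  have hdis := iSupIndep_weightSpace (M := M) ν
  apply hv
  rw [← Submodule.mem_bot ℂ]
  refine hdis.le_bot ⟨hv', ?_⟩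
  have h2 : M.weightSpace μ ⊔ ⨆ ν, ⨆ (_ : f ν < f μ), M.weightSpace ν ≤
      ⨆ κ, ⨆ (_ : κ ≠ ν), M.weightSpace κ := by
    refine sup_le (le_iSup₂_of_le μ hcon.1.symm le_rfl) ?_
    refine iSup₂_le fun κ hκ => le_iSup₂_of_le κ ?_ le_rfl
    rintro rfl
    exact absurd hκ (not_lt.2 hcon.2)
  apply h2
  rw [hle]
  exact Submodule.mem_top

theorem IsHighest.weight_unique {f : Weight n m →ₗ[ℝ] ℝ} {μ ν : Weight n m} {l k : ZMod 2}
    {w v : V} (hM : M.IsIrreducible) (hf : Function.Injective fun c : Idx n m => f (wt c))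
    (hw : M.IsHighest f μ l w) (hv : M.IsHighest f ν k v) : ν = μ := by
  rcases hw.weight_eq_or_lt hM hf hv.ne_zero hv.mem_weightSpace with h | h
  · exact h
  rcases hv.weight_eq_or_lt hM hf hw.ne_zero hw.mem_weightSpace with h' | h'
  · exact h'.symm
  · exact absurd h (not_lt.2 h'.le)

/-! ### Reflections -/

/-- The hypothesis makes the mixed products of elementary matrices vanish; what remains is the
coroot, up to normalization. -/
theorem bracket_rootVec {a b : Idx n m} (hab' : a ≠ bar b) :
    bracket (rootVec a b) (rootVec b a) =
      ((diagVec a - sgn (par a + par b) • diagVec b : cartan n m) : osp n m) := by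
  have hr : ratio a b * ratio b a = sgn (par a + par b) := by
    have ha := gramEntry_ne_zero a
    have hb := gramEntry_ne_zero b
    have : sgn ((par a + par b) * par b) * sgn ((par b + par a) * par a)
        = sgn (par a + par b) := by
      rw [← sgn_add]
      congr 1
      generalize par a = x
      generalize par b = y
      revert x y
      decide
    unfold ratio
    generalize sgn ((par b + par a) * par a) = s₁ at *
    generalize sgn ((par a + par b) * par b) = s₂ at *
    field_simp
    linear_combination this
  have hk : (par a + par b) * (par b + par a) = par a + par b := by
    generalize par a = x
    generalize par b = y
    revert x y
    decide
  have h1 : bar a ≠ b := fun h => hab' (bar_eq_comm.1 h)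
  have hs := sgn_mul_self (par a + par b)
  apply Subtype.ext
  change superComm (rootMatrix a b) (rootMatrix b a) =
    rootMatrix a a - sgn (par a + par b) • rootMatrix b b
  rw [superComm_of_hom (rootMatrix_mem_ospHom a b).1 (rootMatrix_mem_ospHom b a).1, hk]
  simp only [rootMatrix, Matrix.add_mul, Matrix.mul_add, Matrix.single_mul_single_same,
    ratio_self, Matrix.single_mul_single_of_ne _ _ _ _ h1,
    Matrix.single_mul_single_of_ne _ _ _ _ h1.symm, Matrix.single_mul_single_of_ne _ _ _ _ hab',
    Matrix.single_mul_single_of_ne _ _ _ _ hab'.symm, mul_one, hr,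
    mul_comm (ratio b a) (ratio a b), add_zero, zero_add, smul_add, Matrix.smul_single,
    smul_eq_mul, hs, mul_neg]
  rw [← Matrix.single_neg, ← Matrix.single_neg]
  abel

/-- This handles `2 wt a`, which changes sign together with `wt a`. For even `a` the left side is
zero; for odd `a` the bracket is twice the square of an odd matrix and spans the root space of `2 wt
a`. -/
theorem exists_rootVec_bar_eq_smul_bracket {a : Idx n m} (ha : a ≠ idxZero) :
    ∃ r : ℂ, rootVec a (bar a) = r • bracket (rootVec a idxZero) (rootVec a idxZero) := by
  have ha' : bar a ≠ a := fun h => ha (bar_eq_self.1 h)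
  have ha0 : bar a ≠ idxZero := fun h => ha (by rw [bar_eq_comm] at h; exact h)
  have h2 : ∀ c : ZMod 2, c = 0 ∨ c = 1 := by decide
  have hg := gramEntry_ne_zero a
  have hr : ratio a (bar a) = -sgn (par a) := by
    have h0 : par a + par a = 0 := CharTwo.add_self_eq_zero _
    have hs := sgn_mul_self (par a)
    have hs' := sgn_ne_zero (par a)
    rw [ratio, gramEntry_bar, par_bar, h0, zero_mul, sgn, if_pos rfl]
    field_simp
    linear_combination hs
  rcases h2 (par a) with h | h
  · refine ⟨0, Subtype.ext ?_⟩
    change Matrix.single a (bar a) 1 + Matrix.single (bar (bar a)) (bar a) (ratio a (bar a)) =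
      (((0 : ℂ) • bracket (rootVec a idxZero) (rootVec a idxZero) : osp n m) : Gl n m)
    rw [hr, h, bar_bar, zero_smul, sgn, if_pos rfl, ← Matrix.single_neg, add_neg_cancel]
    rfl
  · have hr0 : ratio a idxZero ≠ 0 := left_ne_zero_of_mul_eq_one
      ((mul_comm _ _).trans (ratio_bar a idxZero))
    refine ⟨(ratio a idxZero)⁻¹, Subtype.ext ?_⟩
    change Matrix.single a (bar a) 1 + Matrix.single (bar (bar a)) (bar a) (ratio a (bar a)) =
      (ratio a idxZero)⁻¹ • superComm (rootMatrix a idxZero) (rootMatrix a idxZero)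
    have hp : par a + par (idxZero : Idx n m) = 1 := by rw [h]; rfl
    rw [superComm_of_hom (rootMatrix_mem_ospHom a idxZero).1 (rootMatrix_mem_ospHom a idxZero).1,
      hp, hr, h, bar_bar]
    simp only [rootMatrix, Matrix.add_mul, Matrix.mul_add, Matrix.single_mul_single_same,
      bar_idxZero,
      Matrix.single_mul_single_of_ne _ _ _ _ ha.symm,
      Matrix.single_mul_single_of_ne _ _ _ _ ha',
      Matrix.single_mul_single_of_ne _ _ _ _ ha0, add_zero, zero_add, one_mul]
    have h1' : sgn 1 = -1 := by simp [sgn]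
    rw [h1', ← sub_eq_zero]
    ext i j
    simp only [Matrix.sub_apply, Matrix.add_apply, Matrix.smul_apply, Matrix.single_apply,
      Matrix.zero_apply, smul_eq_mul]
    split_ifs
    · field_simp
      ring
    · simp

theorem exists_smul_of_wt_sub_wt_eq {a b c d : Idx n m} (hab : a ≠ b)
    (h : wt c - wt d = wt a - wt b) : ∃ r : ℂ, rootVec c d = r • rootVec a b := by
  rcases eq_or_eq_of_wt_sub_wt_eq h hab with ⟨rfl, rfl⟩ | ⟨rfl, rfl⟩
  · exact ⟨1, (one_smul _ _).symm⟩
  · exact ⟨_, rootVec_bar a b⟩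

theorem act_bracket_self {k : ZMod 2} {x : osp n m} {v : V} (hx : (x : Gl n m) ∈ ospHom n m k)
    (h : M.act x v = 0) : M.act (bracket x x) v = 0 := by
  rw [M.act_bracket k k x x hx hx]
  simp [h]

/-- The passage of a highest weight vector through the wall of the simple root
`wt a - wt b`: the vector is multiplied by the largest power of the negative root vector that does
not kill it. -/
theorem IsHighest.reflect {f f' : Weight n m →ₗ[ℝ] ℝ} {μ : Weight n m} {l : ZMod 2} {v : V}
    (hM : M.IsIrreducible) (hf : Function.Injective fun c : Idx n m => f (wt c))
    {a b : Idx n m} (ha : a ≠ idxZero) (hab : a ≠ b) (hab' : a ≠ bar b)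
    (hpos : f (wt b) < f (wt a)) (hneg : f' (wt a) < f' (wt b))
    (hff : ∀ c d, f (wt d) < f (wt c) → f' (wt d) < f' (wt c) ∨ wt c - wt d = wt a - wt b ∨
      (b = idxZero ∧ c = a ∧ d = bar a))
    (coef : ℕ → ℂ) (K : ℕ) (h0 : coef 0 = 0)
    (hcoef : ∀ j : ℕ, coef (j + 1) =
      (μ - (j : ℂ) • (wt a - wt b)) (diagVec a - sgn (par a + par b) • diagVec b) +
        sgn (par a + par b) * coef j)
    (hne : ∀ j, j < K → coef (j + 1) ≠ 0) (hK : coef (K + 1) = 0)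
    (hv : M.IsHighest f μ l v) :
    ∃ l' v', M.IsHighest f' (μ - (K : ℂ) • (wt a - wt b)) l' v' := by
  set k := par a + par b with hk
  set α : Weight n m := wt a - wt b with hα
  set E := M.act (rootVec a b) with hE
  set F := M.act (rootVec b a) with hF
  have hFk : (rootVec b a : Gl n m) ∈ ospHom n m k := by
    rw [hk, add_comm]; exact rootVec_mem_ospHom b a
  have hEk : (rootVec a b : Gl n m) ∈ ospHom n m k := rootVec_mem_ospHom a b
  have hFα : rootVec b a ∈ rootSpace (-α) := by
    rw [hα, neg_sub]; exact rootVec_mem_rootSpace b a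
  have hfα : 0 < f α := by rw [hα, map_sub]; linarith
  have hfα' : f' α < 0 := by rw [hα, map_sub]; linarith
  -- The hypothesis on the wall, read from its other side.
  have hff' : ∀ c d, f' (wt d) < f' (wt c) → f (wt d) < f (wt c) ∨ wt c - wt d = -α ∨
      (b = idxZero ∧ c = bar a ∧ d = a) := by
    intro c d h
    rcases lt_trichotomy (f (wt d)) (f (wt c)) with h1 | h1 | h1
    · exact Or.inl h1
    · obtain rfl := hf h1
      exact absurd h (lt_irrefl _)
    · rcases hff d c h1 with h2 | h2 | ⟨h2, h3, h4⟩
      · exact absurd h (not_lt.2 h2.le)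
      · exact Or.inr (Or.inl (by rw [← h2, neg_sub]))
      · exact Or.inr (Or.inr ⟨h2, h4, h3⟩)
  have hpow : ∀ j, (F ^ (j + 1)) v = F ((F ^ j) v) := fun j => by
    rw [pow_succ', Module.End.mul_apply]
  have hdeg : ∀ j, ∃ l', (F ^ j) v ∈ M.deg l' := by
    intro j
    induction j with
    | zero => exact ⟨l, hv.mem_deg⟩
    | succ j ih =>
      obtain ⟨l', h⟩ := ih
      rw [hpow]
      exact ⟨_, M.act_deg _ _ _ _ hFk h⟩
  have hwt : ∀ j : ℕ, (F ^ j) v ∈ M.weightSpace (μ - (j : ℂ) • α) := by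
    intro j
    induction j with
    | zero => simpa using hv.mem_weightSpace
    | succ j ih =>
      rw [hpow]
      have := act_mem_weightSpace hFk hFα ih
      convert this using 2
      push_cast
      rw [add_smul, one_smul]
      abel
  -- Moving `E` past one `F` produces the coroot, evaluated at the weight of `F ^ j v`, and the sign
  -- of the exchange: this is the recursion for `coef`.
  have hEF : ∀ j, E ((F ^ (j + 1)) v) = coef (j + 1) • (F ^ j) v := by
    have hstep : ∀ j : ℕ, E ((F ^ (j + 1)) v) =
        (μ - (j : ℂ) • α) (diagVec a - sgn k • diagVec b) • (F ^ j) v +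
          sgn k • F (E ((F ^ j) v)) := by
      intro j
      have hkk : k * k = k := by
        generalize k = k'
        revert k'
        decide
      rw [hpow, hE, hF, act_act hEk hFk, bracket_rootVec hab', hkk,
        OspModule.mem_weightSpace.1 (hwt j)]
    intro j
    induction j with
    | zero =>
      rw [hstep, hcoef, h0, pow_zero, Module.End.one_apply, hv.isSingular.act_rootVec hpos]
      simp
    | succ j ih =>
      rw [hstep, ih, hcoef (j + 1), map_smul, ← hpow, add_smul, smul_smul]
  have hnz : ∀ j, j ≤ K → (F ^ j) v ≠ 0 := by
    intro j
    induction j with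
    | zero => exact fun _ => hv.ne_zero
    | succ j ih =>
      intro hj h
      have h1 := hEF j
      rw [h, map_zero] at h1
      exact smul_ne_zero (hne j hj) (ih (by omega)) h1.symm
  -- Commuting `x` with `F` changes `β` to `β - α`, which is still positive for `f'` and still no
  -- multiple of `α`. Whether `β - α` is a root is irrelevant.
  have hkill : ∀ (j : ℕ) (β : Weight n m) (k' : ZMod 2) (x : osp n m), 0 < f' β →
      (∀ i : ℤ, β ≠ i • α) → x ∈ rootSpace β → (x : Gl n m) ∈ ospHom n m k' →
      M.act x ((F ^ j) v) = 0 := by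
    intro j
    induction j with
    | zero =>
      intro β k' x hβ hβα hx hxk
      refine hv.isSingular x fun c d hcd => ?_
      have hβ' := mem_rootSpace_iff.1 hx c d hcd
      rcases hff' c d (by rw [← hβ', map_sub] at hβ; linarith) with h | h | ⟨h, rfl, rfl⟩
      · exact h
      · exact absurd (hβ'.symm.trans h) (by simpa using hβα (-1))
      -- Here `β` would be `-2α`.
      · refine absurd hβ'.symm ?_
        have := hβα (-2)
        rwa [hα, h, wt_idxZero, sub_zero, neg_smul, two_smul, neg_add, ← wt_bar, wt_bar,
          ← sub_eq_add_neg, ← wt_bar] at this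
    | succ j ih =>
      intro β k' x hβ hβα hx hxk
      rw [hpow, hF, act_act hxk hFk, ih β k' x hβ hβα hx hxk, map_zero, smul_zero, add_zero]
      refine ih (β + -α) (k' + k) _ ?_ ?_ (bracket_mem_rootSpace hx hFα)
        (superComm_mem_ospHom hxk hFk)
      · rw [map_add, map_neg]; linarith
      · intro i hi
        apply hβα (i + 1)
        rw [add_smul, one_smul, ← hi]
        abel
  -- A multiple of `α` cannot be positive for both functionals, as they have opposite signs at `α`.
  have hkill' : ∀ (j : ℕ) (c d : Idx n m), f (wt d) < f (wt c) → f' (wt d) < f' (wt c) →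
      M.act (rootVec c d) ((F ^ j) v) = 0 := by
    intro j c d h h'
    refine hkill j _ _ _ (by rw [map_sub]; linarith) ?_ (rootVec_mem_rootSpace c d)
      (rootVec_mem_ospHom c d)
    intro i hi
    have h1 : f (i • α) = i * f α := by rw [map_zsmul, zsmul_eq_mul]
    have h2 : f' (i • α) = i * f' α := by rw [map_zsmul, zsmul_eq_mul]
    rw [← hi, map_sub] at h1 h2
    have hi1 : (0 : ℝ) < i := by
      by_contra! hc
      nlinarith
    nlinarith
  -- Otherwise this vector would be singular for `f`, of weight `μ - (K + 1) α ≠ μ`, against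
  -- uniqueness.
  have hzero : (F ^ (K + 1)) v = 0 := by
    by_contra hcon
    have hEz : E ((F ^ (K + 1)) v) = 0 := by rw [hEF, hK, zero_smul]
    obtain ⟨l', hl'⟩ := hdeg (K + 1)
    have hs : M.IsHighest f (μ - ((K + 1 : ℕ) : ℂ) • α) l' ((F ^ (K + 1)) v) := by
      refine ⟨hcon, hl', hwt _, isSingular_of_rootVec fun c d hcd => ?_⟩
      rcases hff c d hcd with h | h | ⟨h1, rfl, rfl⟩
      · exact hkill' _ c d hcd h
      · obtain ⟨r, hr⟩ := exists_smul_of_wt_sub_wt_eq hab h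
        rw [hr, map_smul, LinearMap.smul_apply, ← hE, hEz, smul_zero]
      · obtain ⟨r, hr⟩ := exists_rootVec_bar_eq_smul_bracket ha
        rw [hr, map_smul, LinearMap.smul_apply, ← h1, act_bracket_self hEk hEz, smul_zero]
    have := congrArg f (hv.weight_unique hM hf hs)
    rw [map_sub, sub_eq_self, Nat.cast_smul_eq_nsmul, map_nsmul, nsmul_eq_mul] at this
    have hK0 : (0 : ℝ) < (K + 1 : ℕ) := by positivity
    nlinarith
  obtain ⟨l', hl'⟩ := hdeg K
  rw [hpow] at hzero
  refine ⟨l', (F ^ K) v, hnz K le_rfl, hl', hwt K, isSingular_of_rootVec fun c d hcd => ?_⟩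
  rcases hff' c d hcd with h | h | ⟨h1, rfl, rfl⟩
  · exact hkill' _ c d h hcd
  · obtain ⟨r, hr⟩ := exists_smul_of_wt_sub_wt_eq (a := b) (b := a) hab.symm
      (by rw [h, hα, neg_sub])
    rw [hr, map_smul, LinearMap.smul_apply, ← hF, hzero, smul_zero]
  -- For the root `-2α` the root vector is a multiple of the bracket of a multiple of the negative
  -- root vector with itself, so it kills whatever `F` kills.
  · have hba : bar d ≠ idxZero := fun h => ha (by rw [bar_eq_comm] at h; exact h)
    obtain ⟨r, hr⟩ := exists_rootVec_bar_eq_smul_bracket hba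
    obtain ⟨r', hr'⟩ := exists_smul_of_wt_sub_wt_eq (a := b) (b := d) (c := bar d) (d := idxZero)
      hab.symm (by rw [h1, wt_bar]; simp)
    have hz : M.act (rootVec (bar d) idxZero) ((F ^ K) v) = 0 := by
      rw [hr', map_smul, LinearMap.smul_apply, ← hF, hzero, smul_zero]
    rw [bar_bar] at hr
    rw [hr, map_smul, LinearMap.smul_apply, act_bracket_self (rootVec_mem_ospHom _ _) hz,
      smul_zero]

end OspModule

end OspB

namespace OspB

variable {n m : ℕ}

/-! ### Chambers -/

/-- The weight `δ_i` or `ε_j` as the index of a basis vector of the natural module. -/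
def letterIdx : Fin n ⊕ Fin m → Idx n m
  | Sum.inl i => Sum.inl (Sum.inl i)
  | Sum.inr j => Sum.inr (Sum.inr (Sum.inl j))

theorem letterIdx_injective : Function.Injective (letterIdx : Fin n ⊕ Fin m → Idx n m) := by
  rintro (i | i) (j | j) h <;> simp_all [letterIdx]

theorem letterIdx_ne_bar (x y : Fin n ⊕ Fin m) : letterIdx x ≠ bar (letterIdx y) := by
  rcases x with i | i <;> rcases y with j | j <;> simp [letterIdx, bar]

theorem letterIdx_ne_idxZero (x : Fin n ⊕ Fin m) : (letterIdx x : Idx n m) ≠ idxZero := by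
  rcases x with i | i <;> simp [letterIdx, idxZero]

theorem eq_idxZero_or_letterIdx (c : Idx n m) :
    c = idxZero ∨ ∃ x, c = letterIdx x ∨ c = bar (letterIdx x) := by
  rcases c with (i | i) | (u | (j | j))
  · exact Or.inr ⟨Sum.inl i, Or.inl rfl⟩
  · exact Or.inr ⟨Sum.inl i, Or.inr rfl⟩
  · exact Or.inl rfl
  · exact Or.inr ⟨Sum.inr j, Or.inl rfl⟩
  · exact Or.inr ⟨Sum.inr j, Or.inr rfl⟩

/-- A total ordering of the weights `δ_i` and `ε_j`, each with a sign. -/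
structure Chamber (n m : ℕ) where
  pos : Fin n ⊕ Fin m ≃ Fin (n + m)
  sign : Fin n ⊕ Fin m → ℤˣ

namespace Chamber

variable (C : Chamber n m)

/-- The signed letter as the index of a basis vector of the natural module. -/
def idx (x : Fin n ⊕ Fin m) : Idx n m :=
  if C.sign x = 1 then letterIdx x else bar (letterIdx x)

theorem idx_eq_or (x : Fin n ⊕ Fin m) : C.idx x = letterIdx x ∨ C.idx x = bar (letterIdx x) := by
  unfold idx; split <;> simp

theorem wt_idx (x : Fin n ⊕ Fin m) :
    wt (C.idx x) = ((C.sign x : ℤ) : ℂ) • (wt (letterIdx x) : Weight n m) := by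
  unfold idx
  rcases Int.units_eq_one_or (C.sign x) with h | h
  · simp [h]
  · rw [if_neg (by rw [h]; decide), wt_bar, h]
    simp

theorem idx_injective : Function.Injective C.idx := by
  intro x y h
  rcases C.idx_eq_or x with hx | hx <;> rcases C.idx_eq_or y with hy | hy <;> rw [hx, hy] at h
  · exact letterIdx_injective h
  · exact absurd h (letterIdx_ne_bar _ _)
  · exact absurd h.symm (letterIdx_ne_bar _ _)
  · exact letterIdx_injective (bar_injective h)

theorem idx_ne_bar_idx (x y : Fin n ⊕ Fin m) : C.idx x ≠ bar (C.idx y) := by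
  intro h
  by_cases hxy : x = y
  · subst hxy
    rw [eq_comm, bar_eq_self] at h
    rcases C.idx_eq_or x with hx | hx <;> rw [hx] at h
    · exact letterIdx_ne_idxZero _ h
    · rw [bar_eq_comm] at h
      exact letterIdx_ne_idxZero _ h
  · rcases C.idx_eq_or x with hx | hx <;> rcases C.idx_eq_or y with hy | hy <;> rw [hx, hy] at h
    · exact letterIdx_ne_bar _ _ h
    · rw [bar_bar] at h
      exact hxy (letterIdx_injective h)
    · exact hxy (letterIdx_injective (bar_injective h))
    · rw [bar_bar] at h
      exact letterIdx_ne_bar _ _ h.symm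

theorem idx_ne_idxZero (x : Fin n ⊕ Fin m) : C.idx x ≠ idxZero := fun h =>
  C.idx_ne_bar_idx x x (by rw [h, bar_idxZero])

theorem eq_idxZero_or (c : Idx n m) : c = idxZero ∨ ∃ x, c = C.idx x ∨ c = bar (C.idx x) := by
  rcases eq_idxZero_or_letterIdx c with h | ⟨x, h⟩
  · exact Or.inl h
  · refine Or.inr ⟨x, ?_⟩
    rcases C.idx_eq_or x with hx | hx <;> rw [hx]
    · exact h
    · rw [bar_bar]
      exact h.symm

/-- The height of an index: the values on the signed letters, in order, are `n + m, …, 1`. -/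
def height (c : Idx n m) : ℤ :=
  ∑ x, ((n + m : ℤ) - (C.pos x : ℕ)) * ((if C.idx x = c then 1 else 0) -
    (if bar (C.idx x) = c then 1 else 0))

@[simp] theorem height_idx (x : Fin n ⊕ Fin m) :
    C.height (C.idx x) = (n + m : ℤ) - (C.pos x : ℕ) := by
  unfold height
  rw [Finset.sum_eq_single x]
  · simp [(C.idx_ne_bar_idx x x).symm]
  · intro y _ hy
    simp [(C.idx_ne_bar_idx x y).symm, C.idx_injective.eq_iff, hy]
  · simp

@[simp] theorem height_bar (c : Idx n m) : C.height (bar c) = -C.height c := by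
  unfold height
  rw [← Finset.sum_neg_distrib]
  refine Finset.sum_congr rfl fun x _ => ?_
  simp only [bar_inj, eq_comm (a := C.idx x) (b := bar c), bar_eq_comm (a := c),
    eq_comm (a := c)]
  ring

@[simp] theorem height_idxZero : C.height idxZero = 0 := by
  have := C.height_bar idxZero
  rw [bar_idxZero] at this
  omega

theorem height_idx_pos (x : Fin n ⊕ Fin m) : 0 < C.height (C.idx x) := by
  rw [height_idx]
  have := (C.pos x).2
  omega

theorem height_injective : Function.Injective C.height := by
  have key : ∀ x y, C.height (C.idx x) = C.height (C.idx y) → x = y := by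
    intro x y h
    rw [height_idx, height_idx] at h
    exact C.pos.injective (Fin.ext (by omega))
  intro c d h
  rcases C.eq_idxZero_or c with rfl | ⟨x, rfl | rfl⟩ <;>
    rcases C.eq_idxZero_or d with rfl | ⟨y, rfl | rfl⟩ <;>
    try simp only [height_bar, height_idxZero, neg_inj] at h
  · rfl
  · have := C.height_idx_pos y; omega
  · have := C.height_idx_pos y; omega
  · have := C.height_idx_pos x; omega
  · rw [key x y h]
  · have := C.height_idx_pos x; have := C.height_idx_pos y; omega
  · have := C.height_idx_pos x; omega
  · have := C.height_idx_pos x; have := C.height_idx_pos y; omega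
  · rw [key x y h]

theorem height_inj {c d : Idx n m} : C.height c = C.height d ↔ c = d := C.height_injective.eq_iff

theorem height_le (c : Idx n m) : C.height c ≤ n + m ∧ -(n + m : ℤ) ≤ C.height c := by
  rcases C.eq_idxZero_or c with rfl | ⟨x, rfl | rfl⟩
  · simp only [height_idxZero]; omega
  · have := C.height_idx_pos x; rw [height_idx] at *; omega
  · have := C.height_idx_pos x; rw [height_bar, height_idx] at *; omega

theorem exists_height_eq {z : ℤ} (h1 : z ≤ n + m) (h2 : -(n + m : ℤ) ≤ z) :
    ∃ c, C.height c = z := by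
  have key : ∀ z : ℤ, 0 < z → z ≤ n + m → ∃ c, C.height c = z := by
    intro z hz hz'
    -- Positions count from `0`, so height `z` belongs to position `n + m - z`.
    refine ⟨C.idx (C.pos.symm ⟨n + m - z.toNat, by omega⟩), ?_⟩
    rw [height_idx, Equiv.apply_symm_apply]
    simp only
    omega
  rcases lt_trichotomy z 0 with h | h | h
  · obtain ⟨c, hc⟩ := key (-z) (by omega) (by omega)
    exact ⟨bar c, by rw [height_bar, hc, neg_neg]⟩
  · exact ⟨idxZero, by rw [height_idxZero, h]⟩
  · exact key z h h1

/-- The element of the Cartan subalgebra with diagonal entries the heights. -/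
def diag : cartan n m := ∑ x, ((n + m : ℂ) - (C.pos x : ℕ)) • diagVec (C.idx x)

theorem wt_diag (c : Idx n m) : wt c C.diag = C.height c := by
  rw [diag, map_sum, height]
  push_cast
  refine Finset.sum_congr rfl fun x _ => ?_
  rw [map_smul, wt_diagVec, smul_eq_mul]

/-- The linear functional extending the height. -/
def functional : Weight n m →ₗ[ℝ] ℝ where
  toFun μ := (μ C.diag).re
  map_add' μ ν := by simp
  map_smul' r μ := by simp

theorem functional_wt (c : Idx n m) : C.functional (wt c) = C.height c := by
  change (wt c C.diag).re = _
  rw [wt_diag]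
  simp

theorem functional_injective : Function.Injective fun c : Idx n m => C.functional (wt c) := by
  intro c d h
  simp only [functional_wt, Int.cast_inj] at h
  exact C.height_injective h

theorem functional_wt_lt {c d : Idx n m} :
    C.functional (wt c) < C.functional (wt d) ↔ C.height c < C.height d := by
  rw [functional_wt, functional_wt, Int.cast_lt]

theorem wt_idx_diagVec (x y : Fin n ⊕ Fin m) :
    wt (C.idx x) (diagVec (C.idx y)) = if y = x then 1 else 0 := by
  rw [wt_diagVec, if_neg (C.idx_ne_bar_idx x y).symm, sub_zero]
  simp [C.idx_injective.eq_iff]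

/-! ### The highest weight attached to a chamber -/

/-- The number of weights `δ_i` at positions less than `k`. -/
def cntδ (k : ℕ) : ℕ := (Finset.univ.filter fun i : Fin n => (C.pos (Sum.inl i) : ℕ) < k).card

/-- The number of weights `ε_j` at positions less than `k`. -/
def cntε (k : ℕ) : ℕ := (Finset.univ.filter fun j : Fin m => (C.pos (Sum.inr j) : ℕ) < k).card

end Chamber

/-- The block Frobenius coordinate of a letter with `d` letters `δ` and `e` letters `ε` before
it. -/
def coordAt (lam : YoungDiagram) (d e : ℕ) : Fin n ⊕ Fin m → ℕ
  | Sum.inl _ => lam.rowLen d - e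
  | Sum.inr _ => lam.colLen e - d

namespace Chamber

variable (C : Chamber n m)

/-- The block Frobenius coordinates attached to a chamber. -/
def coord (lam : YoungDiagram) (x : Fin n ⊕ Fin m) : ℕ :=
  coordAt lam (C.cntδ (C.pos x)) (C.cntε (C.pos x)) x

/-- The weight whose coordinates on the signed letters are the block Frobenius coordinates. -/
def weight (lam : YoungDiagram) : Weight n m := ∑ x, (C.coord lam x : ℂ) • wt (C.idx x)

theorem weight_diagVec (lam : YoungDiagram) (x : Fin n ⊕ Fin m) :
    C.weight lam (diagVec (C.idx x)) = C.coord lam x := by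
  rw [weight, LinearMap.sum_apply, Finset.sum_eq_single x]
  · rw [LinearMap.smul_apply, wt_idx_diagVec, if_pos rfl, smul_eq_mul, mul_one]
  · intro y _ hy
    rw [LinearMap.smul_apply, wt_idx_diagVec, if_neg hy.symm, smul_zero]
  · simp

theorem cntδ_succ (x : Fin n ⊕ Fin m) :
    C.cntδ ((C.pos x : ℕ) + 1) = C.cntδ (C.pos x) + if x.isLeft then 1 else 0 := by
  unfold cntδ
  rcases x with i | j
  · have : (Finset.univ.filter fun i' : Fin n =>
        (C.pos (Sum.inl i') : ℕ) < (C.pos (Sum.inl i) : ℕ) + 1) =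
        insert i (Finset.univ.filter fun i' : Fin n =>
        (C.pos (Sum.inl i') : ℕ) < (C.pos (Sum.inl i) : ℕ)) := by
      ext i'
      simp only [Finset.mem_filter, Finset.mem_univ, true_and, Finset.mem_insert,
        Nat.lt_succ_iff_lt_or_eq, Fin.val_inj, C.pos.injective.eq_iff, Sum.inl.injEq]
      tauto
    rw [this, Finset.card_insert_of_notMem (by simp)]
    rfl
  · have : ∀ i', (C.pos (Sum.inl i') : ℕ) ≠ (C.pos (Sum.inr j) : ℕ) := fun i' h => by
      have := C.pos.injective (Fin.ext h)
      simp at this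
    simp only [Nat.lt_succ_iff_lt_or_eq, this, or_false, Sum.isLeft_inr, Bool.false_eq_true,
      if_false, add_zero]

theorem cntε_succ (x : Fin n ⊕ Fin m) :
    C.cntε ((C.pos x : ℕ) + 1) = C.cntε (C.pos x) + if x.isLeft then 0 else 1 := by
  unfold cntε
  rcases x with i | j
  · have : ∀ j', (C.pos (Sum.inr j') : ℕ) ≠ (C.pos (Sum.inl i) : ℕ) := fun i' h => by
      have := C.pos.injective (Fin.ext h)
      simp at this
    simp only [Nat.lt_succ_iff_lt_or_eq, this, or_false, Sum.isLeft_inl, if_true, add_zero]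
  · have : (Finset.univ.filter fun j' : Fin m =>
        (C.pos (Sum.inr j') : ℕ) < (C.pos (Sum.inr j) : ℕ) + 1) =
        insert j (Finset.univ.filter fun j' : Fin m =>
        (C.pos (Sum.inr j') : ℕ) < (C.pos (Sum.inr j) : ℕ)) := by
      ext j'
      simp only [Finset.mem_filter, Finset.mem_univ, true_and, Finset.mem_insert,
        Nat.lt_succ_iff_lt_or_eq, Fin.val_inj, C.pos.injective.eq_iff, Sum.inr.injEq]
      tauto
    rw [this, Finset.card_insert_of_notMem (by simp)]
    rfl

theorem par_idx (x : Fin n ⊕ Fin m) : par (C.idx x) = if x.isLeft then 1 else 0 := by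
  rcases C.idx_eq_or x with h | h <;> rw [h] <;> rcases x with i | j <;> rfl

end Chamber

/-- The change of the block Frobenius coordinates of two adjacent letters that change places. -/
theorem exists_coordAt_swap (lam : YoungDiagram) (d e : ℕ) (x y : Fin n ⊕ Fin m) :
    ∃ K : ℕ,
      coordAt lam (d + if y.isLeft then 1 else 0) (e + if y.isLeft then 0 else 1) x + K =
        coordAt lam d e x ∧
      coordAt lam d e y =
        coordAt lam (d + if x.isLeft then 1 else 0) (e + if x.isLeft then 0 else 1) y + K ∧
      (x.isLeft = y.isLeft → coordAt lam (d + if x.isLeft then 1 else 0)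
        (e + if x.isLeft then 0 else 1) y + K = coordAt lam d e x) ∧
      (x.isLeft ≠ y.isLeft → (K = 0 ∧ coordAt lam d e x = 0 ∧ coordAt lam
        (d + if x.isLeft then 1 else 0) (e + if x.isLeft then 0 else 1) y = 0) ∨
        (K = 1 ∧ 0 < coordAt lam d e x)) := by
  -- Both inequalities say that the box `(d, e)` lies in the diagram, so the coordinates of unlike
  -- neighbours vanish or change together.
  have hrc : e < lam.rowLen d ↔ d < lam.colLen e := by
    rw [← YoungDiagram.mem_iff_lt_rowLen, YoungDiagram.mem_iff_lt_colLen]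
  have hr := lam.rowLen_anti d (d + 1) (by omega)
  have hc := lam.colLen_anti e (e + 1) (by omega)
  rcases x with i | j <;> rcases y with i' | j' <;>
    simp only [coordAt, Sum.isLeft_inl, Sum.isLeft_inr, if_true, if_false, Bool.false_eq_true,
      add_zero, ne_eq, not_true_eq_false, not_false_eq_true, forall_true_left, false_imp_iff,
      and_true, true_and, reduceCtorEq]
  · exact ⟨(lam.rowLen d - e) - (lam.rowLen (d + 1) - e), by omega⟩
  · by_cases h : e < lam.rowLen d
    · exact ⟨1, by omega⟩
    · exact ⟨0, by omega⟩
  · by_cases h : e < lam.rowLen d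
    · exact ⟨1, by omega⟩
    · exact ⟨0, by omega⟩
  · exact ⟨(lam.colLen e - d) - (lam.colLen (e + 1) - d), by omega⟩

end OspB

namespace OspB

variable {n m : ℕ} {V : Type*} [AddCommGroup V] [Module ℂ V]

/-! ### Passing from a chamber to an adjacent one -/

/-- The coefficients by which `e` maps `f ^ j v` to `f ^ (j - 1) v`, for a highest weight vector
`v` and root vectors `e`, `f` of opposite weights in rank one. -/
theorem exists_coef (κ M A : ℂ) (K : ℕ)
    (h : (κ = 1 ∧ A ≠ 0 ∧ 2 * M = A * K) ∨
      (κ = -1 ∧ A = 0 ∧ ((M = 0 ∧ K = 0) ∨ (M ≠ 0 ∧ K = 1))) ∨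
      (κ = -1 ∧ A = 1 ∧ 2 * M = K ∧ Even K)) :
    ∃ coef : ℕ → ℂ, coef 0 = 0 ∧ (∀ j : ℕ, coef (j + 1) = (M - j * A) + κ * coef j) ∧
      (∀ j, j < K → coef (j + 1) ≠ 0) ∧ coef (K + 1) = 0 := by
  let coef : ℕ → ℂ := fun j => Nat.rec 0 (fun j c => (M - j * A) + κ * c) j
  have h0 : coef 0 = 0 := rfl
  have hs : ∀ j : ℕ, coef (j + 1) = (M - j * A) + κ * coef j := fun j => rfl
  refine ⟨coef, h0, hs, ?_⟩
  rcases h with ⟨rfl, hA, hM⟩ | ⟨rfl, rfl, h⟩ | ⟨rfl, rfl, hM, hK⟩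
  -- The case of `sl₂`.
  · have hc : ∀ j : ℕ, 2 * coef j = j * A * (K + 1 - j) := by
      intro j
      induction j with
      | zero => simp [h0]
      | succ j ih =>
        rw [hs]
        push_cast
        linear_combination ih + hM
    constructor
    · intro j hj h
      have := hc (j + 1)
      rw [h, mul_zero, eq_comm, mul_eq_zero, mul_eq_zero] at this
      rcases this with (h | h) | h
      · exact absurd h (Nat.cast_ne_zero.2 (Nat.succ_ne_zero j))
      · exact hA h
      · have h' : (K : ℂ) = j := by push_cast at h; linear_combination h
        exact hj.ne' (by exact_mod_cast h')
    · have := hc (K + 1)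
      push_cast at this
      linear_combination (1 / 2 : ℂ) * this
  -- An isotropic odd root: the sequence is `0, M, 0, M, …`.
  · rcases h with ⟨rfl, rfl⟩ | ⟨hM, rfl⟩
    · exact ⟨by simp, by simp [hs, h0]⟩
    · refine ⟨fun j hj => ?_, by simp [hs, h0]⟩
      obtain rfl : j = 0 := by omega
      simpa [hs, h0] using hM
  -- The case of `osp(1|2)`: past `coef 0`, the sequence can vanish only at odd places, whence the
  -- parity of `K`.
  · have hc : ∀ i : ℕ, coef (2 * i) = -i ∧ coef (2 * i + 1) = M - i := by
      intro i
      induction i with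
      | zero => simp [hs, h0]
      | succ i ih =>
        have h1 : coef (2 * (i + 1)) = -((i + 1 : ℕ) : ℂ) := by
          rw [show 2 * (i + 1) = 2 * i + 1 + 1 by ring, hs, ih.2]
          push_cast
          ring
        refine ⟨h1, ?_⟩
        rw [hs, h1]
        push_cast
        ring
    obtain ⟨p, rfl⟩ := hK
    have hMp : M = p := by push_cast at hM; linear_combination (1 / 2 : ℂ) * hM
    constructor
    · intro j hj
      obtain ⟨i, rfl | rfl⟩ := Nat.even_or_odd' j
      · rw [(hc i).2, hMp, sub_ne_zero]
        exact_mod_cast (by omega : p ≠ i)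
      · rw [show 2 * i + 1 + 1 = 2 * (i + 1) by ring, (hc (i + 1)).1, neg_ne_zero]
        exact_mod_cast (by omega : i + 1 ≠ 0)
    · rw [← two_mul, (hc p).2, hMp, sub_self]

theorem apply_sub_smul (μ : Weight n m) (H H' : cartan n m) (c : ℂ) :
    μ (H - c • H') = μ H - c * μ H' :=
  (LinearMap.map_sub μ H (c • H')).trans (by rw [LinearMap.map_smul μ c H', smul_eq_mul])

namespace Chamber

variable (C : Chamber n m)

variable {C} in
/-- Passing the wall between the chambers `C` and `C'`. -/
theorem exists_isHighest_of_wall {M : OspModule n m V} (hM : M.IsIrreducible)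
    {C' : Chamber n m} {μ : Weight n m} {a b : Idx n m}
    (ha : a ≠ idxZero) (hab : a ≠ b) (hab' : a ≠ bar b)
    (hpos : C.height b < C.height a) (hneg : C'.height a < C'.height b)
    (hff : ∀ c d, C.height d < C.height c → C'.height d < C'.height c ∨
      (c = a ∧ d = b) ∨ (c = bar b ∧ d = bar a) ∨ (b = idxZero ∧ c = a ∧ d = bar a)) (K : ℕ)
    {A : ℂ} (κ : ℂ) (hκ : sgn (par a + par b) = κ)
    (hA : (wt a (diagVec a) - wt b (diagVec a)) - κ * (wt a (diagVec b) - wt b (diagVec b)) = A)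
    (hK : (κ = 1 ∧ A ≠ 0 ∧ 2 * (μ (diagVec a) - κ * μ (diagVec b)) = A * K) ∨
      (κ = -1 ∧ A = 0 ∧ ((μ (diagVec a) - κ * μ (diagVec b) = 0 ∧ K = 0) ∨
        (μ (diagVec a) - κ * μ (diagVec b) ≠ 0 ∧ K = 1))) ∨
      (κ = -1 ∧ A = 1 ∧ 2 * (μ (diagVec a) - κ * μ (diagVec b)) = K ∧ Even K))
    (hv : ∃ l v, M.IsHighest C.functional μ l v) :
    ∃ l v, M.IsHighest C'.functional (μ - (K : ℂ) • (wt a - wt b)) l v := by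
  obtain ⟨l, v, hv⟩ := hv
  obtain ⟨coef, h0, hs, hne, hz⟩ := exists_coef κ _ A K hK
  refine hv.reflect hM C.functional_injective ha hab hab' (C.functional_wt_lt.2 hpos)
    (C'.functional_wt_lt.2 hneg) ?_ coef K h0 ?_ hne hz
  · intro c d h
    rw [functional_wt_lt] at h
    rw [functional_wt_lt]
    rcases hff c d h with h | ⟨rfl, rfl⟩ | ⟨rfl, rfl⟩ | h
    · exact Or.inl h
    · exact Or.inr (Or.inl rfl)
    · refine Or.inr (Or.inl ?_)
      rw [wt_bar, wt_bar]
      abel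
    · exact Or.inr (Or.inr h)
  · intro j
    rw [hs j, hκ, LinearMap.sub_apply, LinearMap.smul_apply, smul_eq_mul, apply_sub_smul,
      apply_sub_smul, ← hA, LinearMap.sub_apply, LinearMap.sub_apply]

/-- The chamber with the letters `x` and `y` exchanged in position. -/
def swap (x y : Fin n ⊕ Fin m) : Chamber n m where
  pos := C.pos.trans (Equiv.swap (C.pos x) (C.pos y))
  sign := C.sign

/-- The chamber with the sign of the letter `x` changed. -/
def flip (x : Fin n ⊕ Fin m) : Chamber n m where
  pos := C.pos
  sign := Function.update C.sign x (-C.sign x)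

/-! ### Exchange of adjacent letters -/

section swap

variable {x y : Fin n ⊕ Fin m}

theorem idx_swap (z : Fin n ⊕ Fin m) : (C.swap x y).idx z = C.idx z := rfl

theorem pos_swap_left : (C.swap x y).pos x = C.pos y := by simp [swap]

theorem pos_swap_right : (C.swap x y).pos y = C.pos x := by simp [swap]

theorem pos_swap_of_ne {z : Fin n ⊕ Fin m} (hx : z ≠ x) (hy : z ≠ y) :
    (C.swap x y).pos z = C.pos z := by
  simp only [swap, Equiv.trans_apply]
  exact Equiv.swap_apply_of_ne_of_ne (C.pos.injective.ne hx) (C.pos.injective.ne hy)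

/-- Written in terms of heights alone, so that comparing the orders of two chambers is integer
arithmetic. The four special values are distinct because `y` comes after `x`, so the height of `x`
is at least `2`. -/
theorem height_swap (hxy : (C.pos y : ℕ) = C.pos x + 1) (c : Idx n m) :
    (C.swap x y).height c =
      if C.height c = C.height (C.idx x) then C.height (C.idx x) - 1
      else if C.height c = C.height (C.idx x) - 1 then C.height (C.idx x)
      else if C.height c = -C.height (C.idx x) then 1 - C.height (C.idx x)
      else if C.height c = 1 - C.height (C.idx x) then -C.height (C.idx x)
      else C.height c := by
  have hy := (C.pos y).2
  have key : ∀ z, (C.swap x y).height (C.idx z) =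
      if C.height (C.idx z) = C.height (C.idx x) then C.height (C.idx x) - 1
      else if C.height (C.idx z) = C.height (C.idx x) - 1 then C.height (C.idx x)
      else C.height (C.idx z) := by
    intro z
    rw [← idx_swap, height_idx, idx_swap, height_idx, height_idx]
    by_cases hzx : z = x
    · subst hzx
      rw [pos_swap_left, if_pos rfl]
      omega
    by_cases hzy : z = y
    · subst hzy
      rw [pos_swap_right, if_neg (by omega), if_pos (by omega)]
    rw [pos_swap_of_ne _ hzx hzy]
    have h1 : (C.pos z : ℕ) ≠ C.pos x := fun h => hzx (C.pos.injective (Fin.ext h))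
    have h2 : (C.pos z : ℕ) ≠ C.pos y := fun h => hzy (C.pos.injective (Fin.ext h))
    rw [if_neg (by omega), if_neg (by omega)]
  have hx1 : 1 < C.height (C.idx x) := by rw [height_idx]; omega
  rcases C.eq_idxZero_or c with rfl | ⟨z, rfl | rfl⟩
  · simp only [height_idxZero]
    split_ifs <;> omega
  · rw [key]
    have := C.height_idx_pos z
    split_ifs <;> omega
  · rw [height_bar, key, height_bar]
    have := C.height_idx_pos z
    split_ifs <;> omega

/-- Counting the positions below `k` notices the exchange only if `k` separates the two positions,
that is, if `k` is the position of `y`. -/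
theorem cntδ_swap_of_ne (hxy : (C.pos y : ℕ) = C.pos x + 1) {k : ℕ} (hk : k ≠ C.pos y) :
    (C.swap x y).cntδ k = C.cntδ k := by
  unfold cntδ
  congr 1
  ext i
  simp only [Finset.mem_filter, Finset.mem_univ, true_and]
  by_cases hx : Sum.inl i = x
  · rw [hx, pos_swap_left]; omega
  by_cases hy : Sum.inl i = y
  · rw [hy, pos_swap_right]; omega
  rw [pos_swap_of_ne _ hx hy]

theorem cntε_swap_of_ne (hxy : (C.pos y : ℕ) = C.pos x + 1) {k : ℕ} (hk : k ≠ C.pos y) :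
    (C.swap x y).cntε k = C.cntε k := by
  unfold cntε
  congr 1
  ext i
  simp only [Finset.mem_filter, Finset.mem_univ, true_and]
  by_cases hx : Sum.inr i = x
  · rw [hx, pos_swap_left]; omega
  by_cases hy : Sum.inr i = y
  · rw [hy, pos_swap_right]; omega
  rw [pos_swap_of_ne _ hx hy]

/-- The change of the block Frobenius coordinates under an exchange of adjacent letters. -/
theorem exists_coord_swap (lam : YoungDiagram) (hxy : (C.pos y : ℕ) = C.pos x + 1) :
    ∃ K : ℕ, (C.swap x y).coord lam x + K = C.coord lam x ∧
      (C.swap x y).coord lam y = C.coord lam y + K ∧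
      (∀ z, z ≠ x → z ≠ y → (C.swap x y).coord lam z = C.coord lam z) ∧
      (x.isLeft = y.isLeft → C.coord lam y + K = C.coord lam x) ∧
      (x.isLeft ≠ y.isLeft → (K = 0 ∧ C.coord lam x = 0 ∧ C.coord lam y = 0) ∨
        (K = 1 ∧ 0 < C.coord lam x)) := by
  obtain ⟨K, h1, h2, h3, h4⟩ := exists_coordAt_swap lam (C.cntδ (C.pos x)) (C.cntε (C.pos x)) x y
  have ey : C.coord lam y = coordAt lam (C.cntδ (C.pos x) + if x.isLeft then 1 else 0)
      (C.cntε (C.pos x) + if x.isLeft then 0 else 1) y := by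
    rw [coord, hxy, cntδ_succ, cntε_succ]
  have ey' : (C.swap x y).coord lam y = coordAt lam (C.cntδ (C.pos x)) (C.cntε (C.pos x)) y := by
    rw [coord, pos_swap_right, cntδ_swap_of_ne _ hxy (by omega),
      cntε_swap_of_ne _ hxy (by omega)]
  have ex' : (C.swap x y).coord lam x =
      coordAt lam (C.cntδ (C.pos x) + if y.isLeft then 1 else 0)
        (C.cntε (C.pos x) + if y.isLeft then 0 else 1) x := by
    have e1 := (C.swap x y).cntδ_succ y
    have e2 := (C.swap x y).cntε_succ y
    rw [pos_swap_right, ← hxy] at e1 e2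
    rw [coord, pos_swap_left, e1, e2, cntδ_swap_of_ne _ hxy (by omega),
      cntε_swap_of_ne _ hxy (by omega)]
  refine ⟨K, by rw [ex', h1, coord], by rw [ey', ey, h2], fun z hx hy => ?_, by rwa [ey, coord],
    by rwa [ey, coord]⟩
  have hz : (C.pos z : ℕ) ≠ C.pos y := fun h => hy (C.pos.injective (Fin.ext h))
  rw [coord, pos_swap_of_ne _ hx hy, cntδ_swap_of_ne _ hxy hz, cntε_swap_of_ne _ hxy hz, coord]

theorem exists_isHighest_swap {M : OspModule n m V} (hM : M.IsIrreducible) (lam : YoungDiagram)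
    (hxy : (C.pos y : ℕ) = C.pos x + 1)
    (hv : ∃ l v, M.IsHighest C.functional (C.weight lam) l v) :
    ∃ l v, M.IsHighest (C.swap x y).functional ((C.swap x y).weight lam) l v := by
  obtain ⟨K, h1, h2, h3, h4, h5⟩ := C.exists_coord_swap lam hxy
  have hne : x ≠ y := by rintro rfl; omega
  have hw : (C.swap x y).weight lam =
      C.weight lam - (K : ℂ) • (wt (C.idx x) - wt (C.idx y)) := by
    have key : ∀ z, ((C.swap x y).coord lam z : ℂ) = C.coord lam z -
        ((if z = x then (K : ℂ) else 0) - (if z = y then (K : ℂ) else 0)) := by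
      intro z
      by_cases hzx : z = x
      · subst hzx
        rw [if_pos rfl, if_neg hne, ← h1]
        push_cast
        ring
      by_cases hzy : z = y
      · subst hzy
        rw [if_pos rfl, if_neg hzx, h2]
        push_cast
        ring
      rw [h3 z hzx hzy, if_neg hzx, if_neg hzy]
      ring
    simp only [weight, key, idx_swap, sub_smul, Finset.sum_sub_distrib, ite_smul, zero_smul,
      Finset.sum_ite_eq', Finset.mem_univ, if_true, smul_sub]
  rw [hw]
  have hx0 := C.height_idx_pos x
  have hy0 := C.height_idx_pos y
  have hyx : C.height (C.idx y) = C.height (C.idx x) - 1 := by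
    rw [height_idx, height_idx]; omega
  have hs : (sgn (par (C.idx x) + par (C.idx y)) = 1 ∧ x.isLeft = y.isLeft) ∨
      (sgn (par (C.idx x) + par (C.idx y)) = -1 ∧ x.isLeft ≠ y.isLeft) := by
    rw [par_idx, par_idx]
    have h11 : (1 : ZMod 2) + 1 = 0 := by decide
    cases x.isLeft <;> cases y.isLeft <;> simp [sgn, h11]
  -- The root takes at its coroot the value `A = 1 + κ`, where `κ` is the sign of the exchange: `2`
  -- for letters of equal parity, `0` for an isotropic root.
  refine exists_isHighest_of_wall (C' := C.swap x y) hM (C.idx_ne_idxZero x)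
    (C.idx_injective.ne hne) (C.idx_ne_bar_idx x y) (by omega) ?_ ?_ K
    (A := 1 + sgn (par (C.idx x) + par (C.idx y))) _ rfl ?_ ?_ hv
  · rw [height_swap _ hxy, height_swap _ hxy, if_pos rfl, if_neg (by omega), if_pos hyx]
    omega
  -- The only pairs whose order changes are `(x, y)` and its opposite `(bar y, bar x)`.
  · intro c d hcd
    by_contra! hcon
    obtain ⟨g1, g2, g3, g4⟩ := hcon
    rw [ne_eq, ← C.height_inj, ← C.height_inj, hyx] at g2
    rw [ne_eq, ← C.height_inj, ← C.height_inj, height_bar, height_bar, hyx] at g3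
    rw [height_swap _ hxy, height_swap _ hxy] at g1
    split_ifs at g1 <;> omega
  · simp only [wt_idx_diagVec, hne, hne.symm, if_true, if_false]
    ring
  · rw [weight_diagVec, weight_diagVec]
    rcases hs with ⟨hs, hp⟩ | ⟨hs, hp⟩
    · left
      rw [hs, ← h4 hp]
      refine ⟨rfl, by norm_num, ?_⟩
      push_cast
      ring
    -- For unlike letters the weight takes at the coroot the sum of the two coordinates, which is
    -- zero exactly when the box is missing.
    · right; left
      rw [hs]
      refine ⟨rfl, by norm_num, ?_⟩
      rcases h5 hp with ⟨h, h', h''⟩ | ⟨h, h'⟩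
      · left
        rw [h', h'']
        exact ⟨by simp, h⟩
      · right
        refine ⟨?_, h⟩
        rw [neg_one_mul, sub_neg_eq_add]
        exact_mod_cast (by omega : C.coord lam x + C.coord lam y ≠ 0)

end swap

/-! ### Change of sign of the last letter -/

section flip

variable {x : Fin n ⊕ Fin m}

theorem idx_flip_self : (C.flip x).idx x = bar (C.idx x) := by
  simp only [idx, flip, Function.update_self]
  rcases Int.units_eq_one_or (C.sign x) with h | h <;> rw [h] <;> simp [show (-1 : ℤˣ) ≠ 1 by decide]

theorem idx_flip_of_ne {z : Fin n ⊕ Fin m} (hz : z ≠ x) : (C.flip x).idx z = C.idx z := by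
  simp only [idx, flip, Function.update_of_ne hz]

theorem height_flip (hx : (C.pos x : ℕ) + 1 = n + m) (c : Idx n m) :
    (C.flip x).height c =
      if C.height c = 1 then -1 else if C.height c = -1 then 1 else C.height c := by
  have key : ∀ z, (C.flip x).height (C.idx z) =
      if C.height (C.idx z) = 1 then -1 else C.height (C.idx z) := by
    intro z
    by_cases hzx : z = x
    · subst hzx
      have h1 : C.idx z = bar ((C.flip z).idx z) := by rw [idx_flip_self, bar_bar]
      have h2 : C.height (C.idx z) = 1 := by rw [height_idx]; omega
      rw [h2, if_pos rfl, h1, height_bar, height_idx]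
      change -((n + m : ℤ) - (C.pos z : ℕ)) = -1
      omega
    · have h1 : (C.pos z : ℕ) ≠ C.pos x := fun h => hzx (C.pos.injective (Fin.ext h))
      have h2 := (C.pos z).2
      rw [if_neg (by rw [height_idx]; omega)]
      conv_lhs => rw [← C.idx_flip_of_ne hzx]
      rw [height_idx, height_idx]
      rfl
  clear hx
  rcases C.eq_idxZero_or c with rfl | ⟨z, rfl | rfl⟩
  · simp
  · rw [key]
    have := C.height_idx_pos z
    split_ifs <;> omega
  · rw [height_bar, key, height_bar]
    have := C.height_idx_pos z
    split_ifs <;> omega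

theorem exists_isHighest_flip {M : OspModule n m V} (hM : M.IsIrreducible) (lam : YoungDiagram)
    (hx : (C.pos x : ℕ) + 1 = n + m)
    (hv : ∃ l v, M.IsHighest C.functional (C.weight lam) l v) :
    ∃ l v, M.IsHighest (C.flip x).functional ((C.flip x).weight lam) l v := by
  have hw : (C.flip x).weight lam =
      C.weight lam - ((2 * C.coord lam x : ℕ) : ℂ) • (wt (C.idx x) - wt idxZero) := by
    have hc : ∀ z, (C.flip x).coord lam z = C.coord lam z := fun z => rfl
    rw [wt_idxZero, sub_zero, weight, weight, ← Finset.add_sum_erase _ _ (Finset.mem_univ x),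
      ← Finset.add_sum_erase (a := x) _ _ (Finset.mem_univ x), idx_flip_self, wt_bar, hc]
    have : ∑ z ∈ Finset.univ.erase x, ((C.flip x).coord lam z : ℂ) • wt ((C.flip x).idx z) =
        ∑ z ∈ Finset.univ.erase x, (C.coord lam z : ℂ) • (wt (C.idx z) : Weight n m) :=
      Finset.sum_congr rfl fun z hz => by rw [C.idx_flip_of_ne (Finset.ne_of_mem_erase hz), hc]
    rw [this]
    push_cast
    module
  rw [hw]
  have hx1 : C.height (C.idx x) = 1 := by rw [height_idx]; omega
  -- The coroot of the short root is therefore `diagVec` of the letter alone, and the root takes the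
  -- value `1` at it.
  have hd0 : (diagVec idxZero : cartan n m) = 0 := by
    apply Subtype.ext
    apply Subtype.ext
    change Matrix.single _ _ 1 + Matrix.single _ _ (ratio idxZero idxZero) = (0 : Gl n m)
    rw [ratio_self, bar_idxZero, ← Matrix.single_neg, add_neg_cancel]
  refine exists_isHighest_of_wall (C' := C.flip x) hM (C.idx_ne_idxZero x)
    (C.idx_ne_idxZero x) (C.idx_ne_idxZero x) (by rw [height_idxZero, hx1]; omega) ?_ ?_ _
    (A := 1) _ rfl ?_ ?_ hv
  · rw [height_flip _ hx, height_flip _ hx, hx1, height_idxZero]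
    norm_num
  · intro c d hcd
    by_contra! hcon
    obtain ⟨g1, g2, g3, g4⟩ := hcon
    rw [ne_eq, ← C.height_inj, ← C.height_inj, height_idxZero, hx1] at g2
    rw [ne_eq, ← C.height_inj, ← C.height_inj, height_bar, height_bar, height_idxZero, hx1] at g3
    have g4' := g4 rfl
    rw [ne_eq, ← C.height_inj, ← C.height_inj, height_bar, hx1] at g4'
    rw [height_flip _ hx, height_flip _ hx] at g1
    split_ifs at g1 <;> omega
  · rw [hd0, map_zero, map_zero, wt_idxZero, wt_idx_diagVec, if_pos rfl]
    simp
  · rw [hd0, map_zero, mul_zero, sub_zero, weight_diagVec]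
    have hp : sgn (par (C.idx x) + par (idxZero : Idx n m)) = if x.isLeft then -1 else 1 := by
      rw [par_idx]
      rcases x with i | j <;> simp [sgn, par, idxZero]
    rw [hp]
    -- A letter `δ` gives `osp(1|2)`, a letter `ε` gives `sl₂`; in both cases `K` is twice the
    -- coordinate.
    rcases x with i | j
    · exact Or.inr (Or.inr ⟨rfl, rfl, by push_cast; ring, even_two_mul _⟩)
    · exact Or.inl ⟨rfl, one_ne_zero, by push_cast; ring⟩

end flip

end Chamber

/-- A property of permutations of `Fin N` that holds for `1` and is stable under the composition
with transpositions of adjacent elements holds for all permutations. -/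
theorem perm_induction {N : ℕ} {P : Equiv.Perm (Fin N) → Prop} (one : P 1)
    (swap : ∀ (τ : Equiv.Perm (Fin N)) (k l : Fin N), (l : ℕ) = k + 1 → P τ →
      P (Equiv.swap k l * τ)) (τ : Equiv.Perm (Fin N)) : P τ := by
  cases N with
  | zero => rwa [Subsingleton.elim τ 1]
  | succ N =>
    have h : τ ∈ Submonoid.closure (Set.range fun i : Fin N ↦ Equiv.swap i.castSucc i.succ) := by
      rw [Equiv.Perm.mclosure_swap_castSucc_succ]
      trivial
    induction h using Submonoid.closure_induction_left with
    | one => exact one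
    | mul_left x hx y _ ih =>
      obtain ⟨i, rfl⟩ := hx
      exact swap y _ _ (by simp) ih

/-- A property of chambers that is stable under the passage to adjacent chambers holds for all
chambers if it holds for one. -/
theorem Chamber.induction {P : Chamber n m → Prop} (C₀ : Chamber n m) (h₀ : P C₀)
    (swap : ∀ (C : Chamber n m) x y, (C.pos y : ℕ) = C.pos x + 1 → P C → P (C.swap x y))
    (flip : ∀ (C : Chamber n m) x, (C.pos x : ℕ) + 1 = n + m → P C → P (C.flip x))
    (C : Chamber n m) : P C := by
  have perm : ∀ s σ, P ⟨σ, s⟩ → ∀ σ', P ⟨σ', s⟩ := by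
    intro s σ h σ'
    have := perm_induction (P := fun τ => P ⟨σ.trans τ, s⟩) h (fun τ k l hkl hτ => by
      have h2 := swap ⟨σ.trans τ, s⟩ ((σ.trans τ).symm k) ((σ.trans τ).symm l)
        (by simpa using hkl) hτ
      unfold Chamber.swap at h2
      simpa [Equiv.Perm.mul_def, Equiv.trans_assoc] using h2) (σ.symm.trans σ')
    simpa [← Equiv.trans_assoc] using this
  -- The signs are corrected one letter at a time, with the order left arbitrary so that a letter
  -- may be moved.
  have sign : ∀ S : Finset (Fin n ⊕ Fin m), ∀ σ,
      P ⟨σ, fun x => if x ∈ S then C.sign x else C₀.sign x⟩ := by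
    intro S
    induction S using Finset.induction_on with
    | empty => simpa using perm C₀.sign C₀.pos h₀
    | insert x S hx ih =>
      intro σ
      by_cases hs : C.sign x = C₀.sign x
      · have : (fun z => if z ∈ insert x S then C.sign z else C₀.sign z) =
            fun z => if z ∈ S then C.sign z else C₀.sign z := by
          ext z
          by_cases hz : z = x
          · subst hz; simp [hs]
          · simp [hz]
        rw [this]
        exact ih σ
      · have hN : n + m - 1 < n + m := by
          have := (C.pos x).2
          omega
        set s : Fin n ⊕ Fin m → ℤˣ := fun z => if z ∈ S then C.sign z else C₀.sign z with hs'
        -- Only the last letter can change its sign, so `x` is first brought there.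
        let σ₁ : Fin n ⊕ Fin m ≃ Fin (n + m) := σ.trans (Equiv.swap (σ x) ⟨n + m - 1, hN⟩)
        have hσ₁ : (σ₁ x : ℕ) + 1 = n + m := by
          simp only [σ₁, Equiv.trans_apply, Equiv.swap_apply_left]
          omega
        have h1 := flip ⟨σ₁, s⟩ x hσ₁ (ih σ₁)
        have : (fun z => if z ∈ insert x S then C.sign z else C₀.sign z) =
            Function.update s x (-s x) := by
          funext z
          by_cases hz : z = x
          · subst hz
            have hsz : s z = C₀.sign z := if_neg hx
            rw [Function.update_self, hsz, if_pos (Finset.mem_insert_self _ _)]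
            rcases Int.units_eq_one_or (C.sign z) with h | h <;>
              rcases Int.units_eq_one_or (C₀.sign z) with h' | h' <;> simp_all
          · rw [Function.update_of_ne hz]
            simp [hz, hs']
        rw [this]
        exact perm _ σ₁ h1 σ
  simpa using sign Finset.univ C.pos

/-- If an irreducible module has the highest weight attached to one chamber, then it has the
highest weights attached to all chambers. -/
theorem OspModule.exists_isHighest {M : OspModule n m V} (hM : M.IsIrreducible)
    (lam : YoungDiagram) (C₀ : Chamber n m)
    (h₀ : ∃ l v, M.IsHighest C₀.functional (C₀.weight lam) l v) (C : Chamber n m) :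
    ∃ l v, M.IsHighest C.functional (C.weight lam) l v :=
  Chamber.induction (P := fun C => ∃ l v, M.IsHighest C.functional (C.weight lam) l v) C₀ h₀
    (fun C _ _ hxy h => C.exists_isHighest_swap hM lam hxy h)
    (fun C _ hx h => C.exists_isHighest_flip hM lam hx h) C

end OspB

namespace OspB

variable {n m : ℕ}

/-! ### Borel subalgebras and chambers -/

/-- A submodule is the Borel subalgebra attached to the functional `f`. -/
def IsBorelOf (f : Weight n m →ₗ[ℝ] ℝ) (B : Submodule ℂ (osp n m)) : Prop :=
  (∀ α, IsRoot α → f α ≠ 0) ∧ B = cartan n m ⊔ ⨆ α, ⨆ (_ : IsRoot α ∧ 0 < f α), rootSpace α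

theorem IsBorelOf.mem_posRoots {f : Weight n m →ₗ[ℝ] ℝ} {B : Submodule ℂ (osp n m)}
    (h : IsBorelOf f B) {α : Weight n m} : α ∈ posRoots B ↔ IsRoot α ∧ 0 < f α := by
  constructor
  · rintro ⟨hα, hle⟩
    refine ⟨hα, ?_⟩
    -- The support condition defining `T` holds on the Cartan subalgebra and on all the root spaces
    -- generating `B`; hence a root space inside `B` belongs to a positive root.
    let T : Submodule ℂ (osp n m) :=
      { carrier := {x | ∀ a b, a ≠ b → (x : Gl n m) a b ≠ 0 → 0 < f (wt a - wt b)}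
        add_mem' := fun {x y} hx hy a b hab h => by
          by_cases h1 : (x : Gl n m) a b = 0
          · by_cases h2 : (y : Gl n m) a b = 0
            · simp [h1, h2] at h
            · exact hy a b hab h2
          · exact hx a b hab h1
        zero_mem' := fun a b _ h => absurd rfl h
        smul_mem' := fun c x hx a b hab h => hx a b hab fun h' => h (by
          change c * (x : Gl n m) a b = 0
          rw [h', mul_zero]) }
    have hT : B ≤ T := by
      rw [h.2]
      refine sup_le (fun x hx a b hab h => absurd (hx a b hab) h)
        (iSup₂_le fun β hβ x hx a b hab h => ?_)
      rw [mem_rootSpace_iff.1 hx a b h]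
      exact hβ.2
    obtain ⟨x, hx, hx0⟩ := Submodule.exists_mem_ne_zero_of_ne_bot hα.2
    obtain ⟨a, b, hab⟩ := exists_apply_ne_zero hx0
    have hα' := mem_rootSpace_iff.1 hx a b hab
    rw [← hα']
    refine hT (hle hx) a b ?_ hab
    rintro rfl
    exact hα.1 (by rw [← hα', sub_self])
  · rintro ⟨hα, hf⟩
    refine ⟨hα, ?_⟩
    rw [h.2]
    exact le_sup_of_le_right (le_iSup₂_of_le α ⟨hα, hf⟩ le_rfl)

namespace Chamber

variable (C : Chamber n m)

/-- The functional `f` orders the weights of the natural module as the chamber does. -/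
def Agrees (f : Weight n m →ₗ[ℝ] ℝ) : Prop :=
  ∀ c d : Idx n m, C.height c < C.height d → f (wt c) < f (wt d)

variable {C}

theorem Agrees.lt_iff {f : Weight n m →ₗ[ℝ] ℝ} (h : C.Agrees f) {c d : Idx n m} :
    f (wt c) < f (wt d) ↔ C.height c < C.height d := by
  refine ⟨fun hcd => ?_, h c d⟩
  by_contra! hle
  rcases hle.lt_or_eq with h1 | h1
  · exact absurd (h d c h1) (not_lt.2 hcd.le)
  · obtain rfl := C.height_injective h1
    exact lt_irrefl _ hcd

theorem Agrees.mem_posRoots {f : Weight n m →ₗ[ℝ] ℝ} (h : C.Agrees f)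
    {B : Submodule ℂ (osp n m)} (hB : IsBorelOf f B) {α : Weight n m} :
    α ∈ posRoots B ↔ IsRoot α ∧ 0 < C.functional α := by
  rw [hB.mem_posRoots]
  refine and_congr_right fun hα => ?_
  obtain ⟨a, b, rfl, -⟩ := hα.exists_eq
  rw [map_sub, map_sub, sub_pos, sub_pos, h.lt_iff, functional_wt_lt]

variable (C)

/-- The differences of weights of the natural module at consecutive heights. -/
def simpleRoots : Set (Weight n m) :=
  {α | ∃ a b : Idx n m, C.height a = C.height b + 1 ∧ α = wt a - wt b}

/-- Each such difference arises from `(a, b)` and from `(bar b, bar a)`; one of the two has its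
first index at positive height, that is, a signed letter. -/
theorem mem_simpleRoots_iff {α : Weight n m} : α ∈ C.simpleRoots ↔
    (∃ x y, (C.pos y : ℕ) = C.pos x + 1 ∧ α = wt (C.idx x) - wt (C.idx y)) ∨
      ∃ x, (C.pos x : ℕ) + 1 = n + m ∧ α = wt (C.idx x) := by
  constructor
  · rintro ⟨a, b, hab, rfl⟩
    have key : ∀ a b, C.height a = C.height b + 1 → 0 < C.height a →
        (∃ x y, (C.pos y : ℕ) = C.pos x + 1 ∧
          (wt a - wt b : Weight n m) = wt (C.idx x) - wt (C.idx y)) ∨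
          ∃ x, (C.pos x : ℕ) + 1 = n + m ∧ (wt a - wt b : Weight n m) = wt (C.idx x) := by
      intro a b hab ha
      rcases C.eq_idxZero_or a with rfl | ⟨x, rfl | rfl⟩
      · rw [height_idxZero] at ha; omega
      · rcases C.eq_idxZero_or b with rfl | ⟨y, rfl | rfl⟩
        · right
          refine ⟨x, ?_, by simp⟩
          rw [height_idxZero, height_idx] at hab
          have := (C.pos x).2
          omega
        · left
          refine ⟨x, y, ?_, rfl⟩
          rw [height_idx, height_idx] at hab
          have := (C.pos x).2
          omega
        · have := C.height_idx_pos x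
          have := C.height_idx_pos y
          rw [height_bar] at hab
          omega
      · have := C.height_idx_pos x
        rw [height_bar] at ha
        omega
    by_cases ha : 0 < C.height a
    · exact key a b hab ha
    · have := key (bar b) (bar a) (by rw [height_bar, height_bar]; omega)
        (by rw [height_bar]; omega)
      have e : wt (bar b) - wt (bar a) = (wt a - wt b : Weight n m) := by
        rw [wt_bar, wt_bar]
        abel
      rwa [e] at this
  · rintro (⟨x, y, hxy, rfl⟩ | ⟨x, hx, rfl⟩)
    · exact ⟨_, _, by rw [height_idx, height_idx]; omega, rfl⟩
    · exact ⟨C.idx x, idxZero, by rw [height_idx, height_idxZero]; omega, by simp⟩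

variable {C}

/-- Every height between two given ones is attained, so a difference of weights telescopes into
simple roots. -/
theorem agrees_of_simpleRoots_pos {f : Weight n m →ₗ[ℝ] ℝ} (h : ∀ α ∈ C.simpleRoots, 0 < f α) :
    C.Agrees f := by
  have key : ∀ (k : ℕ) (a b : Idx n m), C.height a = C.height b + (k + 1) →
      f (wt b) < f (wt a) := by
    intro k
    induction k with
    | zero =>
      intro a b hab
      have := h (wt a - wt b) ⟨a, b, by simpa using hab, rfl⟩
      rw [map_sub] at this
      linarith
    | succ k ih =>
      intro a b hab
      push_cast at hab
      have ha := C.height_le a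
      have hb := C.height_le b
      obtain ⟨c, hc⟩ := C.exists_height_eq (z := C.height b + 1) (by omega) (by omega)
      have h1 := h (wt c - wt b) ⟨c, b, hc, rfl⟩
      rw [map_sub] at h1
      have h2 := ih a c (by omega)
      linarith
  intro c d hcd
  exact key (C.height d - C.height c - 1).toNat d c (by omega)

theorem Agrees.simpleRoots_eq {f : Weight n m →ₗ[ℝ] ℝ} (h : C.Agrees f)
    {B : Submodule ℂ (osp n m)} (hB : IsBorelOf f B) :
    OspB.simpleRoots B = C.simpleRoots := by
  have hpos : ∀ {a b : Idx n m}, C.height b < C.height a → (a ≠ bar b ∨ par a = 1) →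
      (wt a - wt b : Weight n m) ∈ posRoots B := by
    intro a b hab hab'
    rw [h.mem_posRoots hB]
    refine ⟨isRoot_wt_sub_wt (by rintro rfl; exact lt_irrefl _ hab) hab', ?_⟩
    rw [map_sub, sub_pos, functional_wt_lt]
    exact hab
  ext α
  constructor
  · rintro ⟨hα, hsimple⟩
    have hα' := (h.mem_posRoots hB).1 hα
    obtain ⟨a, b, rfl, hab, hab'⟩ := hα'.1.exists_eq
    have hlt : C.height b < C.height a := by
      have := hα'.2
      rwa [map_sub, sub_pos, functional_wt_lt] at this
    refine ⟨a, b, ?_, rfl⟩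
    by_contra hne
    -- An intermediate `c` splits the root, but `c` must avoid `bar a` and `bar b`, since twice an
    -- even weight is no root.
    have hbet : ∀ c, C.height b < C.height c → C.height c < C.height a → a ≠ bar c →
        c ≠ bar b → False := by
      intro c h1 h2 h3 h4
      exact hsimple _ (hpos h2 (Or.inl h3)) _ (hpos h1 (Or.inl h4)) (by abel)
    have ha := C.height_le a
    have hb := C.height_le b
    -- The neighbour below `a` can fail only if it is `bar b`, that is, if the heights add up to
    -- `1`; then the neighbour above `b` works.
    by_cases hs : C.height a + C.height b = 1
    · obtain ⟨c, hc⟩ := C.exists_height_eq (z := C.height b + 1) (by omega) (by omega)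
      refine hbet c (by omega) (by omega) ?_ ?_ <;>
      · rintro rfl
        rw [height_bar] at *
        omega
    · obtain ⟨c, hc⟩ := C.exists_height_eq (z := C.height a - 1) (by omega) (by omega)
      refine hbet c (by omega) (by omega) ?_ ?_ <;>
      · rintro rfl
        rw [height_bar] at *
        omega
  · rintro ⟨a, b, hab, rfl⟩
    refine ⟨hpos (by omega) (Or.inl ?_), ?_⟩
    · rintro rfl
      rw [height_bar] at hab
      omega
    · intro β hβ γ hγ heq
      -- The height is integral, and a simple root has height `1`, too small for a sum of two
      -- positive roots.
      have key : ∀ β ∈ posRoots B, 1 ≤ C.functional β := by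
        intro β hβ
        rw [h.mem_posRoots hB] at hβ
        obtain ⟨c, d, rfl, -⟩ := hβ.1.exists_eq
        have := hβ.2
        rw [map_sub, functional_wt, functional_wt] at this ⊢
        have h1 : (0 : ℤ) < C.height c - C.height d := by exact_mod_cast this
        exact_mod_cast (by omega : 1 ≤ C.height c - C.height d)
      have h1 := congrArg C.functional heq
      rw [map_sub, map_add, functional_wt, functional_wt, hab] at h1
      have h2 := key β hβ
      have h3 := key γ hγ
      push_cast at h1
      linarith

/-- Each functional that vanishes on no root agrees with a chamber. -/
theorem exists_agrees {f : Weight n m →ₗ[ℝ] ℝ} (hf : ∀ α, IsRoot α → f α ≠ 0) :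
    ∃ C : Chamber n m, C.Agrees f := by
  have hL0 : ∀ x : Fin n ⊕ Fin m, f (wt (letterIdx x)) ≠ 0 := by
    intro x
    have := hf _ (isRoot_wt_sub_wt (a := letterIdx x) (b := (idxZero : Idx n m))
      (letterIdx_ne_idxZero x) (Or.inl (letterIdx_ne_idxZero x)))
    simpa using this
  -- Since `f` vanishes on no sum or difference of two letters, their absolute values are distinct;
  -- they give the order, and the signs of the values give the signs.
  have hL1 : ∀ x y : Fin n ⊕ Fin m, |f (wt (letterIdx x))| = |f (wt (letterIdx y))| → x = y := by
    intro x y h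
    by_contra hxy
    have hne : (letterIdx x : Idx n m) ≠ letterIdx y := letterIdx_injective.ne hxy
    rcases abs_eq_abs.1 h with h | h
    · apply hf _ (isRoot_wt_sub_wt hne (Or.inl (letterIdx_ne_bar x y)))
      rw [map_sub, h, sub_self]
    · apply hf _ (isRoot_wt_sub_wt (letterIdx_ne_bar x y) (Or.inl (by rwa [bar_bar])))
      rw [map_sub, wt_bar, map_neg, h, sub_neg_eq_add, neg_add_cancel]
  let rk : Fin n ⊕ Fin m → ℕ := fun x =>
    (Finset.univ.filter fun y => |f (wt (letterIdx x))| < |f (wt (letterIdx y))|).card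
  have hrk : ∀ x y, |f (wt (letterIdx x))| < |f (wt (letterIdx y))| → rk y < rk x := by
    intro x y h
    refine Finset.card_lt_card ⟨fun z hz => ?_, fun hsub => ?_⟩
    · rw [Finset.mem_filter] at hz ⊢
      exact ⟨hz.1, h.trans hz.2⟩
    · have := hsub (Finset.mem_filter.2 ⟨Finset.mem_univ y, h⟩)
      exact lt_irrefl _ (Finset.mem_filter.1 this).2
  have hcard : Fintype.card (Fin n ⊕ Fin m) = Fintype.card (Fin (n + m)) := by simp
  have hrkN : ∀ x, rk x < n + m := by
    intro x
    have : rk x < Fintype.card (Fin n ⊕ Fin m) :=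
      Finset.card_lt_univ_of_notMem (x := x) (by simp)
    simpa using this
  have hinj : Function.Injective fun x => (⟨rk x, hrkN x⟩ : Fin (n + m)) := by
    intro x y hxy
    have hxy : rk x = rk y := congrArg Fin.val hxy
    rcases lt_trichotomy |f (wt (letterIdx x))| |f (wt (letterIdx y))| with h | h | h
    · have := hrk x y h; omega
    · exact hL1 x y h
    · have := hrk y x h; omega
  let C : Chamber n m :=
    { pos := Equiv.ofBijective _ ((Fintype.bijective_iff_injective_and_card _).2 ⟨hinj, hcard⟩)
      sign := fun x => if 0 < f (wt (letterIdx x)) then 1 else -1 }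
  have hpos : ∀ x, (C.pos x : ℕ) = rk x := fun x => rfl
  have hC : ∀ x, f (wt (C.idx x)) = |f (wt (letterIdx x))| := by
    intro x
    unfold idx
    by_cases h : 0 < f (wt (letterIdx x))
    · have : C.sign x = 1 := if_pos h
      rw [if_pos this, abs_of_pos h]
    · have : C.sign x = -1 := if_neg h
      rw [if_neg (by rw [this]; decide), wt_bar, map_neg, abs_of_nonpos (not_lt.1 h)]
  refine ⟨C, agrees_of_simpleRoots_pos fun α hα => ?_⟩
  rcases C.mem_simpleRoots_iff.1 hα with ⟨x, y, hxy, rfl⟩ | ⟨x, -, rfl⟩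
  · rw [map_sub, sub_pos, hC, hC]
    rw [hpos, hpos] at hxy
    rcases lt_trichotomy |f (wt (letterIdx x))| |f (wt (letterIdx y))| with h | h | h
    · have := hrk x y h; omega
    · obtain rfl := hL1 x y h
      omega
    · exact h
  · rw [hC]
    exact abs_pos.2 (hL0 x)

end Chamber

/-! ### Highest weights of irreducible modules -/

section Modules

variable {V : Type*} [AddCommGroup V] [Module ℂ V] {M : OspModule n m V}

namespace OspModule

theorem exists_deg_add (v : V) : ∃ v₀ ∈ M.deg 0, ∃ v₁ ∈ M.deg 1, v = v₀ + v₁ := by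
  have h := M.isInternal.submodule_iSup_eq_top
  have h2 : (⨆ k, M.deg k) = M.deg 0 ⊔ M.deg 1 := by
    apply le_antisymm
    · refine iSup_le fun k => ?_
      have : ∀ k : ZMod 2, k = 0 ∨ k = 1 := by decide
      rcases this k with rfl | rfl
      · exact le_sup_left
      · exact le_sup_right
    · exact sup_le (le_iSup _ _) (le_iSup _ _)
  rw [h2] at h
  have hv : v ∈ M.deg 0 ⊔ M.deg 1 := by rw [h]; trivial
  obtain ⟨v₀, h₀, v₁, h₁, h⟩ := Submodule.mem_sup.1 hv
  exact ⟨v₀, h₀, v₁, h₁, h.symm⟩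

theorem eq_zero_of_add_eq_zero {k l : ZMod 2} (hkl : k ≠ l) {v w : V} (hv : v ∈ M.deg k)
    (hw : w ∈ M.deg l) (h : v + w = 0) : v = 0 ∧ w = 0 := by
  have hd : Disjoint (M.deg k) (M.deg l) :=
    M.isInternal.submodule_iSupIndep.pairwiseDisjoint hkl
  have hvw : v = -w := eq_neg_of_add_eq_zero_left h
  have h1 : v = 0 := Submodule.disjoint_def.1 hd v hv (by rw [hvw]; exact neg_mem hw)
  exact ⟨h1, by rw [h1, zero_add] at h; exact h⟩

/-- A highest weight vector need not be homogeneous. Cartan elements and root vectors are, so both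
components satisfy the same equations, and a nonzero one serves. Conversely, irreducibility makes
any nonzero vector a generator. -/
theorem hasHighestWeight_iff (hM : M.IsIrreducible) {f : Weight n m →ₗ[ℝ] ℝ}
    {C : Chamber n m} (h : C.Agrees f) {B : Submodule ℂ (osp n m)} (hB : IsBorelOf f B)
    {μ : Weight n m} :
    M.HasHighestWeight B μ ↔ ∃ l v, M.IsHighest C.functional μ l v := by
  constructor
  · rintro ⟨v, hv0, hvμ, hvB, -⟩
    have hsing : M.IsSingular C.functional v := by
      refine isSingular_of_rootVec fun a b hab => ?_
      by_cases h0 : rootVec a b = 0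
      · rw [h0, map_zero, LinearMap.zero_apply]
      refine hvB (wt a - wt b) ?_ _ (rootVec_mem_rootSpace a b)
      rw [h.mem_posRoots hB]
      refine ⟨⟨?_, fun hbot => h0 ?_⟩, by rw [map_sub, sub_pos]; exact hab⟩
      · intro h1
        rw [sub_eq_zero] at h1
        rw [h1] at hab
        exact lt_irrefl _ hab
      · have := rootVec_mem_rootSpace a b
        rwa [hbot, Submodule.mem_bot] at this
    obtain ⟨v₀, h₀, v₁, h₁, rfl⟩ := exists_deg_add (M := M) v
    have h01 : ∀ k : ZMod 2, k + 0 ≠ k + 1 := by decide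
    have hwt : v₀ ∈ M.weightSpace μ ∧ v₁ ∈ M.weightSpace μ := by
      rw [mem_weightSpace, mem_weightSpace, ← forall_and]
      intro H
      have hH := hvμ H
      rw [map_add, smul_add] at hH
      have e0 := M.act_deg 0 0 _ _ (cartan_mem_ospHom H) h₀
      have e1 := M.act_deg 0 1 _ _ (cartan_mem_ospHom H) h₁
      rw [zero_add] at e0 e1
      have := eq_zero_of_add_eq_zero (M := M) zero_ne_one
        (sub_mem e0 (Submodule.smul_mem _ (μ H) h₀)) (sub_mem e1 (Submodule.smul_mem _ (μ H) h₁))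
        (by rw [sub_add_sub_comm, hH, sub_self])
      exact ⟨sub_eq_zero.1 this.1, sub_eq_zero.1 this.2⟩
    have hs : M.IsSingular C.functional v₀ ∧ M.IsSingular C.functional v₁ := by
      have key : ∀ a b, C.functional (wt b) < C.functional (wt a) →
          M.act (rootVec a b) v₀ = 0 ∧ M.act (rootVec a b) v₁ = 0 := by
        intro a b hab
        have e := hsing.act_rootVec hab
        rw [map_add] at e
        exact eq_zero_of_add_eq_zero (M := M) (h01 _)
          (M.act_deg _ _ _ _ (rootVec_mem_ospHom a b) h₀)
          (M.act_deg _ _ _ _ (rootVec_mem_ospHom a b) h₁) e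
      exact ⟨isSingular_of_rootVec fun a b hab => (key a b hab).1,
        isSingular_of_rootVec fun a b hab => (key a b hab).2⟩
    by_cases hz : v₀ = 0
    · refine ⟨1, v₁, ?_, h₁, hwt.2, hs.2⟩
      rintro rfl
      exact hv0 (by rw [hz, add_zero])
    · exact ⟨0, v₀, hz, h₀, hwt.1, hs.1⟩
  · rintro ⟨l, v, hv⟩
    refine ⟨v, hv.ne_zero, mem_weightSpace.1 hv.mem_weightSpace, fun α hα x hx => ?_,
      fun W hW hvW => ?_⟩
    · refine hv.isSingular x fun a b hab => ?_
      have h1 := ((h.mem_posRoots hB).1 hα).2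
      rw [← mem_rootSpace_iff.1 hx a b hab, map_sub, sub_pos] at h1
      exact h1
    · refine (hM.2 W hW).resolve_left fun hbot => hv.ne_zero ?_
      rwa [hbot, Submodule.mem_bot] at hvW

end OspModule

end Modules

end OspB

namespace OspB

/-! ### Signed `εδ`-sequences and chambers -/

/-- A number below the last value of a monotone sequence that starts at `0` lies in exactly one of
the intervals between consecutive values. -/
theorem exists_interval {g : ℕ → ℕ} (h0 : g 0 = 0) {r i : ℕ} (hi : i < g r) :
    ∃ u, u < r ∧ g u ≤ i ∧ i < g (u + 1) := by
  induction r with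
  | zero => omega
  | succ r ih =>
    by_cases h : i < g r
    · obtain ⟨u, hu, h⟩ := ih h
      exact ⟨u, by omega, h⟩
    · exact ⟨r, by omega, by omega, hi⟩

namespace EpsDelta

variable {n m : ℕ} (D : EpsDelta n m)

theorem dSum_zero : D.dSum 0 = 0 := rfl

theorem eSum_zero : D.eSum 0 = 0 := rfl

theorem dSum_succ (u : ℕ) : D.dSum (u + 1) = D.dSum u + D.d (u + 1) :=
  Finset.sum_Icc_succ_top (by omega) _

theorem eSum_succ (u : ℕ) : D.eSum (u + 1) = D.eSum u + D.e (u + 1) :=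
  Finset.sum_Icc_succ_top (by omega) _

theorem dSum_mono {u w : ℕ} (h : u ≤ w) : D.dSum u ≤ D.dSum w :=
  monotone_nat_of_le_succ (fun u => by rw [dSum_succ]; omega) h

theorem eSum_mono {u w : ℕ} (h : u ≤ w) : D.eSum u ≤ D.eSum w :=
  monotone_nat_of_le_succ (fun u => by rw [eSum_succ]; omega) h

theorem dSum_r : D.dSum D.r = n := D.sum_d

theorem eSum_r : D.eSum D.r = m := D.sum_e

/-- The first block of letters `δ` may be empty, hence the condition `1 ≤ u`; in `eSum_lt` the last
block of letters `ε` may be, hence `w < D.r`. -/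
theorem dSum_lt {u w : ℕ} (hu : 1 ≤ u) (h : u < w) (hw : w ≤ D.r) : D.dSum u < D.dSum w := by
  have h1 := D.dSum_succ u
  have h2 := D.d_pos (u + 1) (by omega) (by omega)
  have h3 := D.dSum_mono (show u + 1 ≤ w by omega)
  omega

theorem eSum_lt {u w : ℕ} (h : u < w) (hw : w < D.r) : D.eSum u < D.eSum w := by
  have h1 := D.eSum_succ u
  have h2 := D.e_pos (u + 1) (by omega) (by omega)
  have h3 := D.eSum_mono (show u + 1 ≤ w by omega)
  omega

theorem exists_blockδ (i : Fin n) : ∃ u, u < D.r ∧ D.dSum u ≤ i ∧ (i : ℕ) < D.dSum (u + 1) :=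
  exists_interval D.dSum_zero (by rw [D.dSum_r]; exact i.2)

theorem exists_blockε (j : Fin m) : ∃ v, v < D.r ∧ D.eSum v ≤ j ∧ (j : ℕ) < D.eSum (v + 1) :=
  exists_interval D.eSum_zero (by rw [D.eSum_r]; exact j.2)

/-- The block of letters `δ` that contains position `i`. -/
def blockδ (i : Fin n) : ℕ := (D.exists_blockδ i).choose

/-- The block of letters `ε` that contains position `j`. -/
def blockε (j : Fin m) : ℕ := (D.exists_blockε j).choose

theorem blockδ_spec (i : Fin n) :
    D.blockδ i < D.r ∧ D.dSum (D.blockδ i) ≤ i ∧ (i : ℕ) < D.dSum (D.blockδ i + 1) :=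
  (D.exists_blockδ i).choose_spec

theorem blockε_spec (j : Fin m) :
    D.blockε j < D.r ∧ D.eSum (D.blockε j) ≤ j ∧ (j : ℕ) < D.eSum (D.blockε j + 1) :=
  (D.exists_blockε j).choose_spec

theorem le_blockδ_iff {i : Fin n} {u : ℕ} : u ≤ D.blockδ i ↔ D.dSum u ≤ i := by
  have h := D.blockδ_spec i
  constructor
  · intro h'
    have := D.dSum_mono h'
    omega
  · intro h'
    by_contra! hc
    have := D.dSum_mono (show D.blockδ i + 1 ≤ u by omega)
    omega

theorem le_blockε_iff {j : Fin m} {u : ℕ} : u ≤ D.blockε j ↔ D.eSum u ≤ j := by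
  have h := D.blockε_spec j
  constructor
  · intro h'
    have := D.eSum_mono h'
    omega
  · intro h'
    by_contra! hc
    have := D.eSum_mono (show D.blockε j + 1 ≤ u by omega)
    omega

theorem blockδ_eq {i : Fin n} {u : ℕ} (h : D.dSum u ≤ i) (h' : (i : ℕ) < D.dSum (u + 1)) :
    D.blockδ i = u := by
  have hs := D.blockδ_spec i
  rcases lt_trichotomy (D.blockδ i) u with hlt | heq | hlt
  · have := D.dSum_mono (show D.blockδ i + 1 ≤ u by omega)
    omega
  · exact heq
  · have := D.dSum_mono (show u + 1 ≤ D.blockδ i by omega)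
    omega

theorem blockε_eq {j : Fin m} {u : ℕ} (h : D.eSum u ≤ j) (h' : (j : ℕ) < D.eSum (u + 1)) :
    D.blockε j = u := by
  have hs := D.blockε_spec j
  rcases lt_trichotomy (D.blockε j) u with hlt | heq | hlt
  · have := D.eSum_mono (show D.blockε j + 1 ≤ u by omega)
    omega
  · exact heq
  · have := D.eSum_mono (show u + 1 ≤ D.blockε j by omega)
    omega

/-- The number of letters `ε` before the `i`-th letter `δ`. -/
def epsBefore (i : Fin n) : ℕ := D.eSum (D.blockδ i)

/-- The number of letters `δ` before the `j`-th letter `ε`. -/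
def delBefore (j : Fin m) : ℕ := D.dSum (D.blockε j + 1)

/-- Both sides express that the block of the letter `ε` has smaller index than that of the letter
`δ`. This compatibility of the two counts is what makes `place` injective. -/
theorem lt_epsBefore_iff (i : Fin n) (j : Fin m) :
    (j : ℕ) < D.epsBefore i ↔ D.delBefore j ≤ i := by
  have hi := D.blockδ_spec i
  have hj := D.blockε_spec j
  unfold epsBefore delBefore
  constructor
  · intro h
    have h1 : D.blockε j + 1 ≤ D.blockδ i := by
      by_contra! hc
      have := D.eSum_mono (show D.blockδ i ≤ D.blockε j by omega)
      omega
    have := D.dSum_mono h1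
    omega
  · intro h
    have h1 : D.blockε j + 1 ≤ D.blockδ i := by
      by_contra! hc
      have := D.dSum_mono (show D.blockδ i + 1 ≤ D.blockε j + 1 by omega)
      omega
    have := D.eSum_mono h1
    omega

theorem epsBefore_mono {i i' : Fin n} (h : i ≤ i') : D.epsBefore i ≤ D.epsBefore i' := by
  apply D.eSum_mono
  rw [D.le_blockδ_iff]
  exact (D.blockδ_spec i).2.1.trans h

theorem delBefore_mono {j j' : Fin m} (h : j ≤ j') : D.delBefore j ≤ D.delBefore j' := by
  apply D.dSum_mono
  have := (D.le_blockε_iff (j := j')).2 ((D.blockε_spec j).2.1.trans h)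
  omega

theorem epsBefore_le (i : Fin n) : D.epsBefore i ≤ m := by
  conv_rhs => rw [← D.eSum_r]
  exact D.eSum_mono (D.blockδ_spec i).1.le

theorem delBefore_le (j : Fin m) : D.delBefore j ≤ n := by
  conv_rhs => rw [← D.dSum_r]
  exact D.dSum_mono (D.blockε_spec j).1

/-- The position of a letter in the unpermuted sequence. -/
def place : Fin n ⊕ Fin m → ℕ
  | Sum.inl i => i + D.epsBefore i
  | Sum.inr j => j + D.delBefore j

theorem place_lt (x : Fin n ⊕ Fin m) : D.place x < n + m := by
  rcases x with i | j
  · have := D.epsBefore_le i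
    simp only [place]
    omega
  · have := D.delBefore_le j
    simp only [place]
    omega

theorem place_injective : Function.Injective D.place := by
  have hδ : ∀ i i' : Fin n, i < i' → D.place (Sum.inl i) < D.place (Sum.inl i') := by
    intro i i' h
    have := D.epsBefore_mono h.le
    simp only [place]
    omega
  have hε : ∀ j j' : Fin m, j < j' → D.place (Sum.inr j) < D.place (Sum.inr j') := by
    intro j j' h
    have := D.delBefore_mono h.le
    simp only [place]
    omega
  have hδε : ∀ (i : Fin n) (j : Fin m), D.place (Sum.inl i) ≠ D.place (Sum.inr j) := by
    intro i j
    have := D.lt_epsBefore_iff i j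
    simp only [place]
    omega
  rintro (i | j) (i' | j') h
  · rcases lt_trichotomy i i' with h' | h' | h'
    · exact absurd h (hδ _ _ h').ne
    · rw [h']
    · exact absurd h (hδ _ _ h').ne'
  · exact absurd h (hδε _ _)
  · exact absurd h.symm (hδε _ _)
  · rcases lt_trichotomy j j' with h' | h' | h'
    · exact absurd h (hε _ _ h').ne
    · rw [h']
    · exact absurd h (hε _ _ h').ne'

/-- The positions of the letters of a signed `εδ`-sequence. -/
def placeEquiv : Fin n ⊕ Fin m ≃ Fin (n + m) :=
  Equiv.ofBijective (fun x => ⟨D.place x, D.place_lt x⟩)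
    ((Fintype.bijective_iff_injective_and_card _).2
      ⟨fun _ _ h => D.place_injective (congrArg Fin.val h), by simp⟩)

/-- The chamber of a signed `εδ`-sequence. -/
def chamber : Chamber n m where
  pos := (Equiv.sumCongr D.s D.t).symm.trans D.placeEquiv
  sign := Sum.elim (fun i => D.ξ (D.s.symm i)) fun j => D.η (D.t.symm j)

theorem pos_chamber (x : Fin n ⊕ Fin m) :
    (D.chamber.pos (Equiv.sumCongr D.s D.t x) : ℕ) = D.place x := by
  simp only [chamber, Equiv.trans_apply, Equiv.symm_apply_apply]
  rfl

theorem pos_chamber_inl (i : Fin n) :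
    (D.chamber.pos (Sum.inl (D.s i)) : ℕ) = i + D.epsBefore i := D.pos_chamber (Sum.inl i)

theorem pos_chamber_inr (j : Fin m) :
    (D.chamber.pos (Sum.inr (D.t j)) : ℕ) = j + D.delBefore j := D.pos_chamber (Sum.inr j)

theorem wt_idx_chamber_inl (i : Fin n) : wt (D.chamber.idx (Sum.inl (D.s i))) = D.sδ i := by
  rw [Chamber.wt_idx, sδ, δ_eq_wt]
  simp [chamber, letterIdx]

theorem wt_idx_chamber_inr (j : Fin m) : wt (D.chamber.idx (Sum.inr (D.t j))) = D.sε j := by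
  rw [Chamber.wt_idx, sε, ε_eq_wt]
  simp [chamber, letterIdx]

theorem cntδ_chamber (k : ℕ) : D.chamber.cntδ k =
    (Finset.univ.filter fun i : Fin n => (i : ℕ) + D.epsBefore i < k).card := by
  unfold Chamber.cntδ
  refine (Finset.card_equiv D.s fun i => ?_).symm
  simp [pos_chamber_inl]

theorem cntε_chamber (k : ℕ) : D.chamber.cntε k =
    (Finset.univ.filter fun j : Fin m => (j : ℕ) + D.delBefore j < k).card := by
  unfold Chamber.cntε
  refine (Finset.card_equiv D.t fun i => ?_).symm
  simp [pos_chamber_inr]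

end EpsDelta

theorem card_filter_val_lt {N k : ℕ} (hk : k ≤ N) :
    (Finset.univ.filter fun i : Fin N => (i : ℕ) < k).card = k := by
  simp [Fin.card_filter_val_lt, hk]

namespace EpsDelta

variable {n m : ℕ} (D : EpsDelta n m)

theorem coord_chamber_inl (lam : YoungDiagram) (i : Fin n) :
    D.chamber.coord lam (Sum.inl (D.s i)) = lam.rowLen i - D.epsBefore i := by
  have h1 : ∀ i' : Fin n, (i' : ℕ) + D.epsBefore i' < i + D.epsBefore i ↔ (i' : ℕ) < i := by
    intro i'
    rcases le_total i i' with h | h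
    · have := D.epsBefore_mono h
      have : (i : ℕ) ≤ i' := h
      omega
    · have := D.epsBefore_mono h
      have h' : (i' : ℕ) ≤ i := h
      rcases h'.lt_or_eq with h' | h'
      · omega
      · rw [Fin.ext h']; simp
  have h2 : ∀ j : Fin m, (j : ℕ) + D.delBefore j < i + D.epsBefore i ↔
      (j : ℕ) < D.epsBefore i := by
    intro j
    have := D.lt_epsBefore_iff i j
    omega
  rw [Chamber.coord, pos_chamber_inl, cntδ_chamber, cntε_chamber]
  simp only [h1, h2]
  rw [card_filter_val_lt i.2.le, card_filter_val_lt (D.epsBefore_le i)]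
  rfl

theorem coord_chamber_inr (lam : YoungDiagram) (j : Fin m) :
    D.chamber.coord lam (Sum.inr (D.t j)) = lam.colLen j - D.delBefore j := by
  have h1 : ∀ j' : Fin m, (j' : ℕ) + D.delBefore j' < j + D.delBefore j ↔ (j' : ℕ) < j := by
    intro j'
    rcases le_total j j' with h | h
    · have := D.delBefore_mono h
      have : (j : ℕ) ≤ j' := h
      omega
    · have := D.delBefore_mono h
      have h' : (j' : ℕ) ≤ j := h
      rcases h'.lt_or_eq with h' | h'
      · omega
      · rw [Fin.ext h']; simp
  have h2 : ∀ i : Fin n, (i : ℕ) + D.epsBefore i < j + D.delBefore j ↔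
      (i : ℕ) < D.delBefore j := by
    intro i
    have := D.lt_epsBefore_iff i j
    omega
  rw [Chamber.coord, pos_chamber_inr, cntδ_chamber, cntε_chamber]
  simp only [h1, h2]
  rw [card_filter_val_lt j.2.le, card_filter_val_lt (D.delBefore_le j)]
  rfl

theorem p_eq (lam : YoungDiagram) (i : Fin n) : D.p lam i = lam.rowLen i - D.epsBefore i := by
  have h := D.blockδ_spec i
  unfold p
  rw [Finset.sum_eq_single (D.blockδ i), if_pos (by omega)]
  · rfl
  · intro u _ hne
    rw [if_neg]
    rintro ⟨h1, h2⟩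
    exact hne (D.blockδ_eq (by omega) (by omega)).symm
  · intro h'
    exact absurd (Finset.mem_range.2 h.1) h'

theorem q_eq (lam : YoungDiagram) (j : Fin m) : D.q lam j = lam.colLen j - D.delBefore j := by
  have h := D.blockε_spec j
  unfold q
  rw [Finset.sum_eq_single (D.blockε j), if_pos (by omega)]
  · rfl
  · intro u _ hne
    rw [if_neg]
    rintro ⟨h1, h2⟩
    exact hne (D.blockε_eq (by omega) (by omega)).symm
  · intro h'
    exact absurd (Finset.mem_range.2 h.1) h'

theorem weight_chamber (lam : YoungDiagram) : D.chamber.weight lam = D.weight lam := by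
  unfold Chamber.weight weight
  rw [Fintype.sum_sum_type, ← Equiv.sum_comp D.s, ← Equiv.sum_comp D.t]
  congr 1
  · refine Finset.sum_congr rfl fun i _ => ?_
    rw [wt_idx_chamber_inl, coord_chamber_inl, p_eq, sδ, smul_smul, mul_comm]
  · refine Finset.sum_congr rfl fun j _ => ?_
    rw [wt_idx_chamber_inr, coord_chamber_inr, q_eq, sε, smul_smul, mul_comm]

/-- Consecutive letters `δ` in different blocks are separated by at least one letter `ε`, because
only the last block of letters `ε` may be empty. -/
theorem succ_ne_dSum_iff {i i' : Fin n} (h : (i' : ℕ) = i + 1) :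
    (∀ u, 1 ≤ u → u ≤ D.r → (i : ℕ) + 1 ≠ D.dSum u) ↔ D.epsBefore i' = D.epsBefore i := by
  have hi := D.blockδ_spec i
  have hi' := D.blockδ_spec i'
  have hle : D.blockδ i ≤ D.blockδ i' := D.le_blockδ_iff.2 (by omega)
  constructor
  · intro hne
    rcases hle.lt_or_eq with hlt | heq
    · exfalso
      have := D.dSum_mono (show D.blockδ i + 1 ≤ D.blockδ i' by omega)
      exact hne (D.blockδ i + 1) (by omega) (by omega) (by omega)
    · unfold epsBefore
      rw [heq]
  · intro heq u hu1 hu2 hu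
    have h1 : u ≤ D.blockδ i' := D.le_blockδ_iff.2 (by omega)
    have h2 : ¬ u ≤ D.blockδ i := fun h => by
      have := D.le_blockδ_iff.1 h
      omega
    have h3 := D.eSum_lt (show D.blockδ i < D.blockδ i' by omega) hi'.1
    unfold epsBefore at heq
    omega

theorem succ_ne_eSum_iff {j j' : Fin m} (h : (j' : ℕ) = j + 1) :
    (∀ u, 1 ≤ u → u ≤ D.r → (j : ℕ) + 1 ≠ D.eSum u) ↔ D.delBefore j' = D.delBefore j := by
  have hj := D.blockε_spec j
  have hj' := D.blockε_spec j'
  have hle : D.blockε j ≤ D.blockε j' := D.le_blockε_iff.2 (by omega)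
  constructor
  · intro hne
    rcases hle.lt_or_eq with hlt | heq
    · exfalso
      have := D.eSum_mono (show D.blockε j + 1 ≤ D.blockε j' by omega)
      exact hne (D.blockε j + 1) (by omega) (by omega) (by omega)
    · unfold delBefore
      rw [heq]
  · intro heq u hu1 hu2 hu
    have h1 : u ≤ D.blockε j' := D.le_blockε_iff.2 (by omega)
    have h2 : ¬ u ≤ D.blockε j := fun h => by
      have := D.le_blockε_iff.1 h
      omega
    have h3 := D.dSum_lt (u := D.blockε j + 1) (w := D.blockε j' + 1) (by omega) (by omega)
      (by omega)
    unfold delBefore at heq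
    omega

theorem exists_break_δε_iff {i : Fin n} {j : Fin m} :
    (∃ u, 1 ≤ u ∧ u ≤ D.r ∧ (u < D.r ∨ 0 < D.e D.r) ∧ (i : ℕ) + 1 = D.dSum u ∧
      (j : ℕ) = D.eSum (u - 1)) ↔ D.delBefore j = i + 1 ∧ D.epsBefore i = j := by
  have hi := D.blockδ_spec i
  have hj := D.blockε_spec j
  constructor
  · rintro ⟨u, hu1, hu2, hu3, h1, h2⟩
    obtain ⟨w, rfl⟩ : ∃ w, u = w + 1 := ⟨u - 1, by omega⟩
    rw [Nat.add_sub_cancel] at h2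
    -- The block of letters `ε` after the `u`-th block of letters `δ` has to be nonempty for its
    -- first letter to be the neighbour.
    have he : 0 < D.e (w + 1) := by
      rcases hu3 with h | h
      · exact D.e_pos _ hu1 h
      · rcases hu2.lt_or_eq with h' | h'
        · exact D.e_pos _ hu1 h'
        · rwa [h']
    have e1 := D.eSum_succ w
    have hv : D.blockε j = w := D.blockε_eq (by omega) (by omega)
    have hu : D.blockδ i = w := by
      refine D.blockδ_eq ?_ (by omega)
      rcases Nat.eq_zero_or_pos w with rfl | hw
      · rw [D.dSum_zero]; omega
      · have := D.dSum_lt hw (Nat.lt_add_one w) hu2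
        omega
    unfold delBefore epsBefore
    rw [hv, hu]
    exact ⟨h1.symm, h2.symm⟩
  · rintro ⟨h1, h2⟩
    unfold delBefore at h1
    unfold epsBefore at h2
    have h3 : D.blockδ i ≤ D.blockε j := by
      by_contra! hc
      have := D.dSum_mono (show D.blockε j + 1 ≤ D.blockδ i by omega)
      omega
    have h4 := D.eSum_mono h3
    refine ⟨D.blockε j + 1, by omega, by omega, ?_, h1.symm, ?_⟩
    · by_contra! hc
      have h5 := D.eSum_succ (D.blockε j)
      have h6 : D.blockε j + 1 = D.r := by omega
      rw [h6] at h5 hj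
      omega
    · rw [Nat.add_sub_cancel]
      omega

theorem exists_break_εδ_iff {i : Fin n} {j : Fin m} :
    (∃ u, 1 ≤ u ∧ u < D.r ∧ (j : ℕ) + 1 = D.eSum u ∧ (i : ℕ) = D.dSum u) ↔
      D.delBefore j = i ∧ D.epsBefore i = j + 1 := by
  have hi := D.blockδ_spec i
  have hj := D.blockε_spec j
  constructor
  · rintro ⟨u, hu1, hu2, h1, h2⟩
    obtain ⟨w, rfl⟩ : ∃ w, u = w + 1 := ⟨u - 1, by omega⟩
    have h3 := D.dSum_lt hu1 (Nat.lt_add_one (w + 1)) hu2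
    have hu : D.blockδ i = w + 1 := D.blockδ_eq (by omega) (by omega)
    have h4 := D.eSum_lt (Nat.lt_add_one w) hu2
    have hv : D.blockε j = w := D.blockε_eq (by omega) (by omega)
    unfold delBefore epsBefore
    rw [hv, hu]
    exact ⟨h2.symm, h1.symm⟩
  · rintro ⟨h1, h2⟩
    unfold delBefore at h1
    unfold epsBefore at h2
    have h3 : D.blockε j < D.blockδ i := by
      by_contra! hc
      have := D.eSum_mono hc
      omega
    have h4 := D.eSum_mono (show D.blockε j + 1 ≤ D.blockδ i by omega)
    exact ⟨D.blockε j + 1, by omega, by omega, by omega, h1.symm⟩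

theorem last_δ_iff {i : Fin n} : (D.e D.r = 0 ∧ (i : ℕ) + 1 = D.dSum D.r) ↔
    (i : ℕ) + 1 = n ∧ D.epsBefore i = m := by
  have hi := D.blockδ_spec i
  obtain ⟨w, hw⟩ : ∃ w, D.r = w + 1 := ⟨D.r - 1, by have := D.one_le_r; omega⟩
  have h1 := D.eSum_succ w
  have hm := D.eSum_r
  rw [D.dSum_r]
  constructor
  · rintro ⟨he, hin⟩
    have hu : D.blockδ i = w := by
      by_contra hne
      have h2 := D.dSum_lt (u := D.blockδ i + 1) (w := w + 1) (by omega) (by omega) (by omega)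
      have h3 := D.dSum_r
      rw [hw] at h3
      omega
    unfold epsBefore
    rw [hu]
    rw [hw] at he hm
    omega
  · rintro ⟨hin, he⟩
    unfold epsBefore at he
    have := D.eSum_mono (show D.blockδ i ≤ w by omega)
    rw [hw] at hm ⊢
    omega

theorem last_ε_iff {j : Fin m} : (0 < D.e D.r ∧ (j : ℕ) + 1 = D.eSum D.r) ↔
    (j : ℕ) + 1 = m ∧ D.delBefore j = n := by
  have hj := D.blockε_spec j
  obtain ⟨w, hw⟩ : ∃ w, D.r = w + 1 := ⟨D.r - 1, by have := D.one_le_r; omega⟩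
  have h1 := D.eSum_succ w
  have hm := D.eSum_r
  have hn := D.dSum_r
  rw [D.eSum_r]
  constructor
  · rintro ⟨he, hjm⟩
    have hu : D.blockε j = w := by
      rw [hw] at hm he
      exact D.blockε_eq (by omega) (by omega)
    unfold delBefore
    rw [hu, ← hw]
    exact ⟨hjm, hn⟩
  · rintro ⟨hjm, hd⟩
    refine ⟨?_, hjm⟩
    by_contra! he
    unfold delBefore at hd
    rw [hw] at he hm hn
    have hlt : D.blockε j < w := by
      by_contra! hc
      have := D.eSum_mono hc
      omega
    have := D.dSum_lt (u := D.blockε j + 1) (w := w + 1) (by omega) (by omega) (by omega)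
    omega

/-- Adjacency of places is compared with the breaks between blocks, for each pair of types of
neighbours and for the last letter. -/
theorem simpleRoots_chamber : D.chamber.simpleRoots = D.simpleRoots := by
  have hδδ : ∀ i i' : Fin n, (i' : ℕ) + D.epsBefore i' = i + D.epsBefore i + 1 ↔
      (i' : ℕ) = i + 1 ∧ ∀ u, 1 ≤ u → u ≤ D.r → (i : ℕ) + 1 ≠ D.dSum u := by
    intro i i'
    constructor
    · intro h
      have hlt : i < i' := by
        by_contra! hc
        have := D.epsBefore_mono hc
        have : (i' : ℕ) ≤ i := hc
        omega
      have h1 := D.epsBefore_mono hlt.le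
      have h2 : (i : ℕ) < i' := hlt
      have h3 : (i' : ℕ) = i + 1 := by omega
      exact ⟨h3, (D.succ_ne_dSum_iff h3).2 (by omega)⟩
    · rintro ⟨h1, h2⟩
      rw [D.succ_ne_dSum_iff h1] at h2
      omega
  have hεε : ∀ j j' : Fin m, (j' : ℕ) + D.delBefore j' = j + D.delBefore j + 1 ↔
      (j' : ℕ) = j + 1 ∧ ∀ u, 1 ≤ u → u ≤ D.r → (j : ℕ) + 1 ≠ D.eSum u := by
    intro j j'
    constructor
    · intro h
      have hlt : j < j' := by
        by_contra! hc
        have := D.delBefore_mono hc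
        have : (j' : ℕ) ≤ j := hc
        omega
      have h1 := D.delBefore_mono hlt.le
      have h2 : (j : ℕ) < j' := hlt
      have h3 : (j' : ℕ) = j + 1 := by omega
      exact ⟨h3, (D.succ_ne_eSum_iff h3).2 (by omega)⟩
    · rintro ⟨h1, h2⟩
      rw [D.succ_ne_eSum_iff h1] at h2
      omega
  ext α
  rw [Chamber.mem_simpleRoots_iff]
  constructor
  · rintro (⟨x, y, hxy, rfl⟩ | ⟨x, hx, rfl⟩)
    · obtain ⟨x, rfl⟩ := (Equiv.sumCongr D.s D.t).surjective x
      obtain ⟨y, rfl⟩ := (Equiv.sumCongr D.s D.t).surjective y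
      rw [pos_chamber, pos_chamber] at hxy
      rcases x with i | j <;> rcases y with i' | j' <;> simp only [place] at hxy <;>
        simp only [Equiv.sumCongr_apply, Sum.map_inl, Sum.map_inr, wt_idx_chamber_inl,
          wt_idx_chamber_inr]
      · rw [hδδ] at hxy
        exact Or.inl ⟨i, i', hxy.1, hxy.2, rfl⟩
      · have h := D.lt_epsBefore_iff i j'
        obtain ⟨u, h1, h2, h3, h4, h5⟩ := (D.exists_break_δε_iff (i := i) (j := j')).2 (by omega)
        exact Or.inr (Or.inr (Or.inl ⟨u, h1, h2, h3, i, j', h4, h5, rfl⟩))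
      · have h := D.lt_epsBefore_iff i' j
        obtain ⟨u, h1, h2, h3, h4⟩ := (D.exists_break_εδ_iff (i := i') (j := j)).2 (by omega)
        exact Or.inr (Or.inr (Or.inr (Or.inl ⟨u, h1, h2, i', j, h3, h4, rfl⟩)))
      · rw [hεε] at hxy
        exact Or.inr (Or.inl ⟨j, j', hxy.1, hxy.2, rfl⟩)
    · obtain ⟨x, rfl⟩ := (Equiv.sumCongr D.s D.t).surjective x
      rw [pos_chamber] at hx
      rcases x with i | j <;> simp only [place] at hx <;>
        simp only [Equiv.sumCongr_apply, Sum.map_inl, Sum.map_inr, wt_idx_chamber_inl,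
          wt_idx_chamber_inr]
      · have h1 := D.epsBefore_le i
        obtain ⟨h2, h3⟩ := (D.last_δ_iff (i := i)).2 (by omega)
        exact Or.inr (Or.inr (Or.inr (Or.inr (Or.inr ⟨h2, i, h3, rfl⟩))))
      · have h1 := D.delBefore_le j
        obtain ⟨h2, h3⟩ := (D.last_ε_iff (j := j)).2 (by omega)
        exact Or.inr (Or.inr (Or.inr (Or.inr (Or.inl ⟨h2, j, h3, rfl⟩))))
  · rintro (⟨i, i', h1, h2, rfl⟩ | ⟨j, j', h1, h2, rfl⟩ | ⟨u, h1, h2, h3, i, j, h4, h5, rfl⟩ |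
      ⟨u, h1, h2, i, j, h3, h4, rfl⟩ | ⟨h1, j, h2, rfl⟩ | ⟨h1, i, h2, rfl⟩)
    · exact Or.inl ⟨Sum.inl (D.s i), Sum.inl (D.s i'),
        by rw [pos_chamber_inl, pos_chamber_inl]; exact (hδδ i i').2 ⟨h1, h2⟩,
        by rw [wt_idx_chamber_inl, wt_idx_chamber_inl]⟩
    · exact Or.inl ⟨Sum.inr (D.t j), Sum.inr (D.t j'),
        by rw [pos_chamber_inr, pos_chamber_inr]; exact (hεε j j').2 ⟨h1, h2⟩,
        by rw [wt_idx_chamber_inr, wt_idx_chamber_inr]⟩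
    · have := D.exists_break_δε_iff.1 ⟨u, h1, h2, h3, h4, h5⟩
      exact Or.inl ⟨Sum.inl (D.s i), Sum.inr (D.t j),
        by rw [pos_chamber_inl, pos_chamber_inr]; omega,
        by rw [wt_idx_chamber_inl, wt_idx_chamber_inr]⟩
    · have := D.exists_break_εδ_iff.1 ⟨u, h1, h2, h3, h4⟩
      exact Or.inl ⟨Sum.inr (D.t j), Sum.inl (D.s i),
        by rw [pos_chamber_inl, pos_chamber_inr]; omega,
        by rw [wt_idx_chamber_inl, wt_idx_chamber_inr]⟩
    · have := D.last_ε_iff.1 ⟨h1, h2⟩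
      exact Or.inr ⟨Sum.inr (D.t j), by rw [pos_chamber_inr]; omega,
        by rw [wt_idx_chamber_inr]⟩
    · have := D.last_δ_iff.1 ⟨h1, h2⟩
      exact Or.inr ⟨Sum.inl (D.s i), by rw [pos_chamber_inl]; omega,
        by rw [wt_idx_chamber_inl]⟩

end EpsDelta

end OspB

/-! ### From chambers back to signed `εδ`-sequences -/

namespace OspB

variable {n m : ℕ}

/-- A bijection onto `Fin N` is determined by the ordering it induces. -/
theorem equiv_fin_unique {ι : Type*} {N : ℕ} {σ σ' : ι ≃ Fin N}
    (h : ∀ x y, σ x < σ y → σ' x < σ' y) : σ = σ' := by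
  have hm : StrictMono (σ.symm.trans σ') := fun k l hkl => h _ _ (by simpa using hkl)
  let e : Fin N ≃o Fin N := hm.orderIsoOfSurjective _ (σ.symm.trans σ').surjective
  have he : e = OrderIso.refl _ := Subsingleton.elim _ _
  ext x
  have h1 : e (σ x) = σ x := by rw [he]; rfl
  have h2 : e (σ x) = σ' x := by
    change σ' (σ.symm (σ x)) = σ' x
    rw [Equiv.symm_apply_apply]
  rw [← h2, h1]

/-- A monotone sequence with values at most `m` is the sequence of the numbers of letters `ε`
before the letters `δ` of a signed `εδ`-sequence. -/
theorem exists_epsDelta {g : Fin n → ℕ} (hg : Monotone g) (hgm : ∀ i, g i ≤ m)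
    (s : Equiv.Perm (Fin n)) (t : Equiv.Perm (Fin m)) (ξ : Fin n → ℤˣ) (η : Fin m → ℤˣ) :
    ∃ D : EpsDelta n m, D.s = s ∧ D.t = t ∧ D.ξ = ξ ∧ D.η = η ∧ ∀ i, D.epsBefore i = g i := by
  classical
  -- Blocks of letters `δ` correspond to the values of `g`. The value `0` is added by force, which
  -- yields an empty first block if `g` omits it.
  set W : Finset ℕ := insert 0 (Finset.univ.image g) with hW
  set r := W.card with hr
  have hr1 : 0 < r := Finset.card_pos.2 ⟨0, Finset.mem_insert_self _ _⟩
  -- The default `m` supplies the end of the last block of letters `ε`, which is empty if `m` is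
  -- already a value in `W`.
  let S : ℕ → ℕ := fun u => if h : u < r then W.orderEmbOfFin rfl ⟨u, h⟩ else m
  have hS : ∀ u (h : u < r), S u = W.orderEmbOfFin rfl ⟨u, h⟩ := fun u h => dif_pos h
  have hSr : ∀ u, r ≤ u → S u = m := fun u h => dif_neg (not_lt.2 h)
  have hlt : ∀ u w, u < w → w < r → S u < S w := by
    intro u w h hw
    rw [hS u (h.trans hw), hS w hw]
    exact (W.orderEmbOfFin rfl).strictMono h
  have hmem : ∀ u, u < r → S u ∈ W := by
    intro u h
    rw [hS u h]
    exact Finset.orderEmbOfFin_mem _ _ _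
  have hsurj : ∀ x ∈ W, ∃ u, u < r ∧ S u = x := by
    intro x hx
    have : x ∈ Set.range (W.orderEmbOfFin rfl) := by rw [Finset.range_orderEmbOfFin]; exact hx
    obtain ⟨⟨u, hu⟩, h⟩ := this
    exact ⟨u, hu, by rw [hS u hu, h]⟩
  have hSm : ∀ u, S u ≤ m := by
    intro u
    by_cases h : u < r
    · have := hmem u h
      rw [hW, Finset.mem_insert, Finset.mem_image] at this
      rcases this with h | ⟨i, -, h⟩
      · omega
      · rw [← h]; exact hgm i
    · exact (hSr u (not_lt.1 h)).le
  have hS0 : S 0 = 0 := by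
    obtain ⟨u, hu, h⟩ := hsurj 0 (Finset.mem_insert_self _ _)
    rcases Nat.eq_zero_or_pos u with rfl | hpos
    · exact h
    · have := hlt 0 u hpos hu
      omega
  have hmono : ∀ u, S u ≤ S (u + 1) := by
    intro u
    by_cases h : u + 1 < r
    · exact (hlt u (u + 1) (by omega) h).le
    · rw [hSr (u + 1) (by omega)]
      exact hSm u
  have hinj : ∀ u w, u < r → w < r → S u = S w → u = w := by
    intro u w hu hw h
    rcases lt_trichotomy u w with h' | h' | h'
    · have := hlt u w h' hw; omega
    · exact h'
    · have := hlt w u h' hu; omega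
  let d : ℕ → ℕ := fun a => (Finset.univ.filter fun i => g i = S (a - 1)).card
  let e : ℕ → ℕ := fun a => S a - S (a - 1)
  have he : ∀ u, ∑ a ∈ Finset.Icc 1 u, e a = S u := by
    intro u
    induction u with
    | zero => simp [hS0]
    | succ u ih =>
      rw [Finset.sum_Icc_succ_top (by omega), ih]
      have := hmono u
      simp only [e, Nat.add_sub_cancel]
      omega
  have hd : ∀ u, u ≤ r → ∑ a ∈ Finset.Icc 1 u, d a =
      (Finset.univ.filter fun i => ∃ a, a < u ∧ g i = S a).card := by
    intro u
    induction u with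
    | zero => simp
    | succ u ih =>
      intro hu
      rw [Finset.sum_Icc_succ_top (by omega), ih (by omega)]
      simp only [d, Nat.add_sub_cancel]
      rw [← Finset.card_union_of_disjoint]
      · congr 1
        ext i
        simp only [Finset.mem_union, Finset.mem_filter, Finset.mem_univ, true_and,
          Nat.lt_succ_iff_lt_or_eq, or_and_right, exists_or, exists_eq_left]
      · rw [Finset.disjoint_filter]
        rintro i - ⟨a, ha, h1⟩ h2
        have := hlt a u ha (by omega)
        omega
  have hex : ∀ i, ∃ a, a < r ∧ g i = S a := by
    intro i
    obtain ⟨u, hu, h⟩ := hsurj (g i)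
      (Finset.mem_insert_of_mem (Finset.mem_image_of_mem g (Finset.mem_univ i)))
    exact ⟨u, hu, h.symm⟩
  let D : EpsDelta n m :=
    { r := r
      one_le_r := hr1
      d := d
      e := e
      d_pos := by
        intro a ha har
        have h1 := hmem (a - 1) (by omega)
        have h2 := hlt 0 (a - 1) (by omega) (by omega)
        rw [hW, Finset.mem_insert, Finset.mem_image] at h1
        rcases h1 with h | ⟨i, -, h⟩
        · omega
        · exact Finset.card_pos.2 ⟨i, by simp [h]⟩
      e_pos := by
        intro a ha har
        have := hlt (a - 1) a (by omega) har
        simp only [e]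
        omega
      sum_d := by
        rw [hd r le_rfl, Finset.filter_true_of_mem fun i _ => hex i, Finset.card_univ,
          Fintype.card_fin]
      sum_e := by rw [he, hSr r le_rfl]
      s := s
      t := t
      ξ := ξ
      η := η }
  refine ⟨D, rfl, rfl, rfl, rfl, fun i => ?_⟩
  obtain ⟨u, hu, hgi⟩ := hex i
  have hb : D.blockδ i = u := by
    refine D.blockδ_eq ?_ ?_
    · rw [EpsDelta.dSum, hd u hu.le]
      conv_rhs => rw [← card_filter_val_lt (N := n) i.2.le]
      refine Finset.card_le_card fun i' hi' => ?_
      simp only [Finset.mem_filter, Finset.mem_univ, true_and] at hi' ⊢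
      obtain ⟨a, ha, h⟩ := hi'
      have h1 := hlt a u ha hu
      by_contra! hc
      have := hg (show i ≤ i' from hc)
      omega
    · rw [EpsDelta.dSum, hd (u + 1) hu, ← Nat.succ_le_iff]
      conv_lhs => rw [← card_filter_val_lt (N := n) (k := (i : ℕ).succ) i.2]
      refine Finset.card_le_card fun i' hi' => ?_
      simp only [Finset.mem_filter, Finset.mem_univ, true_and] at hi' ⊢
      have h1 := hg (show i' ≤ i from Nat.lt_succ_iff.1 hi')
      obtain ⟨a, ha, h⟩ := hex i'
      refine ⟨a, ?_, h⟩
      by_contra! hc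
      have := hlt u a (by omega) ha
      omega
  rw [EpsDelta.epsBefore, hb, EpsDelta.eSum, hgi]
  exact he u

/-- Sorting the letters of each type by position gives `s` and `t`. The order is then determined by
how many letters `ε` precede each letter `δ`, a monotone sequence. -/
theorem Chamber.exists_epsDelta (C : Chamber n m) : ∃ D : EpsDelta n m, D.chamber = C := by
  have sort : ∀ {N : ℕ} (g : Fin N → ℕ), Function.Injective g →
      ∃ s : Equiv.Perm (Fin N), StrictMono (g ∘ s) := fun g hg =>
    ⟨Tuple.sort g, (Tuple.monotone_sort g).strictMono_of_injective
      (hg.comp (Tuple.sort g).injective)⟩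
  obtain ⟨s, hs⟩ := sort (fun i : Fin n => (C.pos (Sum.inl i) : ℕ))
    (Fin.val_injective.comp (C.pos.injective.comp Sum.inl_injective))
  obtain ⟨t, ht⟩ := sort (fun j : Fin m => (C.pos (Sum.inr j) : ℕ))
    (Fin.val_injective.comp (C.pos.injective.comp Sum.inr_injective))
  let g : Fin n → ℕ := fun i => C.cntε (C.pos (Sum.inl (s i)))
  have hgm : ∀ i, g i ≤ m := fun i => (Finset.card_le_univ _).trans (by simp)
  have hg : Monotone g := by
    intro i i' h
    refine Finset.card_le_card fun j hj => ?_
    rw [Finset.mem_filter] at hj ⊢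
    exact ⟨hj.1, hj.2.trans_le (hs.monotone h)⟩
  have hgj : ∀ (i : Fin n) (j : Fin m), (j : ℕ) < g i ↔
      (C.pos (Sum.inr (t j)) : ℕ) < C.pos (Sum.inl (s i)) := by
    intro i j
    have hcard : g i = (Finset.univ.filter fun j : Fin m =>
        (C.pos (Sum.inr (t j)) : ℕ) < C.pos (Sum.inl (s i))).card := by
      refine (Finset.card_equiv t fun j => ?_).symm
      simp
    constructor
    · intro h
      by_contra! hc
      have : g i ≤ j := by
        rw [hcard, ← card_filter_val_lt (N := m) j.2.le]
        refine Finset.card_le_card fun j' hj' => ?_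
        simp only [Finset.mem_filter, Finset.mem_univ, true_and] at hj' ⊢
        exact ht.lt_iff_lt.1 (hj'.trans_le hc)
      omega
    · intro h
      rw [hcard, ← Nat.succ_le_iff, ← card_filter_val_lt (N := m) (k := (j : ℕ).succ) j.2]
      refine Finset.card_le_card fun j' hj' => ?_
      simp only [Finset.mem_filter, Finset.mem_univ, true_and] at hj' ⊢
      exact (ht.monotone (show j' ≤ j from Nat.lt_succ_iff.1 hj')).trans_lt h
  obtain ⟨D, rfl, rfl, hξ, hη, hD⟩ := OspB.exists_epsDelta hg hgm s t
    (fun i => C.sign (Sum.inl (s i))) (fun j => C.sign (Sum.inr (t j)))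
  refine ⟨D, ?_⟩
  have hpos : D.chamber.pos = C.pos := by
    symm
    refine equiv_fin_unique fun x y hxy => ?_
    obtain ⟨x, rfl⟩ := (Equiv.sumCongr D.s D.t).surjective x
    obtain ⟨y, rfl⟩ := (Equiv.sumCongr D.s D.t).surjective y
    rw [Fin.lt_def, D.pos_chamber, D.pos_chamber]
    rw [Fin.lt_def] at hxy
    rcases x with i | j <;> rcases y with i' | j' <;>
      simp only [EpsDelta.place, Equiv.sumCongr_apply, Sum.map_inl, Sum.map_inr] at hxy ⊢
    · have h := hs.lt_iff_lt.1 hxy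
      have h1 : (i : ℕ) < i' := h
      have h2 := D.epsBefore_mono h.le
      omega
    · have h1 := (hgj i j').not.2 (by omega)
      have h2 := D.lt_epsBefore_iff i j'
      rw [hD] at *
      omega
    · have h1 := (hgj i' j).2 hxy
      have h2 := D.lt_epsBefore_iff i' j
      rw [hD] at *
      omega
    · have h := ht.lt_iff_lt.1 hxy
      have h1 : (j : ℕ) < j' := h
      have h2 := D.delBefore_mono h.le
      omega
  have hsign : D.chamber.sign = C.sign := by
    funext x
    rcases x with i | j <;> simp [EpsDelta.chamber, hξ, hη]
  calc D.chamber = ⟨D.chamber.pos, D.chamber.sign⟩ := rfl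
    _ = C := by rw [hpos, hsign]

/-! ### The standard Borel subalgebra -/

/-- The signed `εδ`-sequence of the standard Borel subalgebra. -/
def stdEpsDelta (n m : ℕ) : EpsDelta n m where
  r := 1
  one_le_r := le_rfl
  d _ := n
  e _ := m
  d_pos := by omega
  e_pos := by omega
  sum_d := by simp
  sum_e := by simp
  s := 1
  t := 1
  ξ _ := 1
  η _ := 1

theorem simpleRoots_stdEpsDelta_subset : (stdEpsDelta n m).simpleRoots ⊆ stdSimpleRoots n m := by
  have hδ : ∀ i, (stdEpsDelta n m).sδ i = δ i := fun i => by simp [EpsDelta.sδ, stdEpsDelta]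
  have hε : ∀ j, (stdEpsDelta n m).sε j = ε j := fun j => by simp [EpsDelta.sε, stdEpsDelta]
  have hd : (stdEpsDelta n m).dSum 1 = n := by simp [EpsDelta.dSum, stdEpsDelta]
  have he : (stdEpsDelta n m).eSum 1 = m := by simp [EpsDelta.eSum, stdEpsDelta]
  have hr : (stdEpsDelta n m).r = 1 := rfl
  have hem : (stdEpsDelta n m).e 1 = m := rfl
  rintro α (⟨i, i', h1, h2, rfl⟩ | ⟨j, j', h1, h2, rfl⟩ | ⟨u, h1, h2, h3, i, j, h4, h5, rfl⟩ |
      ⟨u, h1, h2, i, j, h3, h4, rfl⟩ | ⟨h1, j, h2, rfl⟩ | ⟨h1, i, h2, rfl⟩)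
  · exact Or.inl ⟨i, i', h1, by rw [hδ, hδ]⟩
  · exact Or.inr (Or.inr (Or.inl ⟨j, j', h1, by rw [hε, hε]⟩))
  · rw [hr] at h2
    obtain rfl : u = 1 := by omega
    rw [hd] at h4
    exact Or.inr (Or.inl ⟨i, j, h4, h5, by rw [hδ, hε]⟩)
  · rw [hr] at h2
    omega
  · rw [hr, he] at h2
    exact Or.inr (Or.inr (Or.inr (Or.inl ⟨j, h2, hε j⟩)))
  · rw [hr, hd] at h2
    rw [hr, hem] at h1
    exact Or.inr (Or.inr (Or.inr (Or.inr ⟨i, h1, h2, hδ i⟩)))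

theorem mem_dropRows {lam : YoungDiagram} {k i j : ℕ} :
    (i, j) ∈ dropRows k lam ↔ (k + i, j) ∈ lam := by
  rw [← YoungDiagram.mem_cells, ← YoungDiagram.mem_cells]
  simp only [dropRows, Finset.mem_image, Finset.mem_filter, Prod.mk.injEq, Prod.exists]
  constructor
  · rintro ⟨a, b, ⟨h, hk⟩, rfl, rfl⟩
    rwa [Nat.add_sub_cancel' hk]
  · intro h
    exact ⟨k + i, j, ⟨h, by omega⟩, by omega, rfl⟩

theorem colLen_dropRows (lam : YoungDiagram) (k j : ℕ) :
    (dropRows k lam).colLen j = lam.colLen j - k := by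
  refine eq_of_forall_lt_iff fun i => ?_
  rw [← YoungDiagram.mem_iff_lt_colLen, mem_dropRows, YoungDiagram.mem_iff_lt_colLen]
  omega

theorem weight_stdEpsDelta (lam : YoungDiagram) :
    (stdEpsDelta n m).weight lam = hashWeight n m lam := by
  have hd : (stdEpsDelta n m).dSum 1 = n := by simp [EpsDelta.dSum, stdEpsDelta]
  have hp : ∀ i, (stdEpsDelta n m).p lam i = lam.rowLen i := by
    intro i
    have h : (stdEpsDelta n m).blockδ i = 0 :=
      Nat.lt_one_iff.1 ((stdEpsDelta n m).blockδ_spec i).1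
    rw [EpsDelta.p_eq, EpsDelta.epsBefore, h, EpsDelta.eSum_zero, Nat.sub_zero]
  have hq : ∀ j, (stdEpsDelta n m).q lam j = (dropRows n lam).colLen j := by
    intro j
    have h : (stdEpsDelta n m).blockε j = 0 :=
      Nat.lt_one_iff.1 ((stdEpsDelta n m).blockε_spec j).1
    rw [EpsDelta.q_eq, EpsDelta.delBefore, h, zero_add, hd, colLen_dropRows]
  simp only [EpsDelta.weight, hashWeight, hp, hq]
  simp [stdEpsDelta]

end OspB

end

/-! ### The theorem on highest weights -/

theorem mainTheorem7 (n m : ℕ) (lam : YoungDiagram) (hlam : OspB.IsHook n m lam)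
    {V : Type*} [AddCommGroup V] [Module ℂ V] (L : OspB.OspModule n m V)
    (hL : L.IsIrreducible)
    (Bst : Submodule ℂ (OspB.osp n m)) (hBst : OspB.IsBorel Bst)
    (hst : OspB.simpleRoots Bst = OspB.stdSimpleRoots n m)
    (hw : L.HasHighestWeight Bst (OspB.hashWeight n m lam))
    (B : Submodule ℂ (OspB.osp n m)) (hB : OspB.IsBorel B) :
    (∃ D : OspB.EpsDelta n m, OspB.simpleRoots B = D.simpleRoots) ∧
    ∀ D : OspB.EpsDelta n m, OspB.simpleRoots B = D.simpleRoots →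
      ∀ μ : OspB.Weight n m, L.HasHighestWeight B μ ↔ μ = D.weight lam := by
  obtain ⟨f, hf⟩ := hB
  obtain ⟨f₀, hf₀⟩ := hBst
  refine ⟨?_, fun D hD μ => ?_⟩
  · obtain ⟨C, hC⟩ := OspB.Chamber.exists_agrees hf.1
    obtain ⟨D, rfl⟩ := C.exists_epsDelta
    exact ⟨D, by rw [hC.simpleRoots_eq hf, D.simpleRoots_chamber]⟩
  -- Positivity of `f` on the simple roots already ties `D` to `f`, so uniqueness of the data plays
  -- no role.
  · have hag : D.chamber.Agrees f := OspB.Chamber.agrees_of_simpleRoots_pos fun α hα => by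
      rw [D.simpleRoots_chamber, ← hD] at hα
      exact ((OspB.IsBorelOf.mem_posRoots hf).1 hα.1).2
    have hag₀ : (OspB.stdEpsDelta n m).chamber.Agrees f₀ :=
      OspB.Chamber.agrees_of_simpleRoots_pos fun α hα => by
        rw [OspB.EpsDelta.simpleRoots_chamber] at hα
        -- Only this inclusion matters: `f₀` has to be positive on the simple roots of the standard
        -- chamber.
        have h := OspB.simpleRoots_stdEpsDelta_subset hα
        rw [← hst] at h
        exact ((OspB.IsBorelOf.mem_posRoots hf₀).1 h.1).2
    rw [OspB.OspModule.hasHighestWeight_iff hL hag₀ hf₀, ← OspB.weight_stdEpsDelta,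
      ← OspB.EpsDelta.weight_chamber] at hw
    have hex := OspB.OspModule.exists_isHighest hL lam _ hw D.chamber
    rw [D.weight_chamber] at hex
    rw [OspB.OspModule.hasHighestWeight_iff hL hag hf]
    constructor
    · rintro ⟨l, v, hv⟩
      obtain ⟨l', v', hv'⟩ := hex
      exact hv'.weight_unique hL D.chamber.functional_injective hv
    · rintro rfl
      exact hex
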